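/- **Theorem (hypercircle).** Let $\Omega\subset\mathbb R^2$ be a bounded polygonal domain (open, connected, with Lipschitz boundary $\Gamma=\partial\Omega$ and outward unit normal $\bm n$), and let $\mathcal T_h$ be a conforming triangulation of $\overline\Omega$. Write $V=H^1(\Omega)$, let $\|\cdot\|$ be the norm of $L^2(\Omega)$ or $L^2(\Omega)^2$, and set $$a(u,v)=\int_\Omega(\nabla u\cdot\nabla v+uv)\,dx,\qquad b(f,v)=\int_\Gamma f v\,ds,\qquad \|f\|_b=\sqrt{b(f,f)},\qquad \|v\|_{H^1(\Omega)}^2=\|\nabla v\|^2+\|v\|^2,$$ where functions $v\in V$ enter $b$ through their trace on $\Gamma$. Define * $V^h=\{v\in V: v|_K\in P_1(K)\ \forall K\in\mathcal T_h\}$; * $X^h_\Gamma=\{f\in L^2(\Gamma): f|_e\in P_1(e)$ for every edge $e\subset\Gamma$ of $\mathcal T_h\}$; * the Raviart–Thomas space of order one $W^h$, the set of $p\in H(\mathrm{div},\Omega)$ such that on every $K\in\mathcal T_h$ one has $p=(a_K,b_K)^T+c_K\,(x,y)^T$ with $a_K,b_K,c_K\in P_1(K)$; * for $f\in X^h_\Gamma$,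 the set $W^h_{f}=\{p\in W^h: p\cdot\bm n=f \text{ on }\Gamma\}$. Given $f_h\in X^h_\Gamma$, let $\tilde u\in V$ and $\tilde u_h\in V^h$ satisfy $$a(\tilde u,v)=b(f_h,v)\quad\forall v\in V,\qquad a(\tilde u_h,v_h)=b(f_h,v_h)\quad\forall v_h\in V^h .$$ Then every $p_h\in W^h_{f_h}$ with $\operatorname{div}p_h=\tilde u_h$ satisfies $$\|\nabla\tilde u_h-p_h\|^2=\|\tilde u-\tilde u_h\|_{H^1(\Omega)}^2+\|\nabla\tilde u-p_h\|^2+\|\tilde u-\tilde u_h\|^2 ,$$ and consequently $$\|\tilde u-\tilde u_h\|_{H^1(\Omega)}\le\kappa_h\|f_h\|_b ,\qquad \kappa_h:=\max_{f_h\in X^h_\Gamma\setminus\{0\}}\ \min_{p_h\in W^h_{f_h},\ \operatorname{div}p_h=\tilde u_h}\ \frac{\|\nabla\tilde u_h-p_h\|}{\|f_h\|_b},$$ where in the definition of $\kappa_h$ the function $\tilde u_h\in V^h$ is the finite element solution for $f_h$. In particular, for every $f_h\in X_\Gamma^h\setminus\{0\}$ the set of admissible $p_h$ is non-empty and the minimum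 is attained, and the maximum over $f_h$ is attained. -/

import Mathlib

open MeasureTheory Set
open scoped ContDiff

noncomputable section

namespace Hypercircle

/-- The Euclidean plane. -/
abbrev Plane : Type := EuclideanSpace ℝ (Fin 2)

/-- A bounded domain with Lipschitz boundary: near each boundary point, in suitable Cartesian
coordinates, the domain is the part of the plane above the graph of a Lipschitz function. -/
structure IsLipschitzDomain (Ω : Set Plane) : Prop where
  isOpen : IsOpen Ω
  isConnected : IsConnected Ω
  isBounded : Bornology.IsBounded Ω
  lipschitz_boundary : ∀ x ∈ frontier Ω,
    ∃ (R : Plane ≃ₗᵢ[ℝ] Plane) (ψ : ℝ → ℝ) (L : NNReal) (r : ℝ),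
      LipschitzWith L ψ ∧ 0 < r ∧
        ∀ y ∈ Metric.ball x r, y ∈ Ω ↔ ψ (R y 0) < R y 1

/-- A (conforming) triangulation of a domain: a finite geometric simplicial complex whose
underlying space is the closed domain. A domain that has one is polygonal. -/
structure IsTriangulation (Ω : Set Plane) (T : Geometry.SimplicialComplex ℝ Plane) : Prop where
  finite_faces : T.faces.Finite
  space_eq : T.space = closure Ω

/-- The triangles (elements) of the triangulation, each given by its set of vertices. -/
def triangles (T : Geometry.SimplicialComplex ℝ Plane) : Set (Finset Plane) :=
  {K | K ∈ T.faces ∧ K.card = 3}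

/-- The edges of the triangulation that lie on the boundary `Γ = ∂Ω`, each given by its two
end points. -/
def boundaryEdges (Ω : Set Plane) (T : Geometry.SimplicialComplex ℝ Plane) :
    Set (Finset Plane) :=
  {e | e ∈ T.faces ∧ e.card = 2 ∧ convexHull ℝ (e : Set Plane) ⊆ frontier Ω}

/-- `n` is the unit normal to the edge `e` of the triangle `K` that points out of `K`. -/
def IsOutwardNormal (K e : Finset Plane) (n : Plane) : Prop :=
  ‖n‖ = 1 ∧ (∀ x ∈ e, ∀ y ∈ e, inner ℝ n (y - x) = 0) ∧
    ∀ x ∈ e, ∀ z ∈ K, inner ℝ n (z - x) ≤ 0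

/-- `L²(Ω)`. -/
abbrev L2 (Ω : Set Plane) : Type := Lp ℝ 2 (volume.restrict Ω)

/-- `L²(Ω)²`. -/
abbrev L2Vec (Ω : Set Plane) : Type := Lp Plane 2 (volume.restrict Ω)

/-- `L²(Γ)` with respect to arc length (one-dimensional Hausdorff measure) on `Γ = ∂Ω`. Its inner
product is `b(f, g) = ∫_Γ f g ds`, its norm is `‖f‖_b`. -/
abbrev L2Bdry (Ω : Set Plane) : Type :=
  Lp ℝ 2 ((Measure.hausdorffMeasure 1 : Measure Plane).restrict (frontier Ω))

/-- Test functions: the smooth functions with compact support in `Ω`. -/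
def testFunctions (Ω : Set Plane) : Set (Plane → ℝ) :=
  {φ | ContDiff ℝ ∞ φ ∧ HasCompactSupport φ ∧ tsupport φ ⊆ Ω}

/-- `H¹(Ω)`, as the set of all pairs `(u, ∇u)` of a function in `L²(Ω)` and its weak gradient
in `L²(Ω)²`. -/
def H1 (Ω : Set Plane) : Set (L2 Ω × L2Vec Ω) :=
  {u | ∀ φ ∈ testFunctions Ω,
    ∫ x in Ω, u.1 x • gradient φ x = -∫ x in Ω, φ x • u.2 x}

/-- `H(div, Ω)`, as the set of all pairs `(p, div p)` of a field in `L²(Ω)²` and its weak divergence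
in `L²(Ω)`. -/
def HDiv (Ω : Set Plane) : Set (L2Vec Ω × L2 Ω) :=
  {p | ∀ φ ∈ testFunctions Ω,
    ∫ x in Ω, inner ℝ (p.1 x) (gradient φ x) = -∫ x in Ω, p.2 x * φ x}

/-- The norm of `H¹(Ω)`. -/
def h1Norm {Ω : Set Plane} (u : L2 Ω × L2Vec Ω) : ℝ := Real.sqrt (‖u.1‖ ^ 2 + ‖u.2‖ ^ 2)

/-- `a(u, v) = ∫_Ω (∇u · ∇v + u v) dx`. -/
def aForm {Ω : Set Plane} (u v : L2 Ω × L2Vec Ω) : ℝ := inner ℝ u.2 v.2 + inner ℝ u.1 v.1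

/-- The graph of the restriction to the boundary of functions that are smooth on the closed
domain (restrictions of smooth functions on the plane). -/
def smoothTraceGraph (Ω : Set Plane) : Set ((L2 Ω × L2Vec Ω) × L2Bdry Ω) :=
  {w | ∃ φ : Plane → ℝ, ContDiff ℝ ∞ φ ∧ (w.1.1 : Plane → ℝ) =ᵐ[volume.restrict Ω] φ ∧
    (w.1.2 : Plane → Plane) =ᵐ[volume.restrict Ω] gradient φ ∧
    (w.2 : Plane → ℝ) =ᵐ[(Measure.hausdorffMeasure 1).restrict (frontier Ω)] φ}

/-- `g ∈ L²(Γ)` is the trace of `v ∈ H¹(Ω)`: there are functions `φₙ`, smooth on the closed domain,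
with `φₙ → v` in `H¹(Ω)` and `φₙ|_Γ → g` in `L²(Γ)`. -/
def HasTrace {Ω : Set Plane} (v : L2 Ω × L2Vec Ω) (g : L2Bdry Ω) : Prop :=
  (v, g) ∈ closure (smoothTraceGraph Ω)

open Classical in
/-- The trace operator `H¹(Ω) → L²(Γ)`, the extension by continuity of the restriction to `Γ`. -/
def trace {Ω : Set Plane} (v : L2 Ω × L2Vec Ω) : L2Bdry Ω :=
  if h : ∃ g, HasTrace v g then h.choose else 0

/-- `b(f, v) = ∫_Γ f v ds` for `f ∈ L²(Γ)` and `v ∈ H¹(Ω)`. -/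
def bForm {Ω : Set Plane} (f : L2Bdry Ω) (v : L2 Ω × L2Vec Ω) : ℝ := inner ℝ f (trace v)

/-- `V^h`: the functions in `H¹(Ω)` that are polynomials of degree at most one on each triangle. -/
def Vh (Ω : Set Plane) (T : Geometry.SimplicialComplex ℝ Plane) : Set (L2 Ω × L2Vec Ω) :=
  {v | v ∈ H1 Ω ∧ ∀ K ∈ triangles T, ∃ A : Plane →ᵃ[ℝ] ℝ,
    (v.1 : Plane → ℝ) =ᵐ[volume.restrict (convexHull ℝ (K : Set Plane))] A}

/-- `X_Γ^h`: the functions in `L²(Γ)` that are polynomials of degree at most one on each boundary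
edge. -/
def XGamma (Ω : Set Plane) (T : Geometry.SimplicialComplex ℝ Plane) : Set (L2Bdry Ω) :=
  {f | ∀ e ∈ boundaryEdges Ω T, ∃ A : Plane →ᵃ[ℝ] ℝ,
    (f : Plane → ℝ) =ᵐ[(Measure.hausdorffMeasure 1).restrict (convexHull ℝ (e : Set Plane))] A}

/-- The local Raviart–Thomas field of order one `(a, b) + c (x, y)`, where `(a, b) = A` and `c` have
degree at most one. -/
def rtField (A : Plane →ᵃ[ℝ] Plane) (c : Plane →ᵃ[ℝ] ℝ) (x : Plane) : Plane := A x + c x • x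

/-- The Raviart–Thomas space `W^h` of order one. -/
def Wh (Ω : Set Plane) (T : Geometry.SimplicialComplex ℝ Plane) : Set (L2Vec Ω × L2 Ω) :=
  {p | p ∈ HDiv Ω ∧ ∀ K ∈ triangles T, ∃ (A : Plane →ᵃ[ℝ] Plane) (c : Plane →ᵃ[ℝ] ℝ),
    (p.1 : Plane → Plane) =ᵐ[volume.restrict (convexHull ℝ (K : Set Plane))] rtField A c}

/-- `W^h_f`: the fields `p ∈ W^h` with `p · n = f` on `Γ`. On a boundary edge `e` of a triangle `K`,
the values of `p` are those of the polynomial field with which `p` agrees on `K`. -/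
def WhF (Ω : Set Plane) (T : Geometry.SimplicialComplex ℝ Plane) (f : L2Bdry Ω) :
    Set (L2Vec Ω × L2 Ω) :=
  {p | p ∈ Wh Ω T ∧ ∀ K ∈ triangles T, ∀ e ∈ boundaryEdges Ω T, e ⊆ K →
    ∀ (A : Plane →ᵃ[ℝ] Plane) (c : Plane →ᵃ[ℝ] ℝ),
      (p.1 : Plane → Plane) =ᵐ[volume.restrict (convexHull ℝ (K : Set Plane))] rtField A c →
    ∀ n : Plane, IsOutwardNormal K e n →
      (f : Plane → ℝ) =ᵐ[(Measure.hausdorffMeasure 1).restrict (convexHull ℝ (e : Set Plane))]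
        fun x => inner ℝ (rtField A c x) n}

/-- `u ∈ H¹(Ω)` solves `a(u, v) = b(f, v)` for all `v ∈ H¹(Ω)`: the weak form of `-Δu + u = 0` in
`Ω`, `∂u/∂n = f` on `Γ`. -/
def IsWeakSolution {Ω : Set Plane} (f : L2Bdry Ω) (u : L2 Ω × L2Vec Ω) : Prop :=
  u ∈ H1 Ω ∧ ∀ v ∈ H1 Ω, aForm u v = bForm f v

/-- `u ∈ V^h` solves `a(u, v) = b(f, v)` for all `v ∈ V^h`. -/
def IsFEMSolution {Ω : Set Plane} (T : Geometry.SimplicialComplex ℝ Plane) (f : L2Bdry Ω)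
    (u : L2 Ω × L2Vec Ω) : Prop :=
  u ∈ Vh Ω T ∧ ∀ v ∈ Vh Ω T, aForm u v = bForm f v

/-- The ratios `‖∇u_h - p_h‖ / ‖f‖_b` over all `p_h ∈ W^h_f` with `div p_h = u_h`, where `u_h` is the
finite element solution for the datum `f`. -/
def ratios {Ω : Set Plane} (T : Geometry.SimplicialComplex ℝ Plane) (f : L2Bdry Ω) : Set ℝ :=
  {r | ∃ (u : L2 Ω × L2Vec Ω) (p : L2Vec Ω × L2 Ω), IsFEMSolution T f u ∧ p ∈ WhF Ω T f ∧
    p.2 = u.1 ∧ r = ‖u.2 - p.1‖ / ‖f‖}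

/-- `κ_h`, the maximum over `f ∈ X_Γ^h \ {0}` of the minimum of the ratios. -/
def kappa (Ω : Set Plane) (T : Geometry.SimplicialComplex ℝ Plane) : ℝ :=
  sSup {m | ∃ f ∈ XGamma Ω T, f ≠ 0 ∧ m = sInf (ratios T f)}

end Hypercircle

end

open Hypercircle

namespace Hypercircle

/-- `K` is the vertex set of a nondegenerate triangle. -/
structure IsTri (K : Finset Plane) : Prop where
  indep : AffineIndependent ℝ ((↑) : K → Plane)
  card : K.card = 3

/-- The affine basis of the plane formed by the vertices of a triangle. -/
noncomputable def IsTri.basis {K : Finset Plane} (h : IsTri K) : AffineBasis K ℝ Plane where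
  toFun := (↑)
  ind' := h.indep
  tot' := by
    rw [h.indep.affineSpan_eq_top_iff_card_eq_finrank_add_one]
    simp [h.card]

open Classical in
/-- The barycentric coordinate of the triangle `K` that belongs to the vertex `a`. -/
noncomputable def lam (K : Finset Plane) (a : Plane) : Plane →ᵃ[ℝ] ℝ :=
  if h : IsTri K ∧ a ∈ K then h.1.basis.coord ⟨a, h.2⟩ else 0

namespace IsTri

variable {K : Finset Plane} {a b x : Plane}

theorem lam_eq (h : IsTri K) (ha : a ∈ K) : lam K a = h.basis.coord ⟨a, ha⟩ :=
  dif_pos ⟨h, ha⟩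

theorem lam_self (h : IsTri K) (ha : a ∈ K) : lam K a a = 1 := by
  rw [h.lam_eq ha]
  exact h.basis.coord_apply_eq ⟨a, ha⟩

theorem lam_of_ne (h : IsTri K) (ha : a ∈ K) (hb : b ∈ K) (hab : a ≠ b) : lam K a b = 0 := by
  rw [h.lam_eq ha]
  exact h.basis.coord_apply_ne (i := ⟨a, ha⟩) (j := ⟨b, hb⟩) (by simpa [Subtype.ext_iff] using hab)

theorem sum_lam (h : IsTri K) (x : Plane) : ∑ a ∈ K, lam K a x = 1 := by
  rw [← Finset.sum_coe_sort, ← h.basis.sum_coord_apply_eq_one x]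
  exact Finset.sum_congr rfl fun i _ => by rw [h.lam_eq i.2]

theorem sum_lam_smul (h : IsTri K) (x : Plane) : ∑ a ∈ K, lam K a x • a = x := by
  rw [← Finset.sum_coe_sort]
  conv_rhs => rw [← h.basis.linear_combination_coord_eq_self x]
  exact Finset.sum_congr rfl fun i _ => by rw [h.lam_eq i.2]; rfl

theorem affineMap_eq {E : Type*} [AddCommGroup E] [Module ℝ E] (h : IsTri K)
    (g : Plane →ᵃ[ℝ] E) (x : Plane) : g x = ∑ a ∈ K, lam K a x • g a := by
  have key : ∀ y, g y = g.linear y + g 0 := fun y => by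
    have := g.map_vadd 0 y
    rwa [vadd_eq_add, vadd_eq_add, add_zero] at this
  rw [Finset.sum_congr rfl fun a _ => by rw [key a, smul_add], Finset.sum_add_distrib,
    ← Finset.sum_smul, h.sum_lam, one_smul, key]
  conv_lhs => rw [← h.sum_lam_smul x, map_sum]
  simp only [map_smul]

theorem range_basis (h : IsTri K) : range h.basis = (K : Set Plane) := by
  change range ((↑) : K → Plane) = _
  simp

theorem mem_convexHull (h : IsTri K) :
    x ∈ convexHull ℝ (K : Set Plane) ↔ ∀ a ∈ K, 0 ≤ lam K a x := by
  rw [← h.range_basis, h.basis.convexHull_eq_nonneg_coord]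
  constructor
  · intro hx a ha
    rw [h.lam_eq ha]; exact hx _
  · intro hx i
    rw [← h.lam_eq i.2]; exact hx _ i.2

theorem mem_interior (h : IsTri K) :
    x ∈ interior (convexHull ℝ (K : Set Plane)) ↔ ∀ a ∈ K, 0 < lam K a x := by
  rw [← h.range_basis, h.basis.interior_convexHull]
  constructor
  · intro hx a ha
    rw [h.lam_eq ha]; exact hx _
  · intro hx i
    rw [← h.lam_eq i.2]; exact hx _ i.2

theorem lam_nonneg (h : IsTri K) (ha : a ∈ K) (hx : x ∈ convexHull ℝ (K : Set Plane)) :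
    0 ≤ lam K a x := h.mem_convexHull.1 hx a ha

/-- Points of the hull of a set of vertices have vanishing barycentric coordinate at the others. -/
theorem lam_eq_zero (h : IsTri K) (ha : a ∈ K) {s : Set Plane} (hs : s ⊆ K) (has : a ∉ s)
    (hx : x ∈ convexHull ℝ s) : lam K a x = 0 := by
  have hc : Convex ℝ (lam K a ⁻¹' {0}) := (convex_singleton (𝕜 := ℝ) (0 : ℝ)).affine_preimage _
  have hsub : s ⊆ lam K a ⁻¹' {0} := fun y hy =>
    h.lam_of_ne ha (hs hy) (fun e => has (e ▸ hy))
  exact convexHull_min hsub hc hx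

theorem mem_convexHull_erase (h : IsTri K) (ha : a ∈ K) :
    x ∈ convexHull ℝ (K.erase a : Set Plane) ↔
      x ∈ convexHull ℝ (K : Set Plane) ∧ lam K a x = 0 := by
  constructor
  · intro hx
    exact ⟨convexHull_mono (by simp) hx, h.lam_eq_zero ha (by simp) (by simp) hx⟩
  · rintro ⟨hx, h0⟩
    have e := h.sum_lam_smul x
    have e1 := h.sum_lam x
    rw [← Finset.add_sum_erase _ _ ha, h0] at e e1
    rw [zero_smul, zero_add] at e
    rw [zero_add] at e1
    rw [← e]
    refine (convex_convexHull ℝ _).sum_mem (fun i hi => ?_) e1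
      (fun i hi => subset_convexHull _ _ hi)
    exact h.lam_nonneg (Finset.mem_of_mem_erase hi) hx

theorem eq_of_lam_eq_zero (h : IsTri K) (ha : a ∈ K) (h0 : ∀ b ∈ K, b ≠ a → lam K b x = 0) :
    x = a := by
  have e := h.sum_lam_smul x
  have e1 := h.sum_lam x
  rw [Finset.sum_eq_single a (fun b hb hba => by rw [h0 b hb hba]) (by simp [ha])] at e1
  rw [Finset.sum_eq_single a (fun b hb hba => by rw [h0 b hb hba, zero_smul]) (by simp [ha]),
    e1, one_smul] at e
  exact e.symm

theorem continuous_lam (K : Finset Plane) (a : Plane) : Continuous (lam K a) :=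
  (lam K a).continuous_of_finiteDimensional

theorem nonempty (h : IsTri K) : K.Nonempty := by
  rw [← Finset.card_pos, h.card]; norm_num

theorem isCompact (K : Finset Plane) : IsCompact (convexHull ℝ (K : Set Plane)) :=
  K.finite_toSet.isCompact_convexHull (𝕜 := ℝ)

theorem interior_nonempty (h : IsTri K) : (interior (convexHull ℝ (K : Set Plane))).Nonempty := by
  have := h.nonempty.to_subtype
  exact ⟨_, h.range_basis ▸ h.basis.centroid_mem_interior_convexHull⟩

theorem subset_closure_interior (h : IsTri K) :
    convexHull ℝ (K : Set Plane) ⊆ closure (interior (convexHull ℝ (K : Set Plane))) := by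
  rw [(convex_convexHull ℝ _).closure_interior_eq_closure_of_nonempty_interior h.interior_nonempty]
  exact subset_closure

/-- The vertices of a triangle, listed with a chosen one in front. -/
theorem exists_eq (h : IsTri K) (ha : a ∈ K) :
    ∃ b c, a ≠ b ∧ a ≠ c ∧ b ≠ c ∧ K = {a, b, c} ∧ K.erase a = {b, c} := by
  have hc : (K.erase a).card = 2 := by rw [Finset.card_erase_of_mem ha, h.card]
  obtain ⟨b, c, hbc, e⟩ := Finset.card_eq_two.1 hc
  have hb : b ∈ K.erase a := by simp [e]
  have hc' : c ∈ K.erase a := by simp [e]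
  refine ⟨b, c, (Finset.ne_of_mem_erase hb).symm, (Finset.ne_of_mem_erase hc').symm, hbc, ?_, e⟩
  rw [← e, Finset.insert_erase ha]

end IsTri

/-- The points of the edge of `K` opposite to `a` other than its end points. -/
def openEdge (K : Finset Plane) (a : Plane) : Set Plane :=
  {x | lam K a x = 0 ∧ ∀ b ∈ K, b ≠ a → 0 < lam K b x}

namespace IsTri

variable {K : Finset Plane} {a b x : Plane}

theorem openEdge_subset (h : IsTri K) (ha : a ∈ K) :
    openEdge K a ⊆ convexHull ℝ (K.erase a : Set Plane) := by
  rintro x ⟨h0, h1⟩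
  refine (h.mem_convexHull_erase ha).2 ⟨h.mem_convexHull.2 fun b hb => ?_, h0⟩
  by_cases e : b = a
  · rw [e, h0]
  · exact (h1 b hb e).le

theorem openEdge_subset_convexHull (h : IsTri K) (ha : a ∈ K) :
    openEdge K a ⊆ convexHull ℝ (K : Set Plane) :=
  (h.openEdge_subset ha).trans (convexHull_mono (by simp))

/-- A point of a closed edge is interior to the edge or an end point. -/
theorem mem_openEdge_of_notMem (h : IsTri K) (ha : a ∈ K) (hx : x ∈ convexHull ℝ (K : Set Plane))
    (h0 : lam K a x = 0) (hv : x ∉ K) : x ∈ openEdge K a := by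
  refine ⟨h0, fun b hb hba => lt_of_le_of_ne (h.lam_nonneg hb hx) fun hb0 => hv ?_⟩
  have : ∃ c ∈ (K.erase a).erase b, True := by
    have : ((K.erase a).erase b).card = 1 := by
      rw [Finset.card_erase_of_mem (by simp [hb, hba]), Finset.card_erase_of_mem ha, h.card]
    obtain ⟨c, hc⟩ := Finset.card_eq_one.1 this
    exact ⟨c, by simp [hc], trivial⟩
  obtain ⟨c, hc, -⟩ := this
  have hK : ((K.erase a).erase b).card = 1 := by
    rw [Finset.card_erase_of_mem (by simp [hb, hba]), Finset.card_erase_of_mem ha, h.card]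
  have hcK : c ∈ K := Finset.mem_of_mem_erase (Finset.mem_of_mem_erase hc)
  rw [h.eq_of_lam_eq_zero hcK (x := x)]
  · exact hcK
  intro d hd hdc
  by_cases hda : d = a
  · rw [hda, h0]
  by_cases hdb : d = b
  · rw [hdb, ← hb0]
  · exact absurd (Finset.card_le_one.1 hK.le d (by simp [hd, hda, hdb]) c hc) hdc

theorem openEdge_nonempty (h : IsTri K) (ha : a ∈ K) : (openEdge K a).Nonempty := by
  obtain ⟨b, c, hab, hac, hbc, hK, -⟩ := h.exists_eq ha
  have hb : b ∈ K := by simp [hK]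
  have hc : c ∈ K := by simp [hK]
  have key : ∀ d, lam K d (AffineMap.lineMap b c (1/2 : ℝ)) = (lam K d b + lam K d c) / 2 := by
    intro d
    rw [AffineMap.apply_lineMap, AffineMap.lineMap_apply]
    simp; ring
  refine ⟨AffineMap.lineMap b c (1/2 : ℝ), ?_, ?_⟩
  · rw [key, h.lam_of_ne ha hb hab, h.lam_of_ne ha hc hac]; norm_num
  · intro d hd hda
    rw [key]
    rw [hK] at hd
    simp only [Finset.mem_insert, Finset.mem_singleton] at hd
    rcases hd with rfl | rfl | rfl
    · exact absurd rfl hda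
    · rw [h.lam_self hb, h.lam_of_ne hb hc hbc]; norm_num
    · rw [h.lam_self hc, h.lam_of_ne hc hb hbc.symm]; norm_num

theorem subset_closure_openEdge (h : IsTri K) (ha : a ∈ K) :
    convexHull ℝ (K.erase a : Set Plane) ⊆ closure (openEdge K a) := by
  intro x hx
  obtain ⟨m, hm0, hm⟩ := h.openEdge_nonempty ha
  obtain ⟨hxK, hx0⟩ := (h.mem_convexHull_erase ha).1 hx
  have hcont : Filter.Tendsto (fun t : ℝ => AffineMap.lineMap x m t) (nhdsWithin 0 (Ioi 0))
      (nhds x) := by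
    have : Continuous (fun t : ℝ => AffineMap.lineMap x m t) := AffineMap.lineMap_continuous
    have h2 := this.tendsto 0
    rw [AffineMap.lineMap_apply_zero] at h2
    exact h2.mono_left nhdsWithin_le_nhds
  refine mem_closure_of_tendsto hcont ?_
  have : ∀ᶠ t : ℝ in nhdsWithin 0 (Ioi 0), t < 1 :=
    nhdsWithin_le_nhds (Iio_mem_nhds one_pos)
  filter_upwards [this, self_mem_nhdsWithin] with t ht1 ht0
  have key : ∀ d, lam K d (AffineMap.lineMap x m t) = (1 - t) * lam K d x + t * lam K d m := by
    intro d
    rw [AffineMap.apply_lineMap, AffineMap.lineMap_apply]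
    simp; ring
  refine ⟨by rw [key, hx0, hm0]; simp, fun b hb hba => ?_⟩
  rw [key]
  have h1 := h.lam_nonneg hb hxK
  have h2 := hm b hb hba
  have h3 : 0 < t * lam K b m := mul_pos ht0 h2
  have h4 : 0 ≤ (1 - t) * lam K b x := mul_nonneg (by linarith) h1
  linarith

/-- Near a point of an open edge, the triangle is a half plane. -/
theorem eventually_mem_of_openEdge (h : IsTri K) (hx : x ∈ openEdge K a) :
    ∀ᶠ y in nhds x, 0 ≤ lam K a y → y ∈ convexHull ℝ (K : Set Plane) := by
  have : ∀ b ∈ K, ∀ᶠ y in nhds x, b ≠ a → 0 < lam K b y := by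
    intro b hb
    by_cases hba : b = a
    · simp [hba]
    · filter_upwards [(continuous_lam K b).continuousAt.eventually (lt_mem_nhds (hx.2 b hb hba))]
        with y hy _ using hy
  filter_upwards [(Filter.eventually_all_finset K).2 this] with y hy h0
  refine h.mem_convexHull.2 fun b hb => ?_
  by_cases hba : b = a
  · rwa [hba]
  · exact (hy b hb hba).le

end IsTri

end Hypercircle

namespace Hypercircle

variable {Ω : Set Plane} {T : Geometry.SimplicialComplex ℝ Plane} {K K' : Finset Plane}
  {a b x : Plane}

theorem isTri_of_mem_triangles (hK : K ∈ triangles T) : IsTri K := ⟨T.indep hK.1, hK.2⟩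

theorem IsTriangulation.finite_triangles (hT : IsTriangulation Ω T) : (triangles T).Finite :=
  hT.finite_faces.subset fun _ h => h.1

/-- The finite set of all triangles. -/
noncomputable def IsTriangulation.tris (hT : IsTriangulation Ω T) : Finset (Finset Plane) :=
  hT.finite_triangles.toFinset

theorem IsTriangulation.mem_tris (hT : IsTriangulation Ω T) : K ∈ hT.tris ↔ K ∈ triangles T := by
  simp [tris]

theorem mem_convexHull_inter (hK : K ∈ triangles T) (hK' : K' ∈ triangles T)
    (hx : x ∈ convexHull ℝ (K : Set Plane)) (hx' : x ∈ convexHull ℝ (K' : Set Plane)) :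
    x ∈ convexHull ℝ (K ∩ K' : Set Plane) :=
  T.inter_subset_convexHull hK.1 hK'.1 ⟨hx, hx'⟩

theorem lam_eq_zero_of_mem (hK : K ∈ triangles T) (hK' : K' ∈ triangles T)
    (hx : x ∈ convexHull ℝ (K : Set Plane)) (hx' : x ∈ convexHull ℝ (K' : Set Plane))
    (ha : a ∈ K) (ha' : a ∉ K') : lam K a x = 0 :=
  (isTri_of_mem_triangles hK).lam_eq_zero ha inter_subset_left (fun h => ha' h.2)
    (mem_convexHull_inter hK hK' hx hx')

theorem exists_mem_notMem (hK : K ∈ triangles T) (hK' : K' ∈ triangles T) (h : K ≠ K') :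
    ∃ a ∈ K, a ∉ K' := by
  by_contra! hc
  exact h (Finset.eq_of_subset_of_card_le hc (by rw [hK.2, hK'.2]))

theorem disjoint_interior (hK : K ∈ triangles T) (hK' : K' ∈ triangles T) (h : K ≠ K') :
    Disjoint (interior (convexHull ℝ (K : Set Plane))) (convexHull ℝ (K' : Set Plane)) := by
  rw [Set.disjoint_left]
  intro x hx hx'
  obtain ⟨a, ha, ha'⟩ := exists_mem_notMem hK hK' h
  have h1 := (isTri_of_mem_triangles hK).mem_interior.1 hx a ha
  rw [lam_eq_zero_of_mem hK hK' (interior_subset hx) hx' ha ha'] at h1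
  exact lt_irrefl _ h1

theorem volume_frontier_convexHull (s : Set Plane) : volume (frontier (convexHull ℝ s)) = 0 :=
  (convex_convexHull ℝ s).addHaar_frontier volume

theorem volume_face_eq_zero {s : Finset Plane} (hs : s ∈ T.faces) (h3 : s.card ≠ 3) :
    volume (convexHull ℝ (s : Set Plane)) = 0 := by
  have hlt : affineSpan ℝ (s : Set Plane) ≠ ⊤ := by
    intro e
    have hi := T.indep hs
    have h2 := hi.affineSpan_eq_top_iff_card_eq_finrank_add_one
    rw [Subtype.range_coe_subtype] at h2
    have h4 := h2.1 e
    simp at h4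
    exact h3 h4
  exact measure_mono_null (convexHull_subset_affineSpan _) (Measure.addHaar_affineSubspace _ _ hlt)

theorem IsTriangulation.convexHull_subset (hT : IsTriangulation Ω T) (hK : K ∈ triangles T) :
    convexHull ℝ (K : Set Plane) ⊆ closure Ω :=
  hT.space_eq ▸ T.convexHull_subset_space hK.1

theorem IsTriangulation.isClosed_biUnion (hT : IsTriangulation Ω T) (s : Set (Finset Plane))
    (hs : s ⊆ triangles T) : IsClosed (⋃ K ∈ s, convexHull ℝ (K : Set Plane)) :=
  (hT.finite_triangles.subset hs).isClosed_biUnion fun K _ => (IsTri.isCompact K).isClosed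

theorem IsTriangulation.closure_eq (hT : IsTriangulation Ω T) (hΩ : IsOpen Ω) :
    closure Ω = ⋃ K ∈ triangles T, convexHull ℝ (K : Set Plane) := by
  refine subset_antisymm ?_ (iUnion₂_subset (fun K hK => hT.convexHull_subset hK))
  have hcl := hT.isClosed_biUnion _ subset_rfl
  refine closure_minimal ?_ hcl
  rw [← sdiff_eq_empty]
  have hopen : IsOpen (Ω \ ⋃ K ∈ triangles T, convexHull ℝ (K : Set Plane)) := hΩ.sdiff hcl
  refine hopen.eq_empty_of_measure_zero (μ := volume) ?_
  have hnull : volume (⋃ s ∈ {s | s ∈ T.faces ∧ s.card ≠ 3}, convexHull ℝ (s : Set Plane)) = 0 := by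
    refine (measure_biUnion_null_iff (hT.finite_faces.subset fun s h => h.1).countable).2 ?_
    exact fun s hs => volume_face_eq_zero hs.1 hs.2
  refine measure_mono_null ?_ hnull
  rintro x ⟨hx, hx'⟩
  have : x ∈ T.space := hT.space_eq ▸ subset_closure hx
  obtain ⟨s, hs, hxs⟩ := Geometry.SimplicialComplex.mem_space_iff.1 this
  refine mem_iUnion₂.2 ⟨s, ⟨hs, fun h3 => hx' ?_⟩, hxs⟩
  exact mem_iUnion₂.2 ⟨s, ⟨hs, h3⟩, hxs⟩

theorem IsTriangulation.exists_mem (hT : IsTriangulation Ω T) (hΩ : IsOpen Ω)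
    (hx : x ∈ closure Ω) : ∃ K ∈ triangles T, x ∈ convexHull ℝ (K : Set Plane) := by
  rw [hT.closure_eq hΩ] at hx
  simpa using hx

/-- A Lipschitz domain is the interior of its closure. -/
theorem IsLipschitzDomain.interior_closure (hΩ : IsLipschitzDomain Ω) :
    interior (closure Ω) = Ω := by
  refine subset_antisymm (fun x hx => ?_) (interior_maximal subset_closure hΩ.isOpen)
  by_contra hxΩ
  have hfr : x ∈ frontier Ω := ⟨interior_subset hx, fun h => hxΩ (interior_subset h)⟩
  obtain ⟨R, ψ, L, r, hψ, hr, h⟩ := hΩ.lipschitz_boundary x hfr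
  have hx1 : ¬ ψ (R x 0) < R x 1 := fun hlt => hxΩ ((h x (Metric.mem_ball_self hr)).2 hlt)
  set d : Plane := R.symm (EuclideanSpace.single 1 1) with hd
  have hcont : Filter.Tendsto (fun t : ℝ => x - t • d) (nhdsWithin 0 (Ioi 0)) (nhds x) := by
    have : Continuous (fun t : ℝ => x - t • d) := by fun_prop
    have h2 := this.tendsto 0
    simp only [zero_smul, sub_zero] at h2
    exact h2.mono_left nhdsWithin_le_nhds
  have e1 := hcont.eventually (isOpen_interior.mem_nhds hx)
  have e2 := hcont.eventually (Metric.ball_mem_nhds x hr)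
  obtain ⟨t, ⟨ht1, ht2⟩, ht0⟩ := ((e1.and e2).and self_mem_nhdsWithin).exists
  have ht0' : (0:ℝ) < t := ht0
  have hcl : x - t • d ∈ closure Ω := interior_subset ht1
  have hle : ∀ y ∈ closure Ω ∩ Metric.ball x r, ψ (R y 0) ≤ R y 1 := by
    rintro y ⟨hy, hyb⟩
    rw [mem_closure_iff_seq_limit] at hy
    obtain ⟨z, hz, hzy⟩ := hy
    have c0 : Continuous fun w : Plane => ψ (R w 0) :=
      hψ.continuous.comp (by fun_prop)
    have c1 : Continuous fun w : Plane => R w 1 := by fun_prop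
    refine le_of_tendsto_of_tendsto ((c0.tendsto y).comp hzy) ((c1.tendsto y).comp hzy) ?_
    filter_upwards [hzy.eventually (Metric.isOpen_ball.mem_nhds hyb)] with n hn
    exact ((h _ hn).1 (hz n)).le
  have := hle _ ⟨hcl, ht2⟩
  simp [hd] at this
  linarith

theorem IsTriangulation.interior_subset (hT : IsTriangulation Ω T) (hΩ : IsLipschitzDomain Ω)
    (hK : K ∈ triangles T) : interior (convexHull ℝ (K : Set Plane)) ⊆ Ω :=
  hΩ.interior_closure ▸ interior_mono (hT.convexHull_subset hK)

/-- A triangle that contains an interior point of an edge contains the edge. -/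
theorem erase_subset_of_mem (hK : K ∈ triangles T) (hK' : K' ∈ triangles T)
    (hx : x ∈ openEdge K a) (ha : a ∈ K) (hx' : x ∈ convexHull ℝ (K' : Set Plane)) :
    K.erase a ⊆ K' := by
  intro b hb
  by_contra hbK
  have := lam_eq_zero_of_mem hK hK' ((isTri_of_mem_triangles hK).openEdge_subset_convexHull ha hx)
    hx' (Finset.mem_of_mem_erase hb) hbK
  have h2 := hx.2 b (Finset.mem_of_mem_erase hb) (Finset.ne_of_mem_erase hb)
  exact h2.ne' this

theorem exists_opposite (hK : K ∈ triangles T) (hK' : K' ∈ triangles T) (hne : K ≠ K')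
    (ha : a ∈ K) (hsub : K.erase a ⊆ K') :
    ∃ a' ∈ K', a' ∉ K ∧ a ∉ K' ∧ K'.erase a' = K.erase a := by
  obtain ⟨a', ha', ha'K⟩ := exists_mem_notMem hK' hK hne.symm
  have hsub' : K.erase a ⊆ K'.erase a' := fun b hb =>
    Finset.mem_erase.2 ⟨fun e => ha'K (e ▸ Finset.mem_of_mem_erase hb), hsub hb⟩
  refine ⟨a', ha', ha'K, fun h => ?_, (Finset.eq_of_subset_of_card_le hsub' ?_).symm⟩
  · refine hne (Finset.eq_of_subset_of_card_le (fun b hb => ?_) (by rw [hK.2, hK'.2]))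
    by_cases e : b = a
    · exact e ▸ h
    · exact hsub (Finset.mem_erase.2 ⟨e, hb⟩)
  · rw [Finset.card_erase_of_mem ha, Finset.card_erase_of_mem ha', hK.2, hK'.2]

/-- Two triangles with a common edge lie on opposite sides of it. -/
theorem lam_opposite_neg (hK : K ∈ triangles T) (hK' : K' ∈ triangles T) (ha : a ∈ K)
    {a' : Plane} (ha' : a' ∈ K') (ha'K : a' ∉ K) (he : K'.erase a' = K.erase a) :
    lam K a a' < 0 := by
  by_contra! hge
  have tK := isTri_of_mem_triangles hK
  have tK' := isTri_of_mem_triangles hK'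
  obtain ⟨m, hm⟩ := tK.openEdge_nonempty ha
  have hmK' : m ∈ convexHull ℝ (K' : Set Plane) :=
    convexHull_mono (by rw [← he]; simp) (tK.openEdge_subset ha hm)
  have hm0 : lam K' a' m = 0 :=
    ((tK'.mem_convexHull_erase ha').1 (he ▸ tK.openEdge_subset ha hm)).2
  have hcont : Filter.Tendsto (fun t : ℝ => AffineMap.lineMap m a' t) (nhdsWithin 0 (Ioi 0))
      (nhds m) := by
    have : Continuous (fun t : ℝ => AffineMap.lineMap m a' t) := AffineMap.lineMap_continuous
    have h2 := this.tendsto 0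
    rw [AffineMap.lineMap_apply_zero] at h2
    exact h2.mono_left nhdsWithin_le_nhds
  have e1 : ∀ᶠ t : ℝ in nhdsWithin 0 (Ioi 0), t < 1 :=
    nhdsWithin_le_nhds (Iio_mem_nhds one_pos)
  have e2 := hcont.eventually (tK.eventually_mem_of_openEdge hm)
  obtain ⟨t, ⟨h1, h2⟩, h0⟩ := ((e1.and e2).and self_mem_nhdsWithin).exists
  have h0' : (0:ℝ) < t := h0
  have key : ∀ (K : Finset Plane) (d : Plane),
      lam K d (AffineMap.lineMap m a' t) = (1 - t) * lam K d m + t * lam K d a' := by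
    intro K d
    rw [AffineMap.apply_lineMap, AffineMap.lineMap_apply]
    simp; ring
  have hyK := h2 (by rw [key, hm.1, mul_zero, zero_add]; positivity)
  have hyK' : AffineMap.lineMap m a' t ∈ convexHull ℝ (K' : Set Plane) :=
    (convex_convexHull ℝ _).lineMap_mem hmK' (subset_convexHull _ _ ha') ⟨h0'.le, h1.le⟩
  have := lam_eq_zero_of_mem hK' hK hyK' hyK ha' ha'K
  rw [key, hm0, tK'.lam_self ha'] at this
  linarith

theorem lam_eq_mul_lam (hK : K ∈ triangles T) (hK' : K' ∈ triangles T) (ha : a ∈ K)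
    {a' : Plane} (ha' : a' ∈ K') (he : K'.erase a' = K.erase a) (y : Plane) :
    lam K a y = lam K' a' y * lam K a a' := by
  rw [(isTri_of_mem_triangles hK').affineMap_eq (lam K a) y, ← Finset.add_sum_erase _ _ ha',
    Finset.sum_eq_zero, add_zero, smul_eq_mul]
  intro b hb
  rw [he] at hb
  rw [(isTri_of_mem_triangles hK).lam_of_ne ha (Finset.mem_of_mem_erase hb)
    (Finset.ne_of_mem_erase hb).symm, smul_zero]

/-- The interior of an edge shared by two triangles lies in the domain. -/
theorem IsTriangulation.openEdge_subset_of_shared (hT : IsTriangulation Ω T)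
    (hΩ : IsLipschitzDomain Ω) (hK : K ∈ triangles T) (hK' : K' ∈ triangles T) (hne : K ≠ K')
    (ha : a ∈ K) (hsub : K.erase a ⊆ K') : openEdge K a ⊆ Ω := by
  obtain ⟨a', ha', ha'K, haK', e'⟩ := exists_opposite hK hK' hne ha hsub
  have tK := isTri_of_mem_triangles hK
  have tK' := isTri_of_mem_triangles hK'
  intro x hx
  rw [← hΩ.interior_closure, mem_interior_iff_mem_nhds]
  have hx' : x ∈ openEdge K' a' := by
    refine ⟨((tK'.mem_convexHull_erase ha').1 (e' ▸ tK.openEdge_subset ha hx)).2,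
      fun b hb hba => ?_⟩
    have hbe : b ∈ K'.erase a' := Finset.mem_erase.2 ⟨hba, hb⟩
    have hbK : b ∈ K.erase a := e' ▸ hbe
    rw [(isTri_of_mem_triangles hK).affineMap_eq (lam K' b) x, ← Finset.add_sum_erase _ _ ha, hx.1,
      zero_smul, zero_add, Finset.sum_eq_single b, tK'.lam_self hb, smul_eq_mul, mul_one]
    · exact hx.2 b (Finset.mem_of_mem_erase hbK) (Finset.ne_of_mem_erase hbK)
    · intro c hc hcb
      rw [← e'] at hc
      rw [tK'.lam_of_ne hb (Finset.mem_of_mem_erase hc) hcb.symm, smul_zero]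
    · exact fun h => absurd hbK h
  filter_upwards [tK.eventually_mem_of_openEdge hx, tK'.eventually_mem_of_openEdge hx'] with y h1 h2
  have n1 := lam_opposite_neg hK hK' ha ha' ha'K e'
  have n2 := lam_eq_mul_lam hK hK' ha ha' e' y
  rcases le_total 0 (lam K a y) with h | h
  · exact hT.convexHull_subset hK (h1 h)
  · exact hT.convexHull_subset hK' (h2 (by nlinarith))

/-- The pairs of a triangle and one of its vertices; they stand for the sides of the triangles. -/
noncomputable def IsTriangulation.sides (hT : IsTriangulation Ω T) :
    Finset (Finset Plane × Plane) :=
  hT.tris.biUnion fun K => K.map ⟨Prod.mk K, Prod.mk_right_injective K⟩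

theorem IsTriangulation.mem_sides (hT : IsTriangulation Ω T) :
    (K, a) ∈ hT.sides ↔ K ∈ triangles T ∧ a ∈ K := by
  simp only [sides, Finset.mem_biUnion, Finset.mem_map, Function.Embedding.coeFn_mk, Prod.mk.injEq,
    hT.mem_tris]
  constructor
  · rintro ⟨K', h, b, hb, rfl, rfl⟩; exact ⟨h, hb⟩
  · rintro ⟨h, hb⟩; exact ⟨K, h, a, hb, rfl, rfl⟩

theorem IsTriangulation.sum_sides (hT : IsTriangulation Ω T) {M : Type*} [AddCommMonoid M]
    (F : Finset Plane → Plane → M) :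
    ∑ s ∈ hT.sides, F s.1 s.2 = ∑ K ∈ hT.tris, ∑ a ∈ K, F K a := by
  rw [sides, Finset.sum_biUnion]
  · simp
  · intro K _ K' _ hne
    rw [Function.onFun, Finset.disjoint_left]
    rintro ⟨L, b⟩ h1 h2
    simp only [Finset.mem_map, Function.Embedding.coeFn_mk, Prod.mk.injEq] at h1 h2
    obtain ⟨_, _, rfl, _⟩ := h1
    obtain ⟨_, _, rfl, _⟩ := h2
    exact hne rfl

/-- The side of `K` opposite to `a` belongs to no other triangle. -/
def IsOuter (T : Geometry.SimplicialComplex ℝ Plane) (K : Finset Plane) (a : Plane) : Prop :=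
  ∀ K' ∈ triangles T, K.erase a ⊆ K' → K' = K

theorem IsTriangulation.openEdge_subset_frontier (hT : IsTriangulation Ω T)
    (hΩ : IsLipschitzDomain Ω) (hK : K ∈ triangles T) (ha : a ∈ K) (ho : IsOuter T K a) :
    openEdge K a ⊆ frontier Ω := by
  intro x hx
  have tK := isTri_of_mem_triangles hK
  have hxK := tK.openEdge_subset_convexHull ha hx
  refine ⟨hT.convexHull_subset hK hxK, fun hxi => ?_⟩
  have hcl := hT.isClosed_biUnion (triangles T \ {K}) sdiff_subset
  have hxn : x ∉ ⋃ K' ∈ triangles T \ {K}, convexHull ℝ (K' : Set Plane) := by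
    intro h
    obtain ⟨K', hK', hx'⟩ := mem_iUnion₂.1 h
    exact hK'.2 (ho K' hK'.1 (erase_subset_of_mem hK hK'.1 hx ha hx'))
  have : x ∈ interior (convexHull ℝ (K : Set Plane)) := by
    rw [mem_interior_iff_mem_nhds]
    filter_upwards [hcl.isOpen_compl.mem_nhds hxn, isOpen_interior.mem_nhds hxi] with y hy hyΩ
    obtain ⟨K', hK', hyK'⟩ := hT.exists_mem hΩ.isOpen (subset_closure (_root_.interior_subset hyΩ))
    by_cases e : K' = K
    · exact e ▸ hyK'
    · exact absurd (mem_iUnion₂.2 ⟨K', ⟨hK', e⟩, hyK'⟩) hy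
  exact (tK.mem_interior.1 this a ha).ne' hx.1

theorem IsTriangulation.mem_boundaryEdges_iff (hT : IsTriangulation Ω T)
    (hΩ : IsLipschitzDomain Ω) (hK : K ∈ triangles T) (ha : a ∈ K) :
    K.erase a ∈ boundaryEdges Ω T ↔ IsOuter T K a := by
  have tK := isTri_of_mem_triangles hK
  constructor
  · rintro ⟨-, -, hfr⟩ K' hK' hsub
    by_contra hne
    obtain ⟨m, hm⟩ := tK.openEdge_nonempty ha
    have h1 := hfr (tK.openEdge_subset ha hm)
    have h2 := hT.openEdge_subset_of_shared hΩ hK hK' (fun e => hne e.symm) ha hsub hm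
    rw [hΩ.isOpen.frontier_eq] at h1
    exact h1.2 h2
  · intro ho
    have hc : (K.erase a).card = 2 := by rw [Finset.card_erase_of_mem ha, hK.2]
    refine ⟨T.down_closed hK.1 (Finset.erase_subset _ _) (Finset.card_pos.1 (by omega)), hc, ?_⟩
    exact (tK.subset_closure_openEdge ha).trans
      (closure_minimal (hT.openEdge_subset_frontier hΩ hK ha ho) isClosed_frontier)

theorem IsTriangulation.exists_outer_of_mem_frontier (hT : IsTriangulation Ω T)
    (hΩ : IsLipschitzDomain Ω) (hx : x ∈ frontier Ω) (hv : ∀ K ∈ triangles T, x ∉ K) :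
    ∃ K ∈ triangles T, ∃ a ∈ K, x ∈ openEdge K a ∧ IsOuter T K a := by
  obtain ⟨K, hK, hxK⟩ := hT.exists_mem hΩ.isOpen hx.1
  have tK := isTri_of_mem_triangles hK
  rw [hΩ.isOpen.frontier_eq] at hx
  have : ¬ ∀ a ∈ K, 0 < lam K a x := fun h => hx.2 (hT.interior_subset hΩ hK (tK.mem_interior.2 h))
  push Not at this
  obtain ⟨a, ha, h0⟩ := this
  have hxe := tK.mem_openEdge_of_notMem ha hxK (le_antisymm h0 (tK.lam_nonneg ha hxK)) (hv K hK)
  refine ⟨K, hK, a, ha, hxe, fun K' hK' hsub => ?_⟩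
  by_contra hne
  exact hx.2 (hT.openEdge_subset_of_shared hΩ hK hK' (fun e => hne e.symm) ha hsub hxe)

/-- A point lies on at most one outer side, apart from the vertices. -/
theorem outer_unique (hK : K ∈ triangles T) (hK' : K' ∈ triangles T) (ha : a ∈ K) {a' : Plane}
    (ha' : a' ∈ K') (hx : x ∈ openEdge K a) (hx' : x ∈ convexHull ℝ (K'.erase a' : Set Plane))
    (ho : IsOuter T K a) : K' = K ∧ a' = a := by
  have tK' := isTri_of_mem_triangles hK'
  obtain ⟨h1, h2⟩ := (tK'.mem_convexHull_erase ha').1 hx'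
  have e := ho K' hK' (erase_subset_of_mem hK hK' hx ha h1)
  subst e
  refine ⟨rfl, ?_⟩
  by_contra hne
  exact (hx.2 a' ha' hne).ne' h2

theorem restrict_biUnion_finset_eq_sum {α ι : Type*} [MeasurableSpace α] {μ : Measure α}
    {s : Finset ι} {f : ι → Set α}
    (hd : (s : Set ι).Pairwise (Function.onFun (AEDisjoint μ) f))
    (hm : ∀ i ∈ s, NullMeasurableSet (f i) μ) :
    μ.restrict (⋃ i ∈ s, f i) = ∑ i ∈ s, μ.restrict (f i) := by
  classical
  induction s using Finset.induction_on with
  | empty => simp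
  | insert i s his ih =>
    rw [Finset.set_biUnion_insert, Finset.sum_insert his, union_comm, add_comm,
      Measure.restrict_union₀ _ (hm i (by simp)),
      ih (hd.mono (by simp)) fun j hj => hm j (by simp [hj])]
    rw [AEDisjoint, iUnion₂_inter]
    refine (measure_biUnion_null_iff s.countable_toSet).2 fun j hj => ?_
    exact hd (by simp [Finset.mem_coe.1 hj]) (by simp) (fun e => his (e ▸ hj))

theorem IsTriangulation.volume_restrict_eq_sum (hT : IsTriangulation Ω T)
    (hΩ : IsLipschitzDomain Ω) :
    (volume.restrict Ω : Measure Plane) =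
      ∑ K ∈ hT.tris, volume.restrict (convexHull ℝ (K : Set Plane)) := by
  have hU : (⋃ K ∈ hT.tris, convexHull ℝ (K : Set Plane)) = closure Ω := by
    rw [hT.closure_eq hΩ.isOpen]; simp [hT.mem_tris]
  have hnull : volume (closure Ω \ Ω) = 0 := by
    refine measure_mono_null (t := ⋃ K ∈ triangles T, frontier (convexHull ℝ (K : Set Plane))) ?_
      ((measure_biUnion_null_iff hT.finite_triangles.countable).2
        fun K _ => volume_frontier_convexHull _)
    rintro x ⟨hx, hx'⟩
    obtain ⟨K, hK, hxK⟩ := hT.exists_mem hΩ.isOpen hx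
    exact mem_iUnion₂.2 ⟨K, hK, subset_closure hxK, fun h => hx' (hT.interior_subset hΩ hK h)⟩
  have h1 : (volume.restrict Ω : Measure Plane) = volume.restrict (closure Ω) := by
    refine Measure.restrict_congr_set ?_
    exact subset_closure.eventuallyLE.antisymm (ae_le_set.2 hnull)
  have hdis : (hT.tris : Set (Finset Plane)).Pairwise
      (Function.onFun (AEDisjoint volume) fun K => convexHull ℝ (K : Set Plane)) := by
    intro K hK K' hK' hne
    refine measure_mono_null ?_ (volume_frontier_convexHull (K : Set Plane))
    rintro x ⟨hx, hx'⟩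
    exact ⟨subset_closure hx, fun h => Set.disjoint_left.1
      (disjoint_interior (hT.mem_tris.1 hK) (hT.mem_tris.1 hK') hne) h hx'⟩
  rw [h1, ← hU, restrict_biUnion_finset_eq_sum hdis fun K _ =>
    (IsTri.isCompact K).isClosed.measurableSet.nullMeasurableSet]

end Hypercircle

namespace Hypercircle

variable {Ω : Set Plane} {T : Geometry.SimplicialComplex ℝ Plane} {K K' : Finset Plane}
  {a b x : Plane}

/-! ### Arc length on the boundary -/

theorem hausdorffMeasure_finite_eq_zero {s : Set Plane} (hs : s.Finite) :
    (Measure.hausdorffMeasure 1 : Measure Plane) s = 0 := by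
  have : NullSingletonClass (Measure.hausdorffMeasure 1 : Measure Plane) :=
    Measure.nullSingletonClass_hausdorff _ one_pos
  exact hs.measure_zero _

theorem IsTriangulation.finite_vertices (hT : IsTriangulation Ω T) :
    (⋃ K ∈ triangles T, (K : Set Plane)).Finite :=
  hT.finite_triangles.biUnion fun K _ => K.finite_toSet

open Classical in
/-- The sides that belong to one triangle only. -/
noncomputable def IsTriangulation.outerSides (hT : IsTriangulation Ω T) :
    Finset (Finset Plane × Plane) :=
  hT.sides.filter fun s => IsOuter T s.1 s.2

open Classical in
/-- The sides that belong to two triangles. -/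
noncomputable def IsTriangulation.innerSides (hT : IsTriangulation Ω T) :
    Finset (Finset Plane × Plane) :=
  hT.sides.filter fun s => ¬ IsOuter T s.1 s.2

theorem IsTriangulation.mem_outerSides (hT : IsTriangulation Ω T) {s : Finset Plane × Plane} :
    s ∈ hT.outerSides ↔ s.1 ∈ triangles T ∧ s.2 ∈ s.1 ∧ IsOuter T s.1 s.2 := by
  obtain ⟨K, a⟩ := s
  simp only [outerSides, Finset.mem_filter, hT.mem_sides, and_assoc]

theorem IsTriangulation.mem_innerSides (hT : IsTriangulation Ω T) {s : Finset Plane × Plane} :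
    s ∈ hT.innerSides ↔ s.1 ∈ triangles T ∧ s.2 ∈ s.1 ∧ ¬ IsOuter T s.1 s.2 := by
  obtain ⟨K, a⟩ := s
  simp only [innerSides, Finset.mem_filter, hT.mem_sides, and_assoc]

theorem IsTriangulation.sum_outerSides_add_sum_innerSides (hT : IsTriangulation Ω T)
    (F : Finset Plane × Plane → ℝ) :
    ∑ s ∈ hT.outerSides, F s + ∑ s ∈ hT.innerSides, F s = ∑ s ∈ hT.sides, F s := by
  classical
  exact Finset.sum_filter_add_sum_filter_not _ _ _

/-- The closed edge opposite to the vertex `s.2` of the triangle `s.1`. -/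
def side (s : Finset Plane × Plane) : Set Plane := convexHull ℝ (s.1.erase s.2 : Set Plane)

theorem isCompact_side (s : Finset Plane × Plane) : IsCompact (side s) := IsTri.isCompact _

theorem measurableSet_side (s : Finset Plane × Plane) : MeasurableSet (side s) :=
  (isCompact_side s).isClosed.measurableSet

theorem openEdge_eq_side_diff (h : IsTri K) (ha : a ∈ K) : side (K, a) \ K ⊆ openEdge K a := by
  rintro x ⟨hx, hxK⟩
  obtain ⟨h1, h2⟩ := (h.mem_convexHull_erase ha).1 hx
  exact h.mem_openEdge_of_notMem ha h1 h2 hxK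

/-- Almost every point of a side is not an end point. -/
theorem ae_mem_openEdge (h : IsTri K) (ha : a ∈ K) :
    ∀ᵐ x ∂(Measure.hausdorffMeasure 1 : Measure Plane).restrict (side (K, a)),
      x ∈ openEdge K a := by
  have h0 := hausdorffMeasure_finite_eq_zero K.finite_toSet
  rw [ae_restrict_iff' (measurableSet_side _)]
  filter_upwards [measure_eq_zero_iff_ae_notMem.1 h0] with x hx hxs
  exact openEdge_eq_side_diff h ha ⟨hxs, hx⟩

theorem IsTriangulation.side_subset_frontier (hT : IsTriangulation Ω T) (hΩ : IsLipschitzDomain Ω)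
    {s : Finset Plane × Plane} (hs : s ∈ hT.outerSides) : side s ⊆ frontier Ω := by
  obtain ⟨h1, h2, h3⟩ := hT.mem_outerSides.1 hs
  exact ((hT.mem_boundaryEdges_iff hΩ h1 h2).2 h3).2.2

/-- Arc length on the boundary is the sum of the arc lengths on the outer sides. -/
theorem IsTriangulation.hausdorffMeasure_restrict_eq_sum (hT : IsTriangulation Ω T)
    (hΩ : IsLipschitzDomain Ω) :
    (Measure.hausdorffMeasure 1 : Measure Plane).restrict (frontier Ω) =
      ∑ s ∈ hT.outerSides, (Measure.hausdorffMeasure 1 : Measure Plane).restrict (side s) := by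
  have hV := hausdorffMeasure_finite_eq_zero hT.finite_vertices
  rw [← restrict_biUnion_finset_eq_sum]
  · refine Measure.restrict_congr_set (Filter.EventuallyLE.antisymm ?_ ?_)
    · rw [ae_le_set]
      refine measure_mono_null ?_ hV
      rintro x ⟨hx, hx'⟩
      by_contra hxV
      obtain ⟨K, hK, a, ha, hxe, ho⟩ := hT.exists_outer_of_mem_frontier hΩ hx
        (fun K hK hxK => hxV (mem_iUnion₂.2 ⟨K, hK, hxK⟩))
      refine hx' (mem_iUnion₂.2 ⟨(K, a), hT.mem_outerSides.2 ⟨hK, ha, ho⟩, ?_⟩)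
      exact (isTri_of_mem_triangles hK).openEdge_subset ha hxe
    · have hsub : (⋃ s ∈ hT.outerSides, side s) ⊆ frontier Ω :=
        iUnion₂_subset fun s hs => hT.side_subset_frontier hΩ hs
      exact Filter.Eventually.of_forall fun x hx => hsub hx
  · rintro ⟨K, a⟩ hs ⟨K', a'⟩ hs' hne
    change (Measure.hausdorffMeasure 1 : Measure Plane) (side (K, a) ∩ side (K', a')) = 0
    refine measure_mono_null ?_ hV
    rintro x ⟨hx, hx'⟩
    obtain ⟨hK, ha, ho⟩ := hT.mem_outerSides.1 hs
    obtain ⟨hK', ha', -⟩ := hT.mem_outerSides.1 hs'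
    by_contra hxV
    have hxe := openEdge_eq_side_diff (isTri_of_mem_triangles hK) ha
      ⟨hx, fun h => hxV (mem_iUnion₂.2 ⟨K, hK, h⟩)⟩
    obtain ⟨rfl, rfl⟩ := outer_unique hK hK' ha ha' hxe hx' ho
    exact hne rfl
  · exact fun s _ => (measurableSet_side s).nullMeasurableSet

theorem hausdorffMeasure_side_lt_top {s : Finset Plane × Plane} (h : IsTri s.1) (ha : s.2 ∈ s.1) :
    (Measure.hausdorffMeasure 1 : Measure Plane) (side s) < ⊤ := by
  obtain ⟨b, c, -, -, -, -, e⟩ := h.exists_eq ha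
  rw [side, e, Finset.coe_pair, convexHull_pair, hausdorffMeasure_segment]
  exact edist_lt_top b c

theorem hausdorffMeasure_side_pos {s : Finset Plane × Plane} (h : IsTri s.1) (ha : s.2 ∈ s.1) :
    0 < (Measure.hausdorffMeasure 1 : Measure Plane) (side s) := by
  obtain ⟨b, c, -, -, hbc, -, e⟩ := h.exists_eq ha
  rw [side, e, Finset.coe_pair, convexHull_pair, hausdorffMeasure_segment]
  exact edist_pos.2 hbc

theorem IsTriangulation.hausdorffMeasure_frontier_lt_top (hT : IsTriangulation Ω T)
    (hΩ : IsLipschitzDomain Ω) :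
    (Measure.hausdorffMeasure 1 : Measure Plane) (frontier Ω) < ⊤ := by
  rw [← Measure.restrict_apply_self, hT.hausdorffMeasure_restrict_eq_sum hΩ,
    Measure.finsetSum_apply, ENNReal.sum_lt_top]
  intro s hs
  obtain ⟨h1, h2, -⟩ := hT.mem_outerSides.1 hs
  rw [Measure.restrict_apply isClosed_frontier.measurableSet]
  exact (measure_mono inter_subset_right).trans_lt
      (hausdorffMeasure_side_lt_top (isTri_of_mem_triangles h1) h2)

theorem one_lt_rank_plane : 1 < Module.rank ℝ Plane := by
  rw [← Module.finrank_eq_rank]; simp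

theorem IsLipschitzDomain.frontier_not_finite (hΩ : IsLipschitzDomain Ω) :
    ¬ (frontier Ω).Finite := by
  intro hf
  have hconn := (hf.countable.isConnected_compl_of_one_lt_rank one_lt_rank_plane).isPreconnected
  have hcov : (frontier Ω)ᶜ ⊆ Ω ∪ (closure Ω)ᶜ := by
    intro x hx
    by_cases h : x ∈ closure Ω
    · left
      by_contra h'
      exact hx (hΩ.isOpen.frontier_eq ▸ ⟨h, h'⟩)
    · exact Or.inr h
  have hne : (closure Ω)ᶜ.Nonempty := by
    rw [nonempty_compl]
    intro h
    have hb := hΩ.isBounded.closure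
    rw [h] at hb
    exact NormedSpace.unbounded_univ ℝ Plane hb
  have h1 : ((frontier Ω)ᶜ ∩ Ω).Nonempty := by
    obtain ⟨x, hx⟩ := hΩ.isConnected.nonempty
    exact ⟨x, fun h => (hΩ.isOpen.frontier_eq ▸ h).2 hx, hx⟩
  have h2 : ((frontier Ω)ᶜ ∩ (closure Ω)ᶜ).Nonempty := by
    obtain ⟨x, hx⟩ := hne
    exact ⟨x, fun h => hx h.1, hx⟩
  obtain ⟨x, -, hx, hx'⟩ := hconn _ _ hΩ.isOpen isClosed_closure.isOpen_compl hcov h1 h2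
  exact hx' (subset_closure hx)

theorem IsTriangulation.outer_nonempty (hT : IsTriangulation Ω T) (hΩ : IsLipschitzDomain Ω) :
    hT.outerSides.Nonempty := by
  by_contra h
  refine hΩ.frontier_not_finite (hT.finite_vertices.subset fun x hx => ?_)
  by_contra hxV
  obtain ⟨K, hK, a, ha, -, ho⟩ := hT.exists_outer_of_mem_frontier hΩ hx
    (fun K hK hxK => hxV (mem_iUnion₂.2 ⟨K, hK, hxK⟩))
  exact h ⟨(K, a), hT.mem_outerSides.2 ⟨hK, ha, ho⟩⟩

theorem IsTriangulation.hausdorffMeasure_frontier_pos (hT : IsTriangulation Ω T)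
    (hΩ : IsLipschitzDomain Ω) :
    0 < (Measure.hausdorffMeasure 1 : Measure Plane) (frontier Ω) := by
  obtain ⟨s, hs⟩ := hT.outer_nonempty hΩ
  obtain ⟨h1, h2, -⟩ := hT.mem_outerSides.1 hs
  exact (hausdorffMeasure_side_pos (isTri_of_mem_triangles h1) h2).trans_le
    (measure_mono (hT.side_subset_frontier hΩ hs))

/-! ### Connectedness of the dual graph -/

theorem isPreconnected_ball_diff_singleton (x : Plane) {r : ℝ} (hr : 0 < r) :
    IsPreconnected (Metric.ball x r \ {x}) := by
  have h := (isConnected_compl_singleton_of_one_lt_rank one_lt_rank_plane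
    (0 : Plane)).isPreconnected.image (OpenPartialHomeomorph.univBall x r)
    (OpenPartialHomeomorph.continuous_univBall x r).continuousOn
  convert! h using 1
  have hinj : Function.Injective (OpenPartialHomeomorph.univBall x r : Plane → Plane) := by
    have := (OpenPartialHomeomorph.univBall x r).injOn
    rwa [OpenPartialHomeomorph.univBall_source, injOn_univ] at this
  have himg : (OpenPartialHomeomorph.univBall x r : Plane → Plane) '' univ = Metric.ball x r := by
    rw [← OpenPartialHomeomorph.univBall_source x r,
      OpenPartialHomeomorph.image_source_eq_target, OpenPartialHomeomorph.univBall_target x hr]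
  rw [compl_eq_univ_sdiff, image_sdiff hinj, himg, image_singleton,
    OpenPartialHomeomorph.univBall_apply_zero]

/-- Removing finitely many points does not disconnect a connected open set of the plane. -/
theorem subset_or_subset_of_inter_finite {U A B F : Set Plane} (hU : IsOpen U)
    (hUc : IsPreconnected U) (hA : IsClosed A) (hB : IsClosed B) (hF : F.Finite)
    (hcov : U ⊆ A ∪ B) (hAB : A ∩ B ∩ U ⊆ F) : U ⊆ A ∨ U ⊆ B := by
  let O : Set Plane → Set Plane := fun A => {x | ∃ r > 0, Metric.ball x r \ {x} ⊆ A}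
  have hO : ∀ A, IsClosed A → IsOpen (O A) := by
    intro A hA
    rw [isOpen_iff_mem_nhds]
    rintro x ⟨r, hr, hx⟩
    filter_upwards [Metric.ball_mem_nhds x hr] with z hz
    by_cases hzx : z = x
    · exact hzx ▸ ⟨r, hr, hx⟩
    · have : Metric.ball x r \ {x} ∈ nhds z :=
        (Metric.isOpen_ball.sdiff isClosed_singleton).mem_nhds ⟨hz, hzx⟩
      obtain ⟨s, hs, h⟩ := Metric.mem_nhds_iff.1 this
      exact ⟨s, hs, sdiff_subset.trans (h.trans hx)⟩
  have hsub : ∀ A, IsClosed A → O A ⊆ A := by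
    rintro A hA x ⟨r, hr, hx⟩
    have : x ∈ closure ({x}ᶜ : Set Plane) := by simp
    rw [← hA.closure_eq]
    rw [Metric.mem_closure_iff] at this ⊢
    intro ε hε
    obtain ⟨b, hb, hbx⟩ := this (min ε r) (lt_min hε hr)
    exact ⟨b, hx ⟨by rw [Metric.mem_ball, dist_comm]; exact hbx.trans_le (min_le_right _ _), hb⟩,
      hbx.trans_le (min_le_left _ _)⟩
  have hball : ∀ x ∈ U, ∃ r > 0, Metric.ball x r ⊆ U ∧ Disjoint (Metric.ball x r \ {x}) F := by
    intro x hx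
    have h1 : U ∩ (F \ {x})ᶜ ∈ nhds x :=
      (hU.inter (hF.subset sdiff_subset).isClosed.isOpen_compl).mem_nhds ⟨hx, by simp⟩
    obtain ⟨r, hr, h⟩ := Metric.mem_nhds_iff.1 h1
    refine ⟨r, hr, h.trans inter_subset_left, Set.disjoint_left.2 ?_⟩
    rintro y ⟨hy, hyx⟩ hyF
    exact (h hy).2 ⟨hyF, hyx⟩
  have hcov' : U ⊆ O A ∪ O B := by
    intro x hx
    obtain ⟨r, hr, hrU, hrF⟩ := hball x hx
    have hp := isPreconnected_ball_diff_singleton x hr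
    rw [isPreconnected_closed_iff] at hp
    by_contra hno
    have hno' : ¬ (x ∈ O A) ∧ ¬ (x ∈ O B) := not_or.1 hno
    have hc : Metric.ball x r \ {x} ⊆ A ∪ B := (sdiff_subset.trans hrU).trans hcov
    have n1 : ((Metric.ball x r \ {x}) ∩ A).Nonempty := by
      by_contra he
      refine hno'.2 ⟨r, hr, fun y hy => (hc hy).resolve_left fun h => he ⟨y, hy, h⟩⟩
    have n2 : ((Metric.ball x r \ {x}) ∩ B).Nonempty := by
      by_contra he
      refine hno'.1 ⟨r, hr, fun y hy => (hc hy).resolve_right fun h => he ⟨y, hy, h⟩⟩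
    obtain ⟨y, hy, hyAB⟩ := hp A B hA hB hc n1 n2
    exact Set.disjoint_left.1 hrF hy (hAB ⟨hyAB, hrU hy.1⟩)
  have hdis : ∀ x ∈ U, x ∈ O A → x ∈ O B → False := by
    rintro x hx ⟨r, hr, h1⟩ ⟨s, hs, h2⟩
    obtain ⟨t, ht, htU, htF⟩ := hball x hx
    have : x ∈ closure ({x}ᶜ : Set Plane) := by simp
    obtain ⟨b, hb, hbx⟩ := Metric.mem_closure_iff.1 this (min (min r s) t)
      (lt_min (lt_min hr hs) ht)
    have hbx' : dist b x < min (min r s) t := by rwa [dist_comm]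
    have hbt : b ∈ Metric.ball x t \ {x} := ⟨hbx'.trans_le (min_le_right _ _), hb⟩
    exact Set.disjoint_left.1 htF hbt (hAB ⟨⟨
      h1 ⟨hbx'.trans_le ((min_le_left _ _).trans (min_le_left _ _)), hb⟩,
      h2 ⟨hbx'.trans_le ((min_le_left _ _).trans (min_le_right _ _)), hb⟩⟩, htU hbt.1⟩)
  by_contra! hno
  obtain ⟨⟨x, hx, hxA⟩, y, hy, hyB⟩ := And.imp not_subset.1 not_subset.1 hno
  have hx' := (hcov' hx).resolve_left fun h => hxA (hsub A hA h)
  have hy' := (hcov' hy).resolve_right fun h => hyB (hsub B hB h)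
  obtain ⟨z, hz, hzA, hzB⟩ := hUc _ _ (hO A hA) (hO B hB) hcov' ⟨y, hy, hy'⟩ ⟨x, hx, hx'⟩
  exact hdis z hz hzA hzB

/-- A property that passes from a triangle to its neighbours holds for all triangles if it holds
for one. -/
theorem IsTriangulation.triangle_induction (hT : IsTriangulation Ω T) (hΩ : IsLipschitzDomain Ω)
    {P : Finset Plane → Prop} {K₀ : Finset Plane} (hK₀ : K₀ ∈ triangles T) (h₀ : P K₀)
    (step : ∀ K ∈ triangles T, ∀ K' ∈ triangles T, ∀ a ∈ K, K ≠ K' → K.erase a ⊆ K' → P K → P K') :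
    ∀ K ∈ triangles T, P K := by
  have hA := hT.isClosed_biUnion {K | K ∈ triangles T ∧ P K} (fun K h => h.1)
  have hB := hT.isClosed_biUnion {K | K ∈ triangles T ∧ ¬ P K} (fun K h => h.1)
  have hcov : Ω ⊆ (⋃ K ∈ {K | K ∈ triangles T ∧ P K}, convexHull ℝ (K : Set Plane)) ∪
      ⋃ K ∈ {K | K ∈ triangles T ∧ ¬ P K}, convexHull ℝ (K : Set Plane) := by
    intro x hx
    obtain ⟨K, hK, hxK⟩ := hT.exists_mem hΩ.isOpen (subset_closure hx)
    by_cases hP : P K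
    · exact Or.inl (mem_iUnion₂.2 ⟨K, ⟨hK, hP⟩, hxK⟩)
    · exact Or.inr (mem_iUnion₂.2 ⟨K, ⟨hK, hP⟩, hxK⟩)
  have hmem : ∀ (Q : Finset Plane → Prop) (K : Finset Plane), K ∈ triangles T →
      Ω ⊆ (⋃ K ∈ {K | K ∈ triangles T ∧ Q K}, convexHull ℝ (K : Set Plane)) → Q K := by
    intro Q K hK hsub
    obtain ⟨x, hx⟩ := (isTri_of_mem_triangles hK).interior_nonempty
    obtain ⟨K', ⟨hK', hQ⟩, hx'⟩ := mem_iUnion₂.1 (hsub (hT.interior_subset hΩ hK hx))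
    by_cases e : K = K'
    · rwa [e]
    · exact absurd hx' (Set.disjoint_left.1 (disjoint_interior hK hK' e) hx)
  have hV : (⋃ K ∈ {K | K ∈ triangles T ∧ P K}, convexHull ℝ (K : Set Plane)) ∩
      (⋃ K ∈ {K | K ∈ triangles T ∧ ¬ P K}, convexHull ℝ (K : Set Plane)) ∩ Ω ⊆
      ⋃ K ∈ triangles T, (K : Set Plane) := by
    rintro x ⟨⟨hxA, hxB⟩, -⟩
    obtain ⟨K, ⟨hK, hP⟩, hx⟩ := mem_iUnion₂.1 hxA
    obtain ⟨K', ⟨hK', hP'⟩, hx'⟩ := mem_iUnion₂.1 hxB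
    by_contra hxV
    have hne : K ≠ K' := fun e => hP' (e ▸ hP)
    obtain ⟨a, ha, ha'⟩ := exists_mem_notMem hK hK' hne
    have hxe := (isTri_of_mem_triangles hK).mem_openEdge_of_notMem ha hx
      (lam_eq_zero_of_mem hK hK' hx hx' ha ha') (fun h => hxV (mem_iUnion₂.2 ⟨K, hK, h⟩))
    exact hP' (step K hK K' hK' a ha hne (erase_subset_of_mem hK hK' hxe ha hx') hP)
  rcases subset_or_subset_of_inter_finite hΩ.isOpen hΩ.isConnected.isPreconnected hA hB
    hT.finite_vertices hcov hV with h | h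
  · exact fun K hK => hmem P K hK h
  · exact absurd h₀ (hmem (fun K => ¬ P K) K₀ hK₀ h)

end Hypercircle

namespace Hypercircle

/-! ### The divergence theorem on a triangle for fields pointing away from a vertex -/

/-- Cartesian coordinates on the plane. -/
noncomputable def planeEquiv : ℝ × ℝ ≃ᵐ Plane :=
  (MeasurableEquiv.finTwoArrow (α := ℝ)).symm.trans (MeasurableEquiv.toLp 2 (Fin 2 → ℝ))

theorem planeEquiv_apply (z : ℝ × ℝ) : planeEquiv z = !₂[z.1, z.2] := rfl

theorem measurePreserving_planeEquiv : MeasurePreserving planeEquiv :=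
  (PiLp.volume_preserving_toLp (Fin 2)).comp (volume_preserving_finTwoArrow ℝ).symm

/-- The determinant of two vectors of the plane. -/
def cross (u w : Plane) : ℝ := u 0 * w 1 - w 0 * u 1

/-- The parametrization of a triangle with vertices `a`, `a + u`, `a + u + w` by segments starting
at `a`. -/
noncomputable def fan (a u w : Plane) (z : ℝ × ℝ) : Plane := a + z.1 • (u + z.2 • w)

theorem fan_eq (a u w : Plane) (z : ℝ × ℝ) :
    fan a u w z = planeEquiv (a 0 + z.1 * (u 0 + z.2 * w 0), a 1 + z.1 * (u 1 + z.2 * w 1)) := by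
  ext i
  fin_cases i <;> simp [fan, planeEquiv_apply, mul_add]

theorem setIntegral_image_fan (a u w : Plane) (G : Plane → ℝ)
    (hinj : InjOn (fan a u w) (Ioo 0 1 ×ˢ Ioo 0 1)) :
    ∫ x in fan a u w '' (Ioo 0 1 ×ˢ Ioo 0 1), G x =
      ∫ z in Ioo (0:ℝ) 1 ×ˢ Ioo (0:ℝ) 1, |cross u w| * (z.1 * G (fan a u w z)) := by
  set Q : Set (ℝ × ℝ) := Ioo 0 1 ×ˢ Ioo 0 1 with hQ
  have hQm : MeasurableSet Q := measurableSet_Ioo.prod measurableSet_Ioo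
  set f : ℝ × ℝ → ℝ × ℝ := fun z =>
    (a 0 + z.1 * (u 0 + z.2 * w 0), a 1 + z.1 * (u 1 + z.2 * w 1)) with hf
  have hfan : ∀ z, fan a u w z = planeEquiv (f z) := fan_eq a u w
  let f' : ℝ × ℝ → ℝ × ℝ →L[ℝ] ℝ × ℝ := fun z =>
    (Matrix.toLin (.finTwoProd ℝ) (.finTwoProd ℝ)
      !![u 0 + z.2 * w 0, z.1 * w 0; u 1 + z.2 * w 1, z.1 * w 1]).toContinuousLinearMap
  have hf' : ∀ z, HasFDerivAt f (f' z) z := by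
    intro z
    simp only [f', Matrix.toLin_finTwoProd_toContinuousLinearMap]
    have key : ∀ p q r : ℝ, HasFDerivAt (fun z : ℝ × ℝ => p + z.1 * (q + z.2 * r))
        ((q + z.2 * r) • ContinuousLinearMap.fst ℝ ℝ ℝ +
          (z.1 * r) • ContinuousLinearMap.snd ℝ ℝ ℝ) z := by
      intro p q r
      have h1 : HasFDerivAt (fun z : ℝ × ℝ => q + z.2 * r)
          (r • ContinuousLinearMap.snd ℝ ℝ ℝ) z :=
        (hasFDerivAt_snd.mul_const r).const_add q
      have h2 := ((hasFDerivAt_fst (𝕜 := ℝ) (E := ℝ) (F := ℝ) (p := z)).mul h1).const_add p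
      convert! h2 using 1
      rw [smul_smul, add_comm]
    exact (key _ _ _).prodMk (key _ _ _)
  have hdet : ∀ z, (f' z).det = z.1 * cross u w := by
    intro z
    simp only [f', LinearMap.det_toContinuousLinearMap, LinearMap.det_toLin,
      Matrix.det_fin_two_of, cross]
    ring
  have hinj' : InjOn f Q := fun x hx y hy hxy => hinj hx hy (by rw [hfan, hfan, hxy])
  have himg : fan a u w '' Q = planeEquiv '' (f '' Q) := by
    rw [image_image]
    exact image_congr fun z _ => hfan z
  rw [himg, measurePreserving_planeEquiv.setIntegral_image_emb planeEquiv.measurableEmbedding,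
    integral_image_eq_integral_abs_det_fderiv_smul volume hQm
      (fun z _ => (hf' z).hasFDerivWithinAt) hinj']
  refine setIntegral_congr_fun hQm fun z hz => ?_
  simp only [hdet, smul_eq_mul, hfan, abs_mul, abs_of_pos hz.1.1]
  ring

theorem image_fan_eq_interior {K : Finset Plane} {a b c : Plane} (h : IsTri K) (hab : a ≠ b)
    (hac : a ≠ c) (hbc : b ≠ c) (hK : K = {a, b, c}) :
    fan a (b - a) (c - b) '' (Ioo 0 1 ×ˢ Ioo 0 1) = interior (convexHull ℝ (K : Set Plane)) ∧
      InjOn (fan a (b - a) (c - b)) (Ioo 0 1 ×ˢ Ioo 0 1) := by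
  have ha : a ∈ K := by simp [hK]
  have hb : b ∈ K := by simp [hK]
  have hc : c ∈ K := by simp [hK]
  have hlam : ∀ d z, lam K d (fan a (b - a) (c - b) z) =
      (1 - z.1) * lam K d a + z.1 * (1 - z.2) * lam K d b + z.1 * z.2 * lam K d c := by
    intro d z
    have e : fan a (b - a) (c - b) z =
        AffineMap.lineMap a (AffineMap.lineMap b c z.2) z.1 := by
      simp only [fan, AffineMap.lineMap_apply, vsub_eq_sub, vadd_eq_add, smul_sub, smul_add]
      abel
    rw [e, AffineMap.apply_lineMap, AffineMap.apply_lineMap]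
    simp only [AffineMap.lineMap_apply, vsub_eq_sub, vadd_eq_add, smul_eq_mul]
    ring
  have la : ∀ z, lam K a (fan a (b - a) (c - b) z) = 1 - z.1 := fun z => by
    rw [hlam, h.lam_self ha, h.lam_of_ne ha hb hab, h.lam_of_ne ha hc hac]; ring
  have lb : ∀ z, lam K b (fan a (b - a) (c - b) z) = z.1 * (1 - z.2) := fun z => by
    rw [hlam, h.lam_self hb, h.lam_of_ne hb ha hab.symm, h.lam_of_ne hb hc hbc]; ring
  have lc : ∀ z, lam K c (fan a (b - a) (c - b) z) = z.1 * z.2 := fun z => by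
    rw [hlam, h.lam_self hc, h.lam_of_ne hc ha hac.symm, h.lam_of_ne hc hb hbc.symm]; ring
  constructor
  · ext x
    rw [h.mem_interior]
    constructor
    · rintro ⟨z, ⟨hz1, hz2⟩, rfl⟩ d hd
      rw [hK] at hd
      simp only [Finset.mem_insert, Finset.mem_singleton] at hd
      rcases hd with rfl | rfl | rfl
      · rw [la]; linarith [hz1.2]
      · rw [lb]; exact mul_pos hz1.1 (by linarith [hz2.2])
      · rw [lc]; exact mul_pos hz1.1 hz2.1
    · intro hx
      have pa := hx a ha
      have pb := hx b hb
      have pc := hx c hc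
      have hs := h.sum_lam x
      have hs2 := h.sum_lam_smul x
      have hexp : ∀ {M : Type} [AddCommMonoid M] (F : Plane → M),
          ∑ d ∈ K, F d = F a + (F b + F c) := by
        intro M _ F
        rw [hK, Finset.sum_insert (by simp [hab, hac]), Finset.sum_pair hbc]
      rw [hexp] at hs hs2
      have hp : 0 < lam K b x + lam K c x := by linarith
      refine ⟨(lam K b x + lam K c x, lam K c x / (lam K b x + lam K c x)),
        ⟨⟨hp, by simp only; linarith⟩, div_pos pc hp, (div_lt_one hp).2 (by linarith)⟩, ?_⟩
      have e1 : (lam K b x + lam K c x) * (lam K c x / (lam K b x + lam K c x)) = lam K c x := by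
        field_simp
      simp only [fan, smul_add, smul_smul, e1]
      conv_rhs => rw [← hs2]
      have : lam K a x = 1 - (lam K b x + lam K c x) := by linarith
      rw [this]
      module
  · rintro z hz z' hz' e
    have e1 := congrArg (lam K a) e
    have e2 := congrArg (lam K c) e
    rw [la, la] at e1
    rw [lc, lc] at e2
    have h1 : z.1 = z'.1 := by linarith
    rw [h1] at e2
    exact Prod.ext h1 (mul_left_cancel₀ hz'.1.1.ne' e2)

theorem integral_fan (a u w : Plane) {Φ : Plane → ℝ} (hΦ : ContDiff ℝ 1 Φ) :
    ∫ z in Ioo (0:ℝ) 1 ×ˢ Ioo (0:ℝ) 1, |cross u w| *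
        (z.1 * (2 * Φ (fan a u w z) + fderiv ℝ Φ (fan a u w z) (fan a u w z - a))) =
      |cross u w| * ∫ s in (0:ℝ)..1, Φ (a + u + s • w) := by
  rw [integral_const_mul]
  congr 1
  have hcfan : Continuous (fan a u w) := by unfold fan; fun_prop
  have hcont : Continuous fun z : ℝ × ℝ =>
      z.1 * (2 * Φ (fan a u w z) + fderiv ℝ Φ (fan a u w z) (fan a u w z - a)) := by
    have h1 : Continuous fun z => fderiv ℝ Φ (fan a u w z) :=
      (hΦ.continuous_fderiv one_ne_zero).comp hcfan
    exact continuous_fst.mul ((continuous_const.mul (hΦ.continuous.comp hcfan)).add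
      (h1.clm_apply (hcfan.sub continuous_const)))
  have hint : IntegrableOn (fun z : ℝ × ℝ =>
      z.1 * (2 * Φ (fan a u w z) + fderiv ℝ Φ (fan a u w z) (fan a u w z - a)))
      (Ioo (0:ℝ) 1 ×ˢ Ioo (0:ℝ) 1) (volume.prod volume) := by
    refine IntegrableOn.mono_set (t := Icc (0:ℝ) 1 ×ˢ Icc (0:ℝ) 1) ?_
      (prod_mono Ioo_subset_Icc_self Ioo_subset_Icc_self)
    exact hcont.continuousOn.integrableOn_compact (isCompact_Icc.prod isCompact_Icc)
  rw [IntegrableOn, ← Measure.prod_restrict] at hint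
  rw [Measure.volume_eq_prod, ← Measure.prod_restrict, integral_prod_symm _ hint,
    intervalIntegral.integral_of_le zero_le_one, integral_Ioc_eq_integral_Ioo]
  refine integral_congr_ae (Filter.Eventually.of_forall fun s => ?_)
  have hder : ∀ x : ℝ, HasDerivAt (fun x : ℝ => x ^ 2 * Φ (fan a u w (x, s)))
      (x * (2 * Φ (fan a u w (x, s)) + fderiv ℝ Φ (fan a u w (x, s)) (fan a u w (x, s) - a))) x := by
    intro x
    have h1 : HasDerivAt (fun x : ℝ => fan a u w (x, s)) (u + s • w) x := by
      have := ((hasDerivAt_id x).smul_const (u + s • w)).const_add a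
      simpa only [id, one_smul, fan] using! this
    have h2 : HasDerivAt (fun x : ℝ => Φ (fan a u w (x, s)))
        (fderiv ℝ Φ (fan a u w (x, s)) (u + s • w)) x :=
      ((hΦ.differentiable one_ne_zero _).hasFDerivAt).comp_hasDerivAt x h1
    have h3 := (hasDerivAt_pow 2 x).mul h2
    convert! h3 using 1
    have : fan a u w (x, s) - a = x • (u + s • w) := by simp [fan]
    rw [this, map_smul, smul_eq_mul]
    push_cast
    ring
  have hc : Continuous fun x : ℝ =>
      x * (2 * Φ (fan a u w (x, s)) + fderiv ℝ Φ (fan a u w (x, s)) (fan a u w (x, s) - a)) :=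
    hcont.comp (by fun_prop : Continuous fun x : ℝ => (x, s))
  have := intervalIntegral.integral_eq_sub_of_hasDerivAt (a := (0:ℝ)) (b := 1)
    (fun x _ => hder x) (hc.intervalIntegrable _ _)
  rw [intervalIntegral.integral_of_le zero_le_one, integral_Ioc_eq_integral_Ioo] at this
  simp only [this]
  simp [fan, add_assoc]

/-- Arc length on a segment. -/
theorem integral_segment (b c : Plane) (Φ : Plane → ℝ) (hΦ : Continuous Φ) :
    ∫ x in segment ℝ b c, Φ x ∂(Measure.hausdorffMeasure 1 : Measure Plane) =
      ‖c - b‖ * ∫ s in (0:ℝ)..1, Φ (b + s • (c - b)) := by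
  have hcont : Continuous (AffineMap.lineMap b c : ℝ → Plane) := AffineMap.lineMap_continuous
  have key : (Measure.hausdorffMeasure 1 : Measure Plane).restrict (segment ℝ b c) =
      nndist b c • (volume.restrict (Icc (0:ℝ) 1)).map (AffineMap.lineMap b c : ℝ → Plane) := by
    ext S hS
    rw [Measure.restrict_apply hS, Measure.smul_apply, Measure.map_apply hcont.measurable hS,
      Measure.restrict_apply (hcont.measurable hS), segment_eq_image_lineMap,
      ← image_preimage_inter, hausdorffMeasure_lineMap_image, hausdorffMeasure_real]
  rw [key, integral_smul_nnreal_measure, integral_map hcont.aemeasurable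
    hΦ.aestronglyMeasurable, integral_Icc_eq_integral_Ioc,
    ← intervalIntegral.integral_of_le zero_le_one, NNReal.smul_def, coe_nndist, smul_eq_mul,
    dist_eq_norm']
  simp only [AffineMap.lineMap_apply, vsub_eq_sub, vadd_eq_add, add_comm]

theorem inner_eq (u w : Plane) : inner ℝ u w = u 0 * w 0 + u 1 * w 1 := by
  simp [PiLp.inner_apply, Fin.sum_univ_two, mul_comm]

theorem abs_cross_eq {n u w : Plane} (hn : ‖n‖ = 1) (hnw : inner ℝ n w = 0)
    (hu : 0 ≤ inner ℝ n u) : |cross u w| = inner ℝ n u * ‖w‖ := by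
  have h1 : n 0 * n 0 + n 1 * n 1 = 1 := by
    rw [← inner_eq, real_inner_self_eq_norm_sq, hn, one_pow]
  have hw : ‖w‖ ^ 2 = w 0 * w 0 + w 1 * w 1 := by rw [← inner_eq, real_inner_self_eq_norm_sq]
  rw [inner_eq] at hnw hu ⊢
  rw [← abs_of_nonneg hu, ← abs_of_nonneg (norm_nonneg w), ← abs_mul, ← sq_eq_sq_iff_abs_eq_abs,
    mul_pow, hw, cross]
  set s := n 0 * w 1 - n 1 * w 0 with hs
  have e0 : w 0 = -(n 1 * s) := by rw [hs]; linear_combination (-w 0) * h1 + n 0 * hnw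
  have e1 : w 1 = n 0 * s := by rw [hs]; linear_combination (-w 1) * h1 + n 1 * hnw
  rw [e0, e1]
  linear_combination (-(u 0 * n 0 + u 1 * n 1) ^ 2 * s ^ 2) * h1

theorem exists_height {K : Finset Plane} {a : Plane} (h : IsTri K) (ha : a ∈ K) :
    ∃ H : ℝ, 0 < H ∧ (∃ n, IsOutwardNormal K (K.erase a) n) ∧
      (∀ n, IsOutwardNormal K (K.erase a) n → ∀ x ∈ side (K, a), inner ℝ (x - a) n = H) ∧
      ∀ Φ : Plane → ℝ, ContDiff ℝ 1 Φ →
        ∫ x in convexHull ℝ (K : Set Plane), (2 * Φ x + fderiv ℝ Φ x (x - a)) =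
          H * ∫ x in side (K, a), Φ x ∂(Measure.hausdorffMeasure 1 : Measure Plane) := by
  obtain ⟨b, c, hab, hac, hbc, hK, hKe⟩ := h.exists_eq ha
  obtain ⟨himg, hinj⟩ := image_fan_eq_interior h hab hac hbc hK
  have hside : side (K, a) = segment ℝ b c := by
    rw [side, hKe, Finset.coe_pair, convexHull_pair]
  set u := b - a with hu
  set w := c - b with hw
  have hw0 : 0 < ‖w‖ := norm_pos_iff.2 (sub_ne_zero.2 hbc.symm)
  have hcone : ∀ Φ : Plane → ℝ, ContDiff ℝ 1 Φ →
      ∫ x in convexHull ℝ (K : Set Plane), (2 * Φ x + fderiv ℝ Φ x (x - a)) =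
        |cross u w| * ∫ s in (0:ℝ)..1, Φ (a + u + s • w) := by
    intro Φ hΦ
    rw [← integral_fan a u w hΦ, ← setIntegral_image_fan a u w
      (fun x => 2 * Φ x + fderiv ℝ Φ x (x - a)) hinj, himg]
    refine setIntegral_congr_set ?_
    refine (ae_le_set.2 (measure_mono_null ?_ (volume_frontier_convexHull (K : Set Plane)))).antisymm
      (Filter.Eventually.of_forall fun x hx => interior_subset hx)
    exact fun x hx => ⟨subset_closure hx.1, hx.2⟩
  have hcr : cross u w ≠ 0 := by
    intro h0
    have h1 := hcone (fun _ => 1) contDiff_const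
    rw [h0, abs_zero, zero_mul] at h1
    simp only [mul_one, fderiv_fun_const, Pi.zero_apply, zero_apply, add_zero,
      setIntegral_const, smul_eq_mul, mul_eq_zero, OfNat.ofNat_ne_zero, or_false] at h1
    rw [measureReal_eq_zero_iff (IsTri.isCompact K).measure_lt_top.ne] at h1
    obtain ⟨x, hx⟩ := h.interior_nonempty
    exact (isOpen_interior.measure_pos volume ⟨x, hx⟩).ne'
      (measure_mono_null interior_subset h1)
  have hHn : ∀ n, IsOutwardNormal K (K.erase a) n → ∀ x ∈ side (K, a),
      inner ℝ (x - a) n = |cross u w| / ‖w‖ := by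
    rintro n ⟨hn1, hn2, hn3⟩ x hx
    have hbe : b ∈ K.erase a := by simp [hKe]
    have hce : c ∈ K.erase a := by simp [hKe]
    have i1 : inner ℝ n w = 0 := hn2 b hbe c hce
    have i2 : 0 ≤ inner ℝ n u := by
      have := hn3 b hbe a ha
      rw [← neg_sub, inner_neg_right] at this
      linarith
    rw [abs_cross_eq hn1 i1 i2, mul_div_cancel_right₀ _ hw0.ne', real_inner_comm]
    rw [hside, segment_eq_image_lineMap] at hx
    obtain ⟨t, -, rfl⟩ := hx
    have : AffineMap.lineMap b c t - a = u + t • w := by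
      rw [AffineMap.lineMap_apply, vsub_eq_sub, vadd_eq_add, hu, hw]; abel
    rw [this, inner_add_right, inner_smul_right, i1, mul_zero, add_zero]
  refine ⟨|cross u w| / ‖w‖, by positivity, ?_, hHn, fun Φ hΦ => ?_⟩
  · have hex : ∃ n : Plane, ‖n‖ = 1 ∧ inner ℝ n w = 0 ∧ 0 ≤ inner ℝ n u := by
      let m : Plane := ‖w‖⁻¹ • !₂[w 1, -w 0]
      have hm : ‖m‖ = 1 := by
        rw [norm_smul, norm_inv, norm_norm]
        have : ‖(!₂[w 1, -w 0] : Plane)‖ = ‖w‖ := by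
          simp [EuclideanSpace.norm_eq, Fin.sum_univ_two, add_comm]
        rw [this, inv_mul_cancel₀ hw0.ne']
      have hmw : inner ℝ m w = 0 := by
        rw [inner_smul_left, inner_eq]; simp; right; ring
      rcases le_total 0 (inner ℝ m u) with h0 | h0
      · exact ⟨m, hm, hmw, h0⟩
      · exact ⟨-m, by rwa [norm_neg], by rw [inner_neg_left, hmw, neg_zero],
          by rw [inner_neg_left]; linarith⟩
    obtain ⟨n, hn, hnw, hnu⟩ := hex
    refine ⟨n, hn, ?_, ?_⟩
    · intro x hx y hy
      simp only [hKe, Finset.mem_insert, Finset.mem_singleton] at hx hy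
      rcases hx with rfl | rfl <;> rcases hy with rfl | rfl
      · simp
      · exact hnw
      · rw [← neg_sub, inner_neg_right, hnw, neg_zero]
      · simp
    · have e1 : inner ℝ n (a - b) ≤ 0 := by rw [← neg_sub, inner_neg_right]; linarith
      have e2 : inner ℝ n (b - c) = 0 := by rw [← neg_sub, inner_neg_right, hnw, neg_zero]
      have e3 : inner ℝ n (a - c) ≤ 0 := by
        rw [← sub_add_sub_cancel a b c, inner_add_right, e2]; linarith
      intro x hx z hz
      rw [hKe] at hx
      rw [hK] at hz
      simp only [Finset.mem_insert, Finset.mem_singleton] at hx hz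
      rcases hx with rfl | rfl <;> rcases hz with rfl | rfl | rfl
      · exact e1
      · simp
      · exact hnw.le
      · exact e3
      · exact e2.le
      · simp
  · rw [hcone Φ hΦ, hside, integral_segment b c Φ hΦ.continuous, ← hw, ← mul_assoc,
      div_mul_cancel₀ _ hw0.ne']
    simp [hu]

/-- The distance of the vertex `s.2` of the triangle `s.1` to the opposite side. -/
noncomputable def height (s : Finset Plane × Plane) : ℝ :=
  open Classical in if h : IsTri s.1 ∧ s.2 ∈ s.1 then (exists_height h.1 h.2).choose else 1

variable {K : Finset Plane} {a : Plane}

theorem height_eq (h : IsTri K) (ha : a ∈ K) : height (K, a) = (exists_height h ha).choose :=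
  dif_pos ⟨h, ha⟩

theorem height_pos (h : IsTri K) (ha : a ∈ K) : 0 < height (K, a) := by
  rw [height_eq h ha]; exact (exists_height h ha).choose_spec.1

theorem exists_isOutwardNormal (h : IsTri K) (ha : a ∈ K) : ∃ n, IsOutwardNormal K (K.erase a) n :=
  (exists_height h ha).choose_spec.2.1

theorem inner_sub_eq_height (h : IsTri K) (ha : a ∈ K) {n : Plane}
    (hn : IsOutwardNormal K (K.erase a) n) {x : Plane}
    (hx : x ∈ side (K, a)) : inner ℝ (x - a) n = height (K, a) := by
  rw [height_eq h ha]; exact (exists_height h ha).choose_spec.2.2.1 n hn x hx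

/-- The divergence theorem on a triangle for the field `Φ(x) (x - a)`. -/
theorem integral_cone (h : IsTri K) (ha : a ∈ K) {Φ : Plane → ℝ} (hΦ : ContDiff ℝ 1 Φ) :
    ∫ x in convexHull ℝ (K : Set Plane), (2 * Φ x + fderiv ℝ Φ x (x - a)) =
      height (K, a) * ∫ x in side (K, a), Φ x ∂(Measure.hausdorffMeasure 1 : Measure Plane) := by
  rw [height_eq h ha]; exact (exists_height h ha).choose_spec.2.2.2 Φ hΦ

end Hypercircle

namespace Hypercircle

open Filter Topology

variable {Ω : Set Plane}

/-! ### Square integrable functions -/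

theorem memLp_of_continuous {E : Type*} [NormedAddCommGroup E] [NormedSpace ℝ E]
    (hb : Bornology.IsBounded Ω) {φ : Plane → E} (hφ : Continuous φ)
    [SecondCountableTopologyEither Plane E] :
    MemLp φ 2 (volume.restrict Ω) := by
  have hc : IsCompact (closure Ω) := hb.isCompact_closure
  have hfin : IsFiniteMeasure (volume.restrict (closure Ω) : Measure Plane) :=
    ⟨by rw [Measure.restrict_apply_univ]; exact hc.measure_lt_top⟩
  obtain ⟨C, hC⟩ := hc.exists_bound_of_continuousOn hφ.continuousOn
  have : MemLp φ 2 (volume.restrict (closure Ω)) :=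
    MemLp.of_bound hφ.aestronglyMeasurable C
      ((ae_restrict_iff' isClosed_closure.measurableSet).2 (Eventually.of_forall hC))
  exact this.mono_measure (Measure.restrict_mono subset_closure le_rfl)

theorem integrable_mul_of_memLp {α : Type*} [MeasurableSpace α] {μ : Measure α} {f g : α → ℝ}
    (hf : MemLp f 2 μ) (hg : MemLp g 2 μ) : Integrable (fun x => f x * g x) μ :=
  hf.integrable_mul hg

theorem integrable_inner_of_memLp {α : Type*} [MeasurableSpace α] {μ : Measure α} {f g : α → Plane}
    (hf : MemLp f 2 μ) (hg : MemLp g 2 μ) : Integrable (fun x => inner ℝ (f x) (g x)) μ := by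
  refine (L2.integrable_inner (𝕜 := ℝ) (hf.toLp f) (hg.toLp g)).congr ?_
  filter_upwards [hf.coeFn_toLp, hg.coeFn_toLp] with x h1 h2
  rw [h1, h2]

theorem integrable_smul_of_memLp {α E : Type*} [MeasurableSpace α] {μ : Measure α}
    [NormedAddCommGroup E] [NormedSpace ℝ E] {f : α → ℝ} {g : α → E}
    (hf : MemLp f 2 μ) (hg : MemLp g 2 μ) : Integrable (fun x => f x • g x) μ :=
  memLp_one_iff_integrable.1 (MemLp.smul (r := 1) hg hf)

theorem continuous_gradient {φ : Plane → ℝ} (hφ : ContDiff ℝ ∞ φ) : Continuous (gradient φ) := by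
  have : Continuous (fderiv ℝ φ) := hφ.continuous_fderiv (by simp)
  exact (InnerProductSpace.toDual ℝ Plane).symm.continuous.comp this

theorem inner_gradient (φ : Plane → ℝ) (x v : Plane) :
    inner ℝ (gradient φ x) v = fderiv ℝ φ x v := by
  simp [gradient]

/-- The defining property of the weak gradient, in the direction `e`. -/
theorem H1.integral_eq (hb : Bornology.IsBounded Ω) {u : L2 Ω × L2Vec Ω} (hu : u ∈ H1 Ω)
    {φ : Plane → ℝ} (hφ : φ ∈ testFunctions Ω) (e : Plane) :
    ∫ x in Ω, u.1 x * fderiv ℝ φ x e = -∫ x in Ω, φ x * inner ℝ (u.2 x) e := by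
  have h := congrArg (fun v => inner ℝ e v) (hu φ hφ)
  have i1 : Integrable (fun x => u.1 x • gradient φ x) (volume.restrict Ω) :=
    integrable_smul_of_memLp (Lp.memLp _) (memLp_of_continuous hb (continuous_gradient hφ.1))
  have i2 : Integrable (fun x => φ x • u.2 x) (volume.restrict Ω) :=
    integrable_smul_of_memLp (memLp_of_continuous hb hφ.1.continuous) (Lp.memLp _)
  simp only [inner_neg_right] at h
  rw [← integral_inner i1, ← integral_inner i2] at h
  simp only [inner_smul_right] at h
  have c : ∀ v : Plane, inner ℝ e v = inner ℝ v e := fun v => real_inner_comm _ _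
  simpa only [c, inner_gradient] using h

theorem H1.of_integral_eq (hb : Bornology.IsBounded Ω) {u : L2 Ω × L2Vec Ω}
    (h : ∀ φ ∈ testFunctions Ω, ∀ e : Plane,
      ∫ x in Ω, u.1 x * fderiv ℝ φ x e = -∫ x in Ω, φ x * inner ℝ (u.2 x) e) : u ∈ H1 Ω := by
  intro φ hφ
  have i1 : Integrable (fun x => u.1 x • gradient φ x) (volume.restrict Ω) :=
    integrable_smul_of_memLp (Lp.memLp _) (memLp_of_continuous hb (continuous_gradient hφ.1))
  have i2 : Integrable (fun x => φ x • u.2 x) (volume.restrict Ω) :=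
    integrable_smul_of_memLp (memLp_of_continuous hb hφ.1.continuous) (Lp.memLp _)
  refine ext_inner_left ℝ fun e => ?_
  rw [inner_neg_right, ← integral_inner i1, ← integral_inner i2]
  simp only [inner_smul_right]
  have c : ∀ v : Plane, inner ℝ e v = inner ℝ v e := fun v => real_inner_comm _ _
  simpa only [c, inner_gradient] using h φ hφ e

/-! ### Mollification -/

theorem continuous_correlation {f g : Plane → ℝ} (hf : MemLp f 2 volume) (hg : MemLp g 2 volume) :
    Continuous fun h : Plane => ∫ z, f z * g (z + h) := by
  have : Fact ((2 : ENNReal) ≠ ⊤) := ⟨by norm_num⟩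
  have hcont : Continuous fun h : Plane => (DomAddAct.mk h +ᵥ hg.toLp g : Lp ℝ 2 volume) := by
    have h1 : Continuous fun h : Plane => DomAddAct.mk h := DomAddAct.continuous_mk
    exact h1.vadd continuous_const
  refine ((continuous_const (y := hf.toLp f)).inner hcont (𝕜 := ℝ)).congr fun h => ?_
  rw [DomAddAct.mk_vadd_toLp, L2.inner_def]
  refine integral_congr_ae ?_
  filter_upwards [hf.coeFn_toLp,
    (hg.comp_measurePreserving (measurePreserving_vadd h volume)).coeFn_toLp] with z h1 h2
  rw [h1]
  refine (congrArg (inner ℝ (f z)) h2).trans ?_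
  simp [mul_comm, add_comm]

theorem integral_mul_mollify {f g η : Plane → ℝ} (hf : MemLp f 2 volume) (hg : MemLp g 2 volume)
    (hfm : StronglyMeasurable f) (hgm : StronglyMeasurable g) (hη : Continuous η)
    (hηc : HasCompactSupport η) (h : Plane) :
    ∫ z, f z * ∫ y, g y * η (z + h - y) = ∫ s, η s * ∫ z, f z * g (z + (h - s)) := by
  have e1 : ∀ z, f z * ∫ y, g y * η (z + h - y) = ∫ s, η s * (f z * g (z + (h - s))) := by
    intro z
    rw [← integral_sub_left_eq_self (fun y => g y * η (z + h - y)) volume (z + h),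
      ← integral_const_mul]
    refine integral_congr_ae (Eventually.of_forall fun s => ?_)
    have : z + h - (z + h - s) = s := sub_sub_cancel _ _
    simp only [this]
    rw [add_sub_assoc]
    ring
  simp_rw [e1, ← integral_const_mul]
  refine integral_integral_swap ?_
  have hm : StronglyMeasurable (fun p : Plane × Plane => η p.2 * (f p.1 * g (p.1 + (h - p.2)))) := by
    refine (hη.stronglyMeasurable.comp_measurable measurable_snd).mul
      ((hfm.comp_measurable measurable_fst).mul (hgm.comp_measurable ?_))
    fun_prop
  refine (integrable_prod_iff' hm.aestronglyMeasurable).2 ⟨Eventually.of_forall fun s => ?_, ?_⟩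
  · exact (integrable_mul_of_memLp hf (hg.comp_measurePreserving
      (measurePreserving_add_right volume (h - s)))).const_mul (η s)
  · have hC := (continuous_correlation hf.norm hg.norm).comp
      (by fun_prop : Continuous fun s : Plane => h - s)
    have : Continuous fun s => |η s| * ∫ z, ‖f z‖ * ‖g (z + (h - s))‖ := hη.abs.mul hC
    refine (this.integrable_of_hasCompactSupport ?_).congr (Eventually.of_forall fun s => ?_)
    · exact (hηc.comp_left (g := fun r => |r|) abs_zero).mul_right
    · simp only [norm_mul, integral_const_mul, Real.norm_eq_abs]

theorem tendsto_mollify {f g : Plane → ℝ} (hf : MemLp f 2 volume) (hg : MemLp g 2 volume)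
    (hfm : StronglyMeasurable f) (hgm : StronglyMeasurable g) {ι : Type*} {l : Filter ι}
    {η : ι → ContDiffBump (0 : Plane)} {h : ι → Plane}
    (hη : Tendsto (fun i => (η i).rOut) l (𝓝 0)) (hh : Tendsto h l (𝓝 0)) :
    Tendsto (fun i => ∫ z, f z * ∫ y, g y * (η i).normed volume (z + h i - y)) l
      (𝓝 (∫ z, f z * g z)) := by
  have hC := continuous_correlation hf hg
  have := ContDiffBump.convolution_tendsto_right (μ := volume) (φ := η) (k := h)
    (g := fun _ : ι => fun h : Plane => ∫ z, f z * g (z + h)) (x₀ := 0)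
    (z₀ := ∫ z, f z * g (z + 0)) hη (Eventually.of_forall fun _ => hC.aestronglyMeasurable)
    ((hC.tendsto 0).comp tendsto_snd) hh
  simp only [add_zero] at this
  refine this.congr fun i => ?_
  rw [integral_mul_mollify hf hg hfm hgm (η i).continuous_normed (η i).hasCompactSupport_normed]
  rfl

theorem contDiff_mollify {g η : Plane → ℝ} (hg : LocallyIntegrable g) (hη : ContDiff ℝ ∞ η)
    (hηc : HasCompactSupport η) (h : Plane) :
    ContDiff ℝ ∞ fun z => ∫ y, g y * η (z + h - y) := by
  have := hηc.contDiff_convolution_right (ContinuousLinearMap.mul ℝ ℝ) hg hη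
  exact this.comp (contDiff_id.add contDiff_const)

theorem fderiv_mollify {g η : Plane → ℝ} (hg : LocallyIntegrable g) (hη : ContDiff ℝ ∞ η)
    (hηc : HasCompactSupport η) (h z e : Plane) :
    fderiv ℝ (fun z => ∫ y, g y * η (z + h - y)) z e =
      ∫ y, g y * fderiv ℝ η (z + h - y) e := by
  have h1 := hηc.hasFDerivAt_convolution_right (ContinuousLinearMap.mul ℝ ℝ) hg
    (hη.of_le (by norm_cast)) (z + h)
  have h2 := HasFDerivAt.comp z h1 ((hasFDerivAt_id z).add_const h)
  have h3 : (convolution g η (ContinuousLinearMap.mul ℝ ℝ) volume ∘ fun x => id x + h) =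
      fun z => ∫ y, g y * η (z + h - y) := rfl
  rw [h3] at h2
  rw [h2.fderiv, ContinuousLinearMap.comp_id, convolution_precompR_apply _ hg
    (hηc.fderiv ℝ) (hη.continuous_fderiv (by simp))]
  rfl

end Hypercircle

namespace Hypercircle

open Filter Topology

variable {Ω : Set Plane}

/-! ### Density of the smooth functions in `H¹` of a Lipschitz domain -/

theorem norm_sub_le_of_mem_tsupport {η : ContDiffBump (0 : Plane)} {x : Plane}
    (h : x ∈ tsupport (η.normed volume)) : ‖x‖ ≤ η.rOut := by
  rw [η.tsupport_normed_eq] at h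
  simpa using h

/-- The gradient of a mollified function, in terms of the weak gradient. -/
theorem fderiv_mollify_eq (hΩ : IsOpen Ω) (hb : Bornology.IsBounded Ω) {v : L2 Ω × L2Vec Ω}
    (hv : v ∈ H1 Ω) {ψ η : Plane → ℝ} (hψ : ContDiff ℝ ∞ ψ) (hη : ContDiff ℝ ∞ η)
    (hηc : HasCompactSupport η) {h z : Plane} (e : Plane)
    (hsub : ∀ y ∈ tsupport ψ, z + h - y ∈ tsupport η → ∀ y, z + h - y ∈ tsupport η → y ∈ Ω)
    (hg : LocallyIntegrable (Ω.indicator fun y => ψ y * v.1 y)) :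
    fderiv ℝ (fun z => ∫ y, Ω.indicator (fun y => ψ y * v.1 y) y * η (z + h - y)) z e =
      ∫ y, Ω.indicator (fun y => ψ y * inner ℝ (v.2 y) e + v.1 y * fderiv ℝ ψ y e) y *
        η (z + h - y) := by
  rw [fderiv_mollify hg hη hηc]
  have hind : ∀ F G : Plane → ℝ, ∫ y, Ω.indicator F y * G y = ∫ y in Ω, F y * G y := by
    intro F G
    rw [← integral_indicator hΩ.measurableSet]
    refine integral_congr_ae (Eventually.of_forall fun y => ?_)
    simp only [indicator]
    split_ifs <;> simp
  rw [hind, hind]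
  by_cases hex : ∃ y ∈ tsupport ψ, z + h - y ∈ tsupport η
  · obtain ⟨y₀, hy₀, hy₀'⟩ := hex
    have hin := hsub y₀ hy₀ hy₀'
    set χ : Plane → ℝ := fun y => η (z + h - y) with hχ
    have hχs : ContDiff ℝ ∞ χ := hη.comp (contDiff_const.sub contDiff_id)
    have hχd : ∀ y, fderiv ℝ χ y e = -fderiv ℝ η (z + h - y) e := by
      intro y
      have h1 : HasFDerivAt (fun y : Plane => z + h - y) (-ContinuousLinearMap.id ℝ Plane) y :=
        (hasFDerivAt_id y).const_sub (z + h)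
      have h2 := HasFDerivAt.comp y
        (hη.differentiable (by simp) (z + h - y)).hasFDerivAt h1
      have h3 : (η ∘ fun y => z + h - y) = χ := rfl
      rw [h3] at h2
      rw [h2.fderiv]
      simp
    let hom : Plane ≃ₜ Plane := Homeomorph.subLeft (z + h)
    have hχt : tsupport χ = hom ⁻¹' tsupport η := tsupport_comp_eq_preimage η hom
    have hχc : HasCompactSupport χ := hηc.comp_homeomorph hom
    have htest : (fun y => χ y * ψ y) ∈ testFunctions Ω := by
      refine ⟨hχs.mul hψ, hχc.mul_right, ?_⟩
      refine (closure_mono (Function.support_mul_subset_left χ ψ)).trans fun y hy => ?_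
      have hy' : y ∈ tsupport χ := hy
      rw [hχt] at hy'
      exact hin y hy'
    have key := H1.integral_eq hb hv htest e
    have hprod : ∀ y, fderiv ℝ (fun y => χ y * ψ y) y e =
        χ y * fderiv ℝ ψ y e + ψ y * fderiv ℝ χ y e := by
      intro y
      rw [fderiv_fun_mul (hχs.differentiable (by simp) y) (hψ.differentiable (by simp) y)]
      simp
    simp only [hprod, hχd] at key
    have m1 : MemLp (fun y => χ y * fderiv ℝ ψ y e) 2 (volume.restrict Ω) :=
      memLp_of_continuous hb (hχs.continuous.mul
        ((hψ.continuous_fderiv (by simp)).clm_apply continuous_const))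
    have m2 : MemLp (fun y => ψ y * fderiv ℝ η (z + h - y) e) 2 (volume.restrict Ω) :=
      memLp_of_continuous hb (hψ.continuous.mul
        (((hη.continuous_fderiv (by simp)).comp (by fun_prop)).clm_apply continuous_const))
    have m3 : MemLp (fun y => χ y * ψ y) 2 (volume.restrict Ω) :=
      memLp_of_continuous hb (hχs.continuous.mul hψ.continuous)
    have m4 : MemLp (fun y => inner ℝ (v.2 y) e) 2 (volume.restrict Ω) :=
      (Lp.memLp v.2).inner_const e
    have i1 := integrable_mul_of_memLp (Lp.memLp v.1) m1
    have i2 := integrable_mul_of_memLp (Lp.memLp v.1) m2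
    have i3 := integrable_mul_of_memLp m3 m4
    have s1 : ∫ y in Ω, v.1 y * (χ y * fderiv ℝ ψ y e + ψ y * -fderiv ℝ η (z + h - y) e) =
        (∫ y in Ω, v.1 y * (χ y * fderiv ℝ ψ y e)) -
          ∫ y in Ω, v.1 y * (ψ y * fderiv ℝ η (z + h - y) e) := by
      rw [← integral_sub i1 i2]
      exact integral_congr_ae (Eventually.of_forall fun y => by ring)
    have s2 : ∫ y in Ω, (ψ y * inner ℝ (v.2 y) e + v.1 y * fderiv ℝ ψ y e) * χ y =
        (∫ y in Ω, χ y * ψ y * inner ℝ (v.2 y) e) +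
          ∫ y in Ω, v.1 y * (χ y * fderiv ℝ ψ y e) := by
      rw [← integral_add i3 i1]
      exact integral_congr_ae (Eventually.of_forall fun y => by ring)
    have s3 : ∫ y in Ω, ψ y * v.1 y * fderiv ℝ η (z + h - y) e =
        ∫ y in Ω, v.1 y * (ψ y * fderiv ℝ η (z + h - y) e) :=
      integral_congr_ae (Eventually.of_forall fun y => by ring)
    rw [s1] at key
    rw [s2, s3]
    linarith
  · push Not at hex
    have e1 : ∀ y, ψ y * v.1 y * fderiv ℝ η (z + h - y) e = 0 := by
      intro y
      by_cases hy : y ∈ tsupport ψ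
      · have : fderiv ℝ η (z + h - y) = 0 :=
          image_eq_zero_of_notMem_tsupport fun h' => hex y hy (tsupport_fderiv_subset ℝ h')
        simp [this]
      · simp [image_eq_zero_of_notMem_tsupport hy]
    have e2 : ∀ y, (ψ y * inner ℝ (v.2 y) e + v.1 y * fderiv ℝ ψ y e) * η (z + h - y) = 0 := by
      intro y
      by_cases hy : y ∈ tsupport ψ
      · simp [image_eq_zero_of_notMem_tsupport (hex y hy)]
      · have : fderiv ℝ ψ y = 0 :=
          image_eq_zero_of_notMem_tsupport fun h' => hy (tsupport_fderiv_subset ℝ h')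
        simp [image_eq_zero_of_notMem_tsupport hy, this]
    simp [e1, e2]

theorem inner_eq_sum (x y : Plane) : inner ℝ x y =
    ∑ i, inner ℝ x (EuclideanSpace.single i 1) * inner ℝ y (EuclideanSpace.single i 1) := by
  simp [PiLp.inner_apply, Fin.sum_univ_two, mul_comm]

/-- A pair of square integrable functions orthogonal to the smooth functions is orthogonal to the
localizations of functions in `H¹(Ω)` to regions from which the domain can be shifted inside. -/
theorem integral_localized_eq_zero (hΩ : IsOpen Ω) (hb : Bornology.IsBounded Ω)
    {v w : L2 Ω × L2Vec Ω} (hv : v ∈ H1 Ω)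
    (hw : ∀ φ : Plane → ℝ, ContDiff ℝ ∞ φ →
      ∫ x in Ω, (w.1 x * φ x + inner ℝ (w.2 x) (gradient φ x)) = 0)
    {ψ : Plane → ℝ} (hψ : ContDiff ℝ ∞ ψ) (hψc : HasCompactSupport ψ) {U : Set Plane}
    (hU : IsOpen U) (hψU : tsupport ψ ⊆ U) {d : Plane} {c : ℝ} (hc : 0 < c)
    (hd : ∀ᶠ t in 𝓝[>] (0:ℝ), ∀ z ∈ Ω ∩ U, Metric.closedBall (z + t • d) (c * t) ⊆ Ω) :
    ∫ x in Ω, (ψ x * (v.1 x * w.1 x + inner ℝ (v.2 x) (w.2 x)) +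
      v.1 x * inner ℝ (gradient ψ x) (w.2 x)) = 0 := by
  set E : Fin 2 → Plane := fun i => EuclideanSpace.single i 1 with hE
  -- the extensions by zero
  set F : Plane → ℝ := Ω.indicator fun y => ψ y * v.1 y with hF
  set G : Fin 2 → Plane → ℝ := fun i =>
    Ω.indicator fun y => ψ y * inner ℝ (v.2 y) (E i) + v.1 y * fderiv ℝ ψ y (E i) with hG
  set V : Plane → ℝ := Ω.indicator fun y => w.1 y with hV
  set P : Fin 2 → Plane → ℝ := fun i => Ω.indicator fun y => inner ℝ (w.2 y) (E i) with hP
  have hdψ : ∀ i, Continuous fun y => fderiv ℝ ψ y (E i) := fun i =>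
    (hψ.continuous_fderiv (by simp)).clm_apply continuous_const
  have sv1 : StronglyMeasurable (v.1 : Plane → ℝ) := Lp.stronglyMeasurable _
  have sv2 : StronglyMeasurable (v.2 : Plane → Plane) := Lp.stronglyMeasurable _
  have sw1 : StronglyMeasurable (w.1 : Plane → ℝ) := Lp.stronglyMeasurable _
  have sw2 : StronglyMeasurable (w.2 : Plane → Plane) := Lp.stronglyMeasurable _
  have bmul : ∀ {φ : Plane → ℝ} {f : Plane → ℝ}, Continuous φ → HasCompactSupport φ →
      MemLp f 2 (volume.restrict Ω) → MemLp (fun y => φ y * f y) 2 (volume.restrict Ω) := by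
    intro φ f h1 h2 h3
    have : MemLp φ ⊤ (volume.restrict Ω) := h1.memLp_of_hasCompactSupport h2
    exact h3.mul (r := 2) this
  have hψdc : ∀ i, HasCompactSupport fun y => fderiv ℝ ψ y (E i) := fun i =>
    hψc.fderiv_apply ℝ (E i)
  have hFm : StronglyMeasurable F := (hψ.continuous.stronglyMeasurable.mul sv1).indicator
    hΩ.measurableSet
  have hFl : MemLp F 2 volume := (memLp_indicator_iff_restrict hΩ.measurableSet).2
    (bmul hψ.continuous hψc (Lp.memLp v.1))
  have hGm : ∀ i, StronglyMeasurable (G i) := fun i =>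
    ((hψ.continuous.stronglyMeasurable.mul (sv2.inner stronglyMeasurable_const)).add
      (sv1.mul (hdψ i).stronglyMeasurable)).indicator hΩ.measurableSet
  have hGl : ∀ i, MemLp (G i) 2 volume := fun i => by
    refine (memLp_indicator_iff_restrict hΩ.measurableSet).2 ?_
    refine (bmul hψ.continuous hψc ((Lp.memLp v.2).inner_const (E i))).add ?_
    simpa only [mul_comm] using bmul (hdψ i) (hψdc i) (Lp.memLp v.1)
  have hVm : StronglyMeasurable V := sw1.indicator hΩ.measurableSet
  have hVl : MemLp V 2 volume := (memLp_indicator_iff_restrict hΩ.measurableSet).2 (Lp.memLp w.1)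
  have hPm : ∀ i, StronglyMeasurable (P i) := fun i =>
    (sw2.inner stronglyMeasurable_const).indicator hΩ.measurableSet
  have hPl : ∀ i, MemLp (P i) 2 volume := fun i =>
    (memLp_indicator_iff_restrict hΩ.measurableSet).2 ((Lp.memLp w.2).inner_const (E i))
  have hFloc : LocallyIntegrable F volume := hFl.locallyIntegrable (by norm_num)
  -- the mollifiers
  let η : ℝ → ContDiffBump (0 : Plane) := fun t =>
    if ht : 0 < t then ⟨c * t / 2, c * t, by positivity, by nlinarith [mul_pos hc ht]⟩
    else ⟨1, 2, one_pos, one_lt_two⟩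
  have hη : ∀ t, 0 < t → (η t).rOut = c * t := fun t ht => by simp [η, ht]
  have hηlim : Tendsto (fun t => (η t).rOut) (𝓝[>] (0:ℝ)) (𝓝 0) := by
    have h1 : Tendsto (fun t : ℝ => c * t) (𝓝[>] (0:ℝ)) (𝓝 0) := by
      have : Continuous fun t : ℝ => c * t := by fun_prop
      simpa using (this.tendsto 0).mono_left nhdsWithin_le_nhds
    refine h1.congr' ?_
    filter_upwards [self_mem_nhdsWithin] with t ht
    rw [hη t ht]
  have hhlim : Tendsto (fun t : ℝ => t • d) (𝓝[>] (0:ℝ)) (𝓝 0) := by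
    have : Continuous fun t : ℝ => t • d := by fun_prop
    simpa using (this.tendsto 0).mono_left nhdsWithin_le_nhds
  have lim0 := tendsto_mollify hVl hFl hVm hFm hηlim hhlim
  have lim1 : ∀ i, _ := fun i => tendsto_mollify (hPl i) (hGl i) (hPm i) (hGm i) hηlim hhlim
  have lim := lim0.add (tendsto_finsetSum Finset.univ fun i _ => lim1 i)
  -- the mollified functions are smooth and have the mollified gradient
  obtain ⟨δ, hδ, hδU⟩ := hψc.isCompact.exists_thickening_subset_open hU hψU
  have hsmall : ∀ᶠ t in 𝓝[>] (0:ℝ), t * ‖d‖ + c * t < δ := by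
    have : Continuous fun t : ℝ => t * ‖d‖ + c * t := by fun_prop
    have h2 := (this.tendsto 0).mono_left (nhdsWithin_le_nhds (s := Ioi 0))
    simp only [zero_mul, mul_zero, add_zero] at h2
    exact h2.eventually (gt_mem_nhds hδ)
  have hzero : ∀ᶠ t in 𝓝[>] (0:ℝ),
      (∫ z, V z * ∫ y, F y * (η t).normed volume (z + t • d - y)) +
        ∑ i, ∫ z, P i z * ∫ y, G i y * (η t).normed volume (z + t • d - y) = 0 := by
    filter_upwards [hd, hsmall, self_mem_nhdsWithin] with t h1 h2 ht
    have ht' : 0 < t := ht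
    set Φ : Plane → ℝ := fun z => ∫ y, F y * (η t).normed volume (z + t • d - y) with hΦ
    have hΦs : ContDiff ℝ ∞ Φ := contDiff_mollify hFloc (η t).contDiff_normed
      (η t).hasCompactSupport_normed _
    have hgrad : ∀ z ∈ Ω, ∀ i, fderiv ℝ Φ z (E i) =
        ∫ y, G i y * (η t).normed volume (z + t • d - y) := by
      intro z hz i
      refine fderiv_mollify_eq hΩ hb hv hψ (η t).contDiff_normed (η t).hasCompactSupport_normed
        (E i) (fun y hy hyη y' hy'η => ?_) hFloc
      have b1 := norm_sub_le_of_mem_tsupport hyη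
      have b2 := norm_sub_le_of_mem_tsupport hy'η
      rw [hη t ht'] at b1 b2
      have hzU : z ∈ U := by
        refine hδU (Metric.mem_thickening_iff.2 ⟨y, hy, ?_⟩)
        rw [dist_eq_norm]
        calc ‖z - y‖ = ‖(z + t • d - y) - t • d‖ := by congr 1; abel
          _ ≤ ‖z + t • d - y‖ + ‖t • d‖ := norm_sub_le _ _
          _ ≤ c * t + t * ‖d‖ := by rw [norm_smul, Real.norm_of_nonneg ht'.le]; linarith
          _ < δ := by linarith
      refine h1 z ⟨hz, hzU⟩ ?_
      rw [Metric.mem_closedBall, dist_comm, dist_eq_norm]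
      exact b2
    have hw0 := hw Φ hΦs
    have hexp : ∀ z ∈ Ω, w.1 z * Φ z + inner ℝ (w.2 z) (gradient Φ z) =
        w.1 z * Φ z + ∑ i, inner ℝ (w.2 z) (E i) *
          ∫ y, G i y * (η t).normed volume (z + t • d - y) := by
      intro z hz
      rw [inner_eq_sum]
      simp only [inner_gradient]
      congr 1
      exact Finset.sum_congr rfl fun i _ => by rw [← hgrad z hz i]
    have iG : ∀ i, MemLp (fun z => ∫ y, G i y * (η t).normed volume (z + t • d - y)) 2
        (volume.restrict Ω) := fun i => memLp_of_continuous hb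
      (contDiff_mollify ((hGl i).locallyIntegrable (by norm_num)) (η t).contDiff_normed
        (η t).hasCompactSupport_normed _).continuous
    have iP : ∀ i, MemLp (fun z => inner ℝ (w.2 z) (E i)) 2 (volume.restrict Ω) := fun i =>
      (Lp.memLp w.2).inner_const (E i)
    rw [setIntegral_congr_fun hΩ.measurableSet hexp, integral_add, integral_finsetSum] at hw0
    · have hind : ∀ A B : Plane → ℝ, ∫ z, Ω.indicator A z * B z = ∫ z in Ω, A z * B z := by
        intro A B
        rw [← integral_indicator hΩ.measurableSet]
        refine integral_congr_ae (Eventually.of_forall fun y => ?_)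
        simp only [indicator]
        split_ifs <;> simp
      simp only [hV, hP, hind]
      exact hw0
    · exact fun i _ => integrable_mul_of_memLp (iP i) (iG i)
    · exact integrable_mul_of_memLp (Lp.memLp w.1) (memLp_of_continuous hb hΦs.continuous)
    · exact integrable_finsetSum _ fun i _ => integrable_mul_of_memLp (iP i) (iG i)
  have hfin := tendsto_nhds_unique (lim.congr' hzero) tendsto_const_nhds
  rw [← integral_finsetSum, ← integral_add] at hfin
  · rw [← hfin, ← integral_indicator hΩ.measurableSet]
    refine integral_congr_ae (Eventually.of_forall fun z => ?_)
    simp only [hV, hF, hP, hG, indicator]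
    split_ifs with hz
    · rw [inner_eq_sum (v.2 z), inner_eq_sum (gradient ψ z)]
      simp only [Fin.sum_univ_two, inner_gradient, hE]
      ring
    · simp
  · exact integrable_mul_of_memLp hVl hFl
  · exact integrable_finsetSum _ fun i _ => integrable_mul_of_memLp (hPl i) (hGl i)
  · exact fun i _ => integrable_mul_of_memLp (hPl i) (hGl i)

/-- Near each point of the closure, a Lipschitz domain can be shifted into itself. -/
theorem IsLipschitzDomain.exists_shift (hΩ : IsLipschitzDomain Ω) {x : Plane}
    (hx : x ∈ closure Ω) : ∃ (r : ℝ) (d : Plane) (c : ℝ), 0 < r ∧ 0 < c ∧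
      ∀ᶠ t in 𝓝[>] (0:ℝ), ∀ z ∈ Ω ∩ Metric.ball x r,
        Metric.closedBall (z + t • d) (c * t) ⊆ Ω := by
  by_cases hxΩ : x ∈ Ω
  · obtain ⟨ε, hε, h⟩ := Metric.isOpen_iff.1 hΩ.isOpen x hxΩ
    refine ⟨ε / 2, 0, 1, half_pos hε, one_pos, ?_⟩
    filter_upwards [nhdsWithin_le_nhds (Iio_mem_nhds (half_pos hε))] with t ht z hz y hy
    refine h ?_
    have h1 := hz.2
    simp only [smul_zero, add_zero, one_mul, Metric.mem_closedBall, Metric.mem_ball] at hy h1 ⊢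
    have h2 : t < ε / 2 := ht
    linarith [dist_triangle y z x]
  · have hfr : x ∈ frontier Ω := by rw [hΩ.isOpen.frontier_eq]; exact ⟨hx, hxΩ⟩
    obtain ⟨R, ψ, L, r, hψ, hr, h⟩ := hΩ.lipschitz_boundary x hfr
    set c : ℝ := 1 / (2 * (1 + (L:ℝ))) with hc
    have hL : (0:ℝ) ≤ L := L.2
    have hc0 : 0 < c := by positivity
    refine ⟨r / 2, R.symm (EuclideanSpace.single 1 1), c, half_pos hr, hc0, ?_⟩
    have hsmall : ∀ᶠ t in 𝓝[>] (0:ℝ), t + c * t < r / 2 := by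
      have : Continuous fun t : ℝ => t + c * t := by fun_prop
      have h2 := (this.tendsto 0).mono_left (nhdsWithin_le_nhds (s := Ioi 0))
      simp only [mul_zero, add_zero] at h2
      exact h2.eventually (gt_mem_nhds (half_pos hr))
    filter_upwards [hsmall, self_mem_nhdsWithin] with t ht ht0 z hz y hy
    have ht0' : 0 < t := ht0
    set d : Plane := R.symm (EuclideanSpace.single 1 1) with hd
    have hdn : ‖d‖ = 1 := by simp [hd]
    have hzb : dist z x < r / 2 := hz.2
    have hy' : ‖y - (z + t • d)‖ ≤ c * t := by rwa [Metric.mem_closedBall, dist_eq_norm] at hy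
    have hzr : z ∈ Metric.ball x r := by rw [Metric.mem_ball]; linarith
    have hyz : dist y z ≤ t + c * t := by
      rw [dist_eq_norm]
      calc ‖y - z‖ = ‖(y - (z + t • d)) + t • d‖ := by congr 1; abel
        _ ≤ ‖y - (z + t • d)‖ + ‖t • d‖ := norm_add_le _ _
        _ ≤ t + c * t := by rw [norm_smul, hdn, Real.norm_of_nonneg ht0'.le]; linarith
    have hyr : y ∈ Metric.ball x r := by
      rw [Metric.mem_ball]; linarith [dist_triangle y z x]
    rw [h y hyr]
    have hz' := (h z hzr).1 hz.1
    set q : Plane := R (y - (z + t • d)) with hq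
    have hqn : ‖q‖ ≤ c * t := by rw [hq, R.norm_map]; exact hy'
    have hq0 : |q 0| ≤ c * t := (PiLp.norm_apply_le q 0).trans hqn
    have hq1 : |q 1| ≤ c * t := (PiLp.norm_apply_le q 1).trans hqn
    have hRy : R y = R z + t • EuclideanSpace.single 1 1 + q := by
      have : y = z + t • d + (y - (z + t • d)) := by abel
      conv_lhs => rw [this]
      rw [map_add, map_add, map_smul, hd, R.apply_symm_apply]
    have h0 : R y 0 = R z 0 + q 0 := by rw [hRy]; simp
    have h1 : R y 1 = R z 1 + t + q 1 := by rw [hRy]; simp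
    have hlip := hψ.dist_le_mul (R y 0) (R z 0)
    rw [h0, Real.dist_eq, Real.dist_eq, add_sub_cancel_left] at hlip
    rw [h0, h1]
    have e1 := le_abs_self (ψ (R z 0 + q 0) - ψ (R z 0))
    have e2 := neg_abs_le (q 1)
    have e3 : (L:ℝ) * |q 0| ≤ L * (c * t) := mul_le_mul_of_nonneg_left hq0 hL
    have e4 : L * (c * t) + c * t = t / 2 := by
      rw [hc]; field_simp; ring
    linarith

/-- In a Lipschitz domain, only zero is orthogonal to the smooth functions in `H¹`. -/
theorem IsLipschitzDomain.inner_eq_zero (hΩ : IsLipschitzDomain Ω) {v w : L2 Ω × L2Vec Ω}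
    (hv : v ∈ H1 Ω) (hw : ∀ φ : Plane → ℝ, ContDiff ℝ ∞ φ →
      ∫ x in Ω, (w.1 x * φ x + inner ℝ (w.2 x) (gradient φ x)) = 0) :
    ∫ x in Ω, (v.1 x * w.1 x + inner ℝ (v.2 x) (w.2 x)) = 0 := by
  have hb := hΩ.isBounded
  have hcomp : IsCompact (closure Ω) := hb.isCompact_closure
  choose! r d c hr hc hd using fun x (hx : x ∈ closure Ω) => hΩ.exists_shift hx
  obtain ⟨t, ht, hcov⟩ := hcomp.elim_nhds_subcover (fun x => Metric.ball x (r x))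
    (fun x hx => Metric.ball_mem_nhds x (hr x hx))
  obtain ⟨f, hf⟩ := SmoothPartitionOfUnity.exists_isSubordinate (modelWithCornersSelf ℝ Plane)
    (isClosed_closure (s := Ω)) (fun x : t => Metric.ball (x : Plane) (r x))
    (fun _ => Metric.isOpen_ball) (fun x hx => by
      obtain ⟨y, hy, hxy⟩ := mem_iUnion₂.1 (hcov hx)
      exact mem_iUnion.2 ⟨⟨y, hy⟩, hxy⟩)
  have hs : ∀ i, ContDiff ℝ ∞ (f i) := fun i => (f i).contMDiff.contDiff
  have hcs : ∀ i, HasCompactSupport (f i) := fun i =>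
    HasCompactSupport.of_support_subset_isCompact (isCompact_closedBall (i : Plane) (r i))
      ((subset_tsupport _).trans ((hf i).trans Metric.ball_subset_closedBall))
  have hloc := fun i : t => integral_localized_eq_zero hΩ.isOpen hb hv hw (hs i) (hcs i)
    Metric.isOpen_ball (hf i) (hc i (ht i i.2)) (hd i (ht i i.2))
  have hsum : ∀ x ∈ closure Ω, ∑ i, f i x = 1 := fun x hx => by
    rw [← finsum_eq_sum_of_fintype]; exact f.sum_eq_one hx
  have hgrad : ∀ x ∈ Ω, ∑ i, gradient (f i) x = 0 := by
    intro x hx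
    refine ext_inner_right ℝ fun e => ?_
    rw [sum_inner, inner_zero_left]
    simp only [inner_gradient]
    have h1 : fderiv ℝ (fun x => ∑ i, f i x) x = 0 := by
      have : (fun x => ∑ i, f i x) =ᶠ[𝓝 x] fun _ => (1:ℝ) := by
        filter_upwards [hΩ.isOpen.mem_nhds hx] with y hy using hsum y (subset_closure hy)
      rw [this.fderiv_eq]; simp
    rw [fderiv_fun_sum fun i _ => (hs i).differentiable (by simp) x] at h1
    simpa using congrArg (fun A => A e) h1
  have hint : ∀ i : t, Integrable (fun x => f i x * (v.1 x * w.1 x + inner ℝ (v.2 x) (w.2 x)) +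
      v.1 x * inner ℝ (gradient (f i) x) (w.2 x)) (volume.restrict Ω) := by
    intro i
    have i1 : Integrable (fun x => v.1 x * w.1 x + inner ℝ (v.2 x) (w.2 x)) (volume.restrict Ω) :=
      (integrable_mul_of_memLp (Lp.memLp v.1) (Lp.memLp w.1)).add
        (integrable_inner_of_memLp (Lp.memLp v.2) (Lp.memLp w.2))
    obtain ⟨C, hC⟩ := (hcs i).exists_bound_of_continuous (hs i).continuous
    have hgc : HasCompactSupport (gradient (f i)) := by
      refine ((hcs i).fderiv ℝ).comp_left (g := (InnerProductSpace.toDual ℝ Plane).symm) ?_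
      simp
    obtain ⟨D, hD⟩ := hgc.exists_bound_of_continuous (continuous_gradient (hs i))
    refine (i1.bdd_mul (hs i).continuous.aestronglyMeasurable (Eventually.of_forall hC)).add ?_
    have : Integrable (fun x => inner ℝ (v.1 x • gradient (f i) x) (w.2 x))
        (volume.restrict Ω) := by
      refine integrable_inner_of_memLp ?_ (Lp.memLp w.2)
      have hb' : MemLp (gradient (f i)) ⊤ (volume.restrict Ω) :=
        (continuous_gradient (hs i)).memLp_of_hasCompactSupport hgc
      exact MemLp.smul (r := 2) hb' (Lp.memLp v.1)
    refine this.congr (Eventually.of_forall fun x => ?_)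
    simp only [inner_smul_left]
    simp
  have htot := Finset.sum_eq_zero fun i (_ : i ∈ Finset.univ) => hloc i
  rw [← integral_finsetSum _ fun i _ => hint i] at htot
  rw [← htot]
  refine setIntegral_congr_fun hΩ.isOpen.measurableSet fun x hx => ?_
  rw [Finset.sum_add_distrib, ← Finset.sum_mul, hsum x (subset_closure hx), one_mul,
    ← Finset.mul_sum, ← sum_inner, hgrad x hx, inner_zero_left, mul_zero, add_zero]

end Hypercircle

namespace Hypercircle

open Filter Topology

variable {Ω : Set Plane} {T : Geometry.SimplicialComplex ℝ Plane}

/-! ### The Sobolev space as a closed subspace -/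

theorem L2.inner_toLp {α E : Type*} [MeasurableSpace α] {μ : Measure α} [NormedAddCommGroup E]
    [InnerProductSpace ℝ E] {f : α → E} (hf : MemLp f 2 μ) (g : Lp E 2 μ) :
    inner ℝ (hf.toLp f) g = ∫ x, inner ℝ (f x) (g x) ∂μ := by
  rw [L2.inner_def]
  refine integral_congr_ae ?_
  filter_upwards [hf.coeFn_toLp] with x hx
  rw [hx]

theorem mem_H1_iff (hb : Bornology.IsBounded Ω) {u : L2 Ω × L2Vec Ω} :
    u ∈ H1 Ω ↔ ∀ (φ : Plane → ℝ) (e : Plane) (_ : φ ∈ testFunctions Ω)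
      (h1 : MemLp (fun x => fderiv ℝ φ x e) 2 (volume.restrict Ω))
      (h2 : MemLp (fun x => φ x • e) 2 (volume.restrict Ω)),
      inner ℝ (h1.toLp _) u.1 + inner ℝ (h2.toLp _) u.2 = 0 := by
  have key : ∀ (φ : Plane → ℝ) (e : Plane)
      (h1 : MemLp (fun x => fderiv ℝ φ x e) 2 (volume.restrict Ω))
      (h2 : MemLp (fun x => φ x • e) 2 (volume.restrict Ω)),
      (inner ℝ (h1.toLp _) u.1 = ∫ x in Ω, u.1 x * fderiv ℝ φ x e) ∧
      (inner ℝ (h2.toLp _) u.2 = ∫ x in Ω, φ x * inner ℝ (u.2 x) e) := by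
    intro φ e h1 h2
    rw [L2.inner_toLp, L2.inner_toLp]
    constructor
    · rfl
    · simp only [inner_smul_left]
      refine integral_congr_ae (Eventually.of_forall fun x => ?_)
      simp [real_inner_comm e]
  constructor
  · intro hu φ e hφ h1 h2
    rw [(key φ e h1 h2).1, (key φ e h1 h2).2, H1.integral_eq hb hu hφ e]
    ring
  · intro h
    refine H1.of_integral_eq hb fun φ hφ e => ?_
    have h1 : MemLp (fun x => fderiv ℝ φ x e) 2 (volume.restrict Ω) :=
      memLp_of_continuous hb ((hφ.1.continuous_fderiv (by simp)).clm_apply continuous_const)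
    have h2 : MemLp (fun x => φ x • e) 2 (volume.restrict Ω) :=
      memLp_of_continuous hb (hφ.1.continuous.smul continuous_const)
    have := h φ e hφ h1 h2
    rw [(key φ e h1 h2).1, (key φ e h1 h2).2] at this
    linarith

/-- `H¹(Ω)` as a subspace. -/
def h1Submodule (hb : Bornology.IsBounded Ω) : Submodule ℝ (L2 Ω × L2Vec Ω) where
  carrier := H1 Ω
  zero_mem' := (mem_H1_iff hb).2 fun φ e _ h1 h2 => by simp
  add_mem' := fun {u v} hu hv => (mem_H1_iff hb).2 fun φ e hφ h1 h2 => by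
    have a1 := (mem_H1_iff hb).1 hu φ e hφ h1 h2
    have a2 := (mem_H1_iff hb).1 hv φ e hφ h1 h2
    rw [Prod.fst_add, Prod.snd_add, inner_add_right, inner_add_right]
    linarith
  smul_mem' := fun c u hu => (mem_H1_iff hb).2 fun φ e hφ h1 h2 => by
    have a1 := (mem_H1_iff hb).1 hu φ e hφ h1 h2
    rw [Prod.smul_fst, Prod.smul_snd, inner_smul_right, inner_smul_right, ← mul_add, a1, mul_zero]

theorem isClosed_H1 (hb : Bornology.IsBounded Ω) : IsClosed (H1 Ω) := by
  have : H1 Ω = ⋂ (φ : Plane → ℝ) (e : Plane) (_ : φ ∈ testFunctions Ω)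
      (h1 : MemLp (fun x => fderiv ℝ φ x e) 2 (volume.restrict Ω))
      (h2 : MemLp (fun x => φ x • e) 2 (volume.restrict Ω)),
      {u | inner ℝ (h1.toLp _) u.1 + inner ℝ (h2.toLp _) u.2 = 0} := by
    ext u
    rw [mem_H1_iff hb]
    simp only [mem_iInter, mem_ofPred_eq]
  rw [this]
  refine isClosed_iInter fun φ => isClosed_iInter fun e => isClosed_iInter fun _ =>
    isClosed_iInter fun h1 => isClosed_iInter fun h2 => isClosed_eq ?_ continuous_const
  exact (continuous_const.inner continuous_fst).add (continuous_const.inner continuous_snd)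

/-- A smooth function and its gradient, as an element of `H¹(Ω)`. -/
noncomputable def smoothPair (hb : Bornology.IsBounded Ω) {φ : Plane → ℝ} (hφ : ContDiff ℝ ∞ φ) :
    L2 Ω × L2Vec Ω :=
  ((memLp_of_continuous hb hφ.continuous).toLp φ,
    (memLp_of_continuous hb (continuous_gradient hφ)).toLp (gradient φ))

theorem smoothPair_add (hb : Bornology.IsBounded Ω) {φ χ : Plane → ℝ} (hφ : ContDiff ℝ ∞ φ)
    (hχ : ContDiff ℝ ∞ χ) :
    smoothPair hb (hφ.add hχ) = smoothPair hb hφ + smoothPair hb hχ := by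
  refine Prod.ext ?_ ?_
  · exact MemLp.toLp_add (memLp_of_continuous hb hφ.continuous)
      (memLp_of_continuous hb hχ.continuous)
  · refine (MemLp.toLp_congr (memLp_of_continuous hb (continuous_gradient (hφ.add hχ))) _
      (Eventually.of_forall fun x => ?_)).trans
      (MemLp.toLp_add (memLp_of_continuous hb (continuous_gradient hφ))
        (memLp_of_continuous hb (continuous_gradient hχ)))
    refine ext_inner_right ℝ fun e => ?_
    rw [Pi.add_apply, inner_add_left, inner_gradient, inner_gradient, inner_gradient,
      fderiv_fun_add (hφ.differentiable (by simp) x) (hχ.differentiable (by simp) x)]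
    rfl

theorem smoothPair_smul (hb : Bornology.IsBounded Ω) (c : ℝ) {φ : Plane → ℝ}
    (hφ : ContDiff ℝ ∞ φ) :
    smoothPair hb ((contDiff_const (c := c)).mul hφ) = c • smoothPair hb hφ := by
  refine Prod.ext ?_ ?_
  · exact MemLp.toLp_const_smul c (memLp_of_continuous hb hφ.continuous)
  · refine (MemLp.toLp_congr
      (memLp_of_continuous hb (continuous_gradient ((contDiff_const (c := c)).mul hφ))) _
      (Eventually.of_forall fun x => ?_)).trans
      (MemLp.toLp_const_smul c (memLp_of_continuous hb (continuous_gradient hφ)))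
    refine ext_inner_right ℝ fun e => ?_
    rw [Pi.smul_apply, inner_smul_left, inner_gradient, inner_gradient,
      fderiv_const_mul (hφ.differentiable (by simp) x)]
    simp

theorem setIntegral_eq_integral_of_tsupport_subset {f : Plane → ℝ} {χ : Plane → ℝ}
    (hχ : tsupport χ ⊆ Ω) (h : ∀ x, x ∉ tsupport χ → f x = 0) :
    ∫ x in Ω, f x = ∫ x, f x :=
  setIntegral_eq_integral_of_forall_compl_eq_zero fun x hx => h x fun h' => hx (hχ h')

theorem smoothPair_mem (hb : Bornology.IsBounded Ω) {φ : Plane → ℝ} (hφ : ContDiff ℝ ∞ φ) :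
    smoothPair hb hφ ∈ H1 Ω := by
  refine H1.of_integral_eq hb fun χ hχ e => ?_
  have e1 : ∫ x in Ω, (smoothPair hb hφ).1 x * fderiv ℝ χ x e = ∫ x, φ x * fderiv ℝ χ x e := by
    rw [← setIntegral_eq_integral_of_tsupport_subset hχ.2.2 (f := fun x => φ x * fderiv ℝ χ x e)]
    · refine integral_congr_ae ?_
      filter_upwards [(memLp_of_continuous hb hφ.continuous).coeFn_toLp] with x hx
      rw [smoothPair, hx]
    · intro x hx
      have : fderiv ℝ χ x = 0 :=
        image_eq_zero_of_notMem_tsupport fun h' => hx (tsupport_fderiv_subset ℝ h')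
      simp [this]
  have e2 : ∫ x in Ω, χ x * inner ℝ ((smoothPair hb hφ).2 x) e = ∫ x, fderiv ℝ φ x e * χ x := by
    rw [← setIntegral_eq_integral_of_tsupport_subset hχ.2.2 (f := fun x => fderiv ℝ φ x e * χ x)]
    · refine integral_congr_ae ?_
      filter_upwards [(memLp_of_continuous hb (continuous_gradient hφ)).coeFn_toLp] with x hx
      rw [smoothPair, hx, inner_gradient, mul_comm]
    · intro x hx
      simp [image_eq_zero_of_notMem_tsupport hx]
  rw [e1, e2]
  have cχ : Continuous fun x => fderiv ℝ χ x e :=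
    (hχ.1.continuous_fderiv (by simp)).clm_apply continuous_const
  have cφ : Continuous fun x => fderiv ℝ φ x e :=
    (hφ.continuous_fderiv (by simp)).clm_apply continuous_const
  refine integral_mul_fderiv_eq_neg_fderiv_mul_of_integrable ?_ ?_ ?_ ?_ ?_
  · exact (cφ.mul hχ.1.continuous).integrable_of_hasCompactSupport hχ.2.1.mul_left
  · exact (hφ.continuous.mul cχ).integrable_of_hasCompactSupport
      (hχ.2.1.fderiv_apply ℝ e).mul_left
  · exact (hφ.continuous.mul hχ.1.continuous).integrable_of_hasCompactSupport hχ.2.1.mul_left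
  · exact fun x _ => hφ.differentiable (by simp) x
  · exact fun x _ => hχ.1.differentiable (by simp) x

/-- `L²(Ω) × L²(Ω)²` as a Hilbert space. -/
abbrev L2Prod (Ω : Set Plane) : Type := WithLp 2 (L2 Ω × L2Vec Ω)

/-- The smooth functions are dense in `H¹` of a Lipschitz domain. -/
theorem IsLipschitzDomain.mem_closure_smoothPair (hΩ : IsLipschitzDomain Ω) {v : L2 Ω × L2Vec Ω}
    (hv : v ∈ H1 Ω) :
    v ∈ closure {w | ∃ (φ : Plane → ℝ) (hφ : ContDiff ℝ ∞ φ), w = smoothPair hΩ.isBounded hφ} := by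
  have hb := hΩ.isBounded
  let toX : (L2 Ω × L2Vec Ω) ≃L[ℝ] L2Prod Ω :=
    (WithLp.prodContinuousLinearEquiv 2 ℝ (L2 Ω) (L2Vec Ω)).symm
  have hinner : ∀ u w : L2 Ω × L2Vec Ω, inner ℝ (toX u) (toX w) =
      inner ℝ u.1 w.1 + inner ℝ u.2 w.2 := fun u w => rfl
  set A : Set (L2 Ω × L2Vec Ω) :=
    {w | ∃ (φ : Plane → ℝ) (hφ : ContDiff ℝ ∞ φ), w = smoothPair hb hφ}
  have hAadd : ∀ u ∈ A, ∀ w ∈ A, u + w ∈ A := by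
    rintro _ ⟨φ, hφ, rfl⟩ _ ⟨χ, hχ, rfl⟩
    exact ⟨_, hφ.add hχ, (smoothPair_add hb hφ hχ).symm⟩
  have hAsmul : ∀ (c : ℝ), ∀ u ∈ A, c • u ∈ A := by
    rintro c _ ⟨φ, hφ, rfl⟩
    exact ⟨_, contDiff_const.mul hφ, (smoothPair_smul hb c hφ).symm⟩
  let A' : Submodule ℝ (L2 Ω × L2Vec Ω) :=
    { carrier := A
      zero_mem' := by
        have := hAsmul 0 _ ⟨fun _ => 0, contDiff_const, rfl⟩
        rwa [zero_smul] at this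
      add_mem' := fun {u w} hu hw => hAadd u hu w hw
      smul_mem' := fun c u hu => hAsmul c u hu }
  let S : Submodule ℝ (L2Prod Ω) := (A'.map (toX : L2 Ω × L2Vec Ω →ₗ[ℝ] L2Prod Ω)).topologicalClosure
  have hS : ∀ w, toX w ∈ S ↔ w ∈ closure A := by
    intro w
    have : (S : Set (L2Prod Ω)) = closure (toX '' A) := rfl
    rw [← SetLike.mem_coe, this]
    have h2 : toX '' closure A = closure (toX '' A) := toX.toHomeomorph.image_closure A
    rw [← h2]
    exact toX.injective.mem_set_image
  have : CompleteSpace S := (Submodule.isClosed_topologicalClosure _).completeSpace_coe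
  set p := S.starProjection (toX v) with hp
  have hpS : p ∈ S := Submodule.starProjection_apply_mem _ _
  set q := toX.symm p with hq
  have hqA : q ∈ closure A := (hS q).1 (by rw [hq, toX.apply_symm_apply]; exact hpS)
  have hqH : q ∈ H1 Ω := by
    refine closure_minimal ?_ (isClosed_H1 hb) hqA
    rintro _ ⟨φ, hφ, rfl⟩
    exact smoothPair_mem hb hφ
  have hr : v - q ∈ H1 Ω := (h1Submodule hb).sub_mem hv hqH
  have horth : ∀ φ : Plane → ℝ, ContDiff ℝ ∞ φ →
      ∫ x in Ω, ((v - q).1 x * φ x + inner ℝ ((v - q).2 x) (gradient φ x)) = 0 := by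
    intro φ hφ
    have h1 : inner ℝ (toX (smoothPair hb hφ)) (toX v - p) = 0 := by
      refine Submodule.sub_starProjection_mem_orthogonal (K := S) (toX v) _ ?_
      exact (hS _).2 (subset_closure ⟨φ, hφ, rfl⟩)
    have h2 : toX v - p = toX (v - q) := by rw [map_sub, hq, toX.apply_symm_apply]
    rw [h2, hinner, smoothPair, L2.inner_toLp, L2.inner_toLp, ← integral_add] at h1
    · rw [← h1]
      refine integral_congr_ae (Eventually.of_forall fun x => ?_)
      simp only [real_inner_comm (gradient φ x)]
      simp
    · exact (integrable_mul_of_memLp (memLp_of_continuous hb hφ.continuous)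
        (Lp.memLp (v - q).1)).congr (Eventually.of_forall fun x => by simp [mul_comm])
    · exact integrable_inner_of_memLp (memLp_of_continuous hb (continuous_gradient hφ)) (Lp.memLp _)
  have h0 := hΩ.inner_eq_zero hr horth
  have hz : v - q = 0 := by
    rw [integral_add (integrable_mul_of_memLp (Lp.memLp _) (Lp.memLp _))
      (integrable_inner_of_memLp (Lp.memLp _) (Lp.memLp _))] at h0
    have e1 : ∫ x in Ω, (v - q).1 x * (v - q).1 x = ‖(v - q).1‖ ^ 2 := by
      rw [← real_inner_self_eq_norm_sq, L2.inner_def]; rfl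
    have e2 : ∫ x in Ω, inner ℝ ((v - q).2 x) ((v - q).2 x) = ‖(v - q).2‖ ^ 2 := by
      rw [← real_inner_self_eq_norm_sq, L2.inner_def]
    rw [e1, e2] at h0
    have n1 := sq_nonneg ‖(v - q).1‖
    have n2 := sq_nonneg ‖(v - q).2‖
    refine Prod.ext ?_ ?_
    · exact norm_eq_zero.1 (pow_eq_zero_iff two_ne_zero |>.1 (by linarith))
    · exact norm_eq_zero.1 (pow_eq_zero_iff two_ne_zero |>.1 (by linarith))
  rw [sub_eq_zero.1 hz]
  exact hqA

/-! ### Traces -/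

theorem IsTriangulation.volume_restrict_le (hT : IsTriangulation Ω T) (hΩ : IsLipschitzDomain Ω)
    {K : Finset Plane} (hK : K ∈ triangles T) :
    (volume.restrict (convexHull ℝ (K : Set Plane)) : Measure Plane) ≤ volume.restrict Ω := by
  rw [hT.volume_restrict_eq_sum hΩ]
  exact Finset.single_le_sum (f := fun K : Finset Plane =>
    (volume.restrict (convexHull ℝ (K : Set Plane)) : Measure Plane))
    (fun _ _ => Measure.zero_le _) (hT.mem_tris.2 hK)

theorem IsTriangulation.ae_of_ae (hT : IsTriangulation Ω T) (hΩ : IsLipschitzDomain Ω)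
    {K : Finset Plane} (hK : K ∈ triangles T) {p : Plane → Prop}
    (h : ∀ᵐ x ∂(volume.restrict Ω), p x) :
    ∀ᵐ x ∂(volume.restrict (convexHull ℝ (K : Set Plane))), p x :=
  ae_mono (hT.volume_restrict_le hΩ hK) h

theorem IsTriangulation.ae_iff (hT : IsTriangulation Ω T) (hΩ : IsLipschitzDomain Ω)
    {p : Plane → Prop} : (∀ᵐ x ∂(volume.restrict Ω), p x) ↔
      ∀ K ∈ triangles T, ∀ᵐ x ∂(volume.restrict (convexHull ℝ (K : Set Plane))), p x := by
  refine ⟨fun h K hK => hT.ae_of_ae hΩ hK h, fun h => ?_⟩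
  rw [hT.volume_restrict_eq_sum hΩ, MeasureTheory.ae_finsetSum_measure_iff]
  exact fun K hK => h K (hT.mem_tris.1 hK)

theorem IsTriangulation.integral_eq_sum (hT : IsTriangulation Ω T) (hΩ : IsLipschitzDomain Ω)
    {F : Plane → ℝ} (hF : Integrable F (volume.restrict Ω)) :
    ∫ x in Ω, F x = ∑ K ∈ hT.tris, ∫ x in convexHull ℝ (K : Set Plane), F x := by
  rw [hT.volume_restrict_eq_sum hΩ, integral_finsetSum_measure]
  exact fun K hK => hF.mono_measure (hT.volume_restrict_le hΩ (hT.mem_tris.1 hK))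

theorem IsTriangulation.isFiniteMeasure (hT : IsTriangulation Ω T) (hΩ : IsLipschitzDomain Ω) :
    IsFiniteMeasure ((Measure.hausdorffMeasure 1 : Measure Plane).restrict (frontier Ω)) :=
  ⟨by rw [Measure.restrict_apply_univ]; exact hT.hausdorffMeasure_frontier_lt_top hΩ⟩

theorem IsTriangulation.memLp_bdry (hT : IsTriangulation Ω T) (hΩ : IsLipschitzDomain Ω)
    {φ : Plane → ℝ} (hφ : Continuous φ) :
    MemLp φ 2 ((Measure.hausdorffMeasure 1 : Measure Plane).restrict (frontier Ω)) := by
  have := hT.isFiniteMeasure hΩ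
  have hc : IsCompact (frontier Ω) :=
    hΩ.isBounded.isCompact_closure.of_isClosed_subset isClosed_frontier frontier_subset_closure
  obtain ⟨C, hC⟩ := hc.exists_bound_of_continuousOn hφ.continuousOn
  exact MemLp.of_bound hφ.aestronglyMeasurable C
      ((ae_restrict_iff' isClosed_frontier.measurableSet).2 (Eventually.of_forall hC))

theorem IsTriangulation.integral_bdry_eq_sum (hT : IsTriangulation Ω T)
    (hΩ : IsLipschitzDomain Ω) {F : Plane → ℝ}
    (hF : Integrable F ((Measure.hausdorffMeasure 1 : Measure Plane).restrict (frontier Ω))) :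
    ∫ x in frontier Ω, F x ∂(Measure.hausdorffMeasure 1 : Measure Plane) =
      ∑ s ∈ hT.outerSides, ∫ x in side s, F x ∂(Measure.hausdorffMeasure 1 : Measure Plane) := by
  rw [hT.hausdorffMeasure_restrict_eq_sum hΩ, integral_finsetSum_measure]
  exact fun s hs => IntegrableOn.mono_set hF (hT.side_subset_frontier hΩ hs)

/-- The trace inequality for smooth functions. -/
theorem IsTriangulation.exists_trace_bound (hT : IsTriangulation Ω T) (hΩ : IsLipschitzDomain Ω) :
    ∃ C : ℝ, 0 ≤ C ∧ ∀ (φ : Plane → ℝ) (hφ : ContDiff ℝ ∞ φ),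
      ‖(hT.memLp_bdry hΩ hφ.continuous).toLp φ‖ ≤ C * ‖smoothPair hΩ.isBounded hφ‖ := by
  have hb := hΩ.isBounded
  obtain ⟨M, hM⟩ := Metric.isBounded_iff.1 hb.closure
  have key : ∀ s ∈ hT.outerSides, ∀ (φ : Plane → ℝ), ContDiff ℝ ∞ φ →
      ∫ x in side s, φ x ^ 2 ∂(Measure.hausdorffMeasure 1 : Measure Plane) ≤
        (height s)⁻¹ * ((2 + |M|) * ∫ x in Ω, (φ x ^ 2 + ‖gradient φ x‖ ^ 2)) := by
    rintro ⟨K, a⟩ hs φ hφ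
    obtain ⟨hK, ha, -⟩ := hT.mem_outerSides.1 hs
    have tK := isTri_of_mem_triangles hK
    have hH := height_pos tK ha
    have hcone := integral_cone tK ha (Φ := fun x => φ x ^ 2)
      ((hφ.pow 2).of_le (by norm_cast))
    rw [le_inv_mul_iff₀ hH, ← hcone, ← integral_const_mul]
    have iΩ : Integrable (fun x => φ x ^ 2 + ‖gradient φ x‖ ^ 2) (volume.restrict Ω) := by
      refine Integrable.add ?_ ?_
      · exact (memLp_of_continuous hb hφ.continuous).integrable_sq
      · exact (memLp_of_continuous hb (continuous_gradient hφ).norm).integrable_sq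
    refine (setIntegral_mono_on (g := fun x => (2 + |M|) * (φ x ^ 2 + ‖gradient φ x‖ ^ 2))
      ?_ ?_ (IsTri.isCompact K).isClosed.measurableSet ?_).trans ?_
    · have c1 : Continuous fun x => fderiv ℝ (fun x => φ x ^ 2) x (x - a) :=
        ((hφ.pow 2).continuous_fderiv (by simp)).clm_apply (by fun_prop)
      exact (((hφ.continuous.pow 2).const_mul 2).add c1).continuousOn.integrableOn_compact
        (IsTri.isCompact K)
    · exact (iΩ.mono_measure (hT.volume_restrict_le hΩ hK)).const_mul _
    · intro x hx
      have hd : fderiv ℝ (fun x => φ x ^ 2) x (x - a) =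
          2 * φ x * inner ℝ (gradient φ x) (x - a) := by
        rw [inner_gradient, fderiv_fun_pow 2 (hφ.differentiable (by simp) x)]
        simp
      have h1 : |inner ℝ (gradient φ x) (x - a)| ≤ ‖gradient φ x‖ * |M| := by
        refine (abs_real_inner_le_norm _ _).trans
          (mul_le_mul_of_nonneg_left ?_ (norm_nonneg (gradient φ x)))
        rw [← dist_eq_norm]
        exact (hM (hT.convexHull_subset hK hx)
          (hT.convexHull_subset hK (subset_convexHull _ _ ha))).trans (le_abs_self M)
      have h2 : φ x * inner ℝ (gradient φ x) (x - a) ≤ |φ x| * (‖gradient φ x‖ * |M|) := by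
        refine (le_abs_self _).trans ?_
        rw [abs_mul]
        exact mul_le_mul_of_nonneg_left h1 (abs_nonneg _)
      have h3 : 2 * |φ x| * ‖gradient φ x‖ ≤ φ x ^ 2 + ‖gradient φ x‖ ^ 2 := by
        rw [← sq_abs (φ x)]; exact two_mul_le_add_sq _ _
      have h4 := mul_le_mul_of_nonneg_right h3 (abs_nonneg M)
      simp only [hd]
      nlinarith [sq_nonneg ‖gradient φ x‖]
    · refine integral_mono_measure (hT.volume_restrict_le hΩ hK) ?_ (iΩ.const_mul _)
      exact Eventually.of_forall fun x => by positivity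
  refine ⟨Real.sqrt (2 * ∑ s ∈ hT.outerSides, (height s)⁻¹ * (2 + |M|)), Real.sqrt_nonneg _,
    fun φ hφ => ?_⟩
  set g := (hT.memLp_bdry hΩ hφ.continuous).toLp φ with hg
  set S := ∑ s ∈ hT.outerSides, (height s)⁻¹ * (2 + |M|) with hS
  have hS0 : 0 ≤ S := by
    refine Finset.sum_nonneg ?_
    rintro ⟨K, a⟩ hs
    obtain ⟨hK, ha, -⟩ := hT.mem_outerSides.1 hs
    have := height_pos (isTri_of_mem_triangles hK) ha
    positivity
  have n1 : ‖g‖ ^ 2 = ∫ x in frontier Ω, φ x ^ 2 ∂(Measure.hausdorffMeasure 1 : Measure Plane) := by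
    rw [← real_inner_self_eq_norm_sq, hg, L2.inner_toLp]
    refine integral_congr_ae ?_
    filter_upwards [(hT.memLp_bdry hΩ hφ.continuous).coeFn_toLp] with x hx
    rw [hx]
    simp [sq]
  have n2 : ∫ x in Ω, (φ x ^ 2 + ‖gradient φ x‖ ^ 2) =
      ‖(smoothPair hb hφ).1‖ ^ 2 + ‖(smoothPair hb hφ).2‖ ^ 2 := by
    rw [← real_inner_self_eq_norm_sq, ← real_inner_self_eq_norm_sq, smoothPair, L2.inner_toLp,
      L2.inner_toLp, integral_add (memLp_of_continuous hb hφ.continuous).integrable_sq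
        (memLp_of_continuous hb (continuous_gradient hφ).norm).integrable_sq]
    congr 1
    · refine integral_congr_ae ?_
      filter_upwards [(memLp_of_continuous hb hφ.continuous).coeFn_toLp] with x hx
      rw [hx]
      simp [sq]
    · refine integral_congr_ae ?_
      filter_upwards [(memLp_of_continuous hb (continuous_gradient hφ)).coeFn_toLp] with x hx
      rw [hx, real_inner_self_eq_norm_sq]
  have n3 : ‖g‖ ^ 2 ≤ S * (‖(smoothPair hb hφ).1‖ ^ 2 + ‖(smoothPair hb hφ).2‖ ^ 2) := by
    rw [n1, hT.integral_bdry_eq_sum hΩ (hT.memLp_bdry hΩ hφ.continuous).integrable_sq, ← n2, hS,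
      Finset.sum_mul]
    refine Finset.sum_le_sum fun s hs => (key s hs φ hφ).trans_eq ?_
    ring
  have n4 : ‖(smoothPair hb hφ).1‖ ≤ ‖smoothPair hb hφ‖ := norm_fst_le _
  have n5 : ‖(smoothPair hb hφ).2‖ ≤ ‖smoothPair hb hφ‖ := norm_snd_le _
  refine abs_le_of_sq_le_sq' ?_ (by positivity) |>.2
  rw [mul_pow, Real.sq_sqrt (by positivity)]
  refine n3.trans ?_
  have : ‖(smoothPair hb hφ).1‖ ^ 2 + ‖(smoothPair hb hφ).2‖ ^ 2 ≤ 2 * ‖smoothPair hb hφ‖ ^ 2 := by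
    have a1 := pow_le_pow_left₀ (norm_nonneg _) n4 2
    have a2 := pow_le_pow_left₀ (norm_nonneg _) n5 2
    linarith
  nlinarith [mul_le_mul_of_nonneg_left this hS0]

/-- Every function in `H¹(Ω)` has a trace. -/
theorem IsTriangulation.exists_hasTrace (hT : IsTriangulation Ω T) (hΩ : IsLipschitzDomain Ω)
    {v : L2 Ω × L2Vec Ω} (hv : v ∈ H1 Ω) : ∃ g, HasTrace v g := by
  have hb := hΩ.isBounded
  obtain ⟨C, hC, hbound⟩ := hT.exists_trace_bound hΩ
  obtain ⟨w, hw, hlim⟩ := mem_closure_iff_seq_limit.1 (hΩ.mem_closure_smoothPair hv)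
  choose φ hφ hwφ using hw
  set g : ℕ → L2Bdry Ω := fun n => (hT.memLp_bdry hΩ (hφ n).continuous).toLp (φ n) with hg
  have hdist : ∀ n m, dist (g n) (g m) ≤ C * dist (w n) (w m) := by
    intro n m
    have hm := (contDiff_const (c := (-1:ℝ))).mul (hφ m)
    have hneg : smoothPair hb ((hφ n).add hm) = w n - w m := by
      rw [smoothPair_add hb (hφ n) hm, smoothPair_smul hb (-1) (hφ m), ← hwφ, ← hwφ, neg_one_smul,
        sub_eq_add_neg]
    have h1 := hbound _ ((hφ n).add hm)
    rw [hneg, ← dist_eq_norm] at h1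
    refine le_trans (le_of_eq ?_) h1
    rw [dist_eq_norm]
    congr 1
    refine (MemLp.toLp_sub _ _).symm.trans (MemLp.toLp_congr _ _ (Eventually.of_forall fun x => ?_))
    simp [sub_eq_add_neg]
  have hcau : CauchySeq g := by
    have := hlim.cauchySeq
    rw [Metric.cauchySeq_iff] at this ⊢
    intro ε hε
    obtain ⟨N, hN⟩ := this (ε / (C + 1)) (by positivity)
    refine ⟨N, fun m hm n hn => (hdist m n).trans_lt ?_⟩
    have h1 := hN m hm n hn
    rw [lt_div_iff₀ (by positivity)] at h1
    nlinarith [dist_nonneg (x := w m) (y := w n)]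
  obtain ⟨g₀, hg₀⟩ := cauchySeq_tendsto_of_complete hcau
  refine ⟨g₀, mem_closure_of_tendsto (hlim.prodMk_nhds hg₀) (Eventually.of_forall fun n => ?_)⟩
  refine ⟨φ n, hφ n, ?_, ?_, ?_⟩
  · simp only [hwφ]; exact MemLp.coeFn_toLp (memLp_of_continuous hb (hφ n).continuous)
  · simp only [hwφ]; exact MemLp.coeFn_toLp (memLp_of_continuous hb (continuous_gradient (hφ n)))
  · exact MemLp.coeFn_toLp (hT.memLp_bdry hΩ (hφ n).continuous)

theorem IsTriangulation.hasTrace_trace (hT : IsTriangulation Ω T) (hΩ : IsLipschitzDomain Ω)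
    {v : L2 Ω × L2Vec Ω} (hv : v ∈ H1 Ω) : HasTrace v (trace v) := by
  have h := hT.exists_hasTrace hΩ hv
  rw [trace, dif_pos h]
  exact h.choose_spec

/-- A boundary integral given by a formula of Green's type for smooth functions is given by it on
all of `H¹(Ω)`. -/
theorem IsTriangulation.bForm_eq (hT : IsTriangulation Ω T) (hΩ : IsLipschitzDomain Ω)
    {f : L2Bdry Ω} {p : L2Vec Ω × L2 Ω}
    (h : ∀ φ : Plane → ℝ, ContDiff ℝ ∞ φ →
      ∫ x in Ω, (inner ℝ (p.1 x) (gradient φ x) + p.2 x * φ x) =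
        ∫ x in frontier Ω, f x * φ x ∂(Measure.hausdorffMeasure 1 : Measure Plane))
    {v : L2 Ω × L2Vec Ω} (hv : v ∈ H1 Ω) :
    bForm f v = inner ℝ p.1 v.2 + inner ℝ p.2 v.1 := by
  have hcl : IsClosed {w : (L2 Ω × L2Vec Ω) × L2Bdry Ω |
      inner ℝ f w.2 = inner ℝ p.1 w.1.2 + inner ℝ p.2 w.1.1} := by
    refine isClosed_eq (continuous_const.inner continuous_snd) ?_
    exact (continuous_const.inner (continuous_snd.comp continuous_fst)).add
      (continuous_const.inner (continuous_fst.comp continuous_fst))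
  refine closure_minimal ?_ hcl (hT.hasTrace_trace hΩ hv)
  rintro ⟨w, g⟩ ⟨φ, hφ, h1, h2, h3⟩
  simp only [mem_ofPred_eq, L2.inner_def]
  have i1 : Integrable (fun x => inner ℝ (p.1 x) (gradient φ x)) (volume.restrict Ω) :=
    integrable_inner_of_memLp (Lp.memLp _)
      (memLp_of_continuous hΩ.isBounded (continuous_gradient hφ))
  have i2 : Integrable (fun x => p.2 x * φ x) (volume.restrict Ω) :=
    integrable_mul_of_memLp (Lp.memLp _) (memLp_of_continuous hΩ.isBounded hφ.continuous)
  have hφ' := h φ hφ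
  rw [integral_add i1 i2] at hφ'
  have e1 : ∫ x in Ω, inner ℝ (p.1 x) (w.2 x) = ∫ x in Ω, inner ℝ (p.1 x) (gradient φ x) :=
    integral_congr_ae (h2.mono fun x hx => by simp only at hx ⊢; rw [hx])
  have e2 : ∫ x in Ω, inner ℝ (p.2 x) (w.1 x) = ∫ x in Ω, p.2 x * φ x :=
    integral_congr_ae (h1.mono fun x hx => by simp only at hx ⊢; rw [hx]; simp [mul_comm])
  have e3 : ∫ x in frontier Ω, inner ℝ (f x) (g x) ∂(Measure.hausdorffMeasure 1 : Measure Plane) =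
      ∫ x in frontier Ω, f x * φ x ∂(Measure.hausdorffMeasure 1 : Measure Plane) :=
    integral_congr_ae (h3.mono fun x hx => by simp only at hx ⊢; rw [hx]; simp [mul_comm])
  rw [e1, e2, e3, hφ']

end Hypercircle

namespace Hypercircle

open Filter Topology

variable {Ω : Set Plane} {T : Geometry.SimplicialComplex ℝ Plane} {K : Finset Plane} {a : Plane}

/-! ### Raviart–Thomas fields as sums of fields pointing away from the vertices -/

/-- A family of affine functions, one for every side of every triangle. -/
abbrev SideFamily : Type := Finset Plane × Plane → Plane →ᵃ[ℝ] ℝ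

/-- The field on the triangle `K` given by a family of affine functions. -/
noncomputable def rtSum (g : SideFamily) (K : Finset Plane) (x : Plane) : Plane :=
  ∑ a ∈ K, g (K, a) x • (x - a)

/-- The divergence of `rtSum`. -/
noncomputable def divSum (g : SideFamily) (K : Finset Plane) (x : Plane) : ℝ :=
  ∑ a ∈ K, (3 * g (K, a) x - g (K, a) a)

theorem continuous_affine {E : Type*} [NormedAddCommGroup E] [NormedSpace ℝ E]
    (g : Plane →ᵃ[ℝ] E) : Continuous g := g.continuous_of_finiteDimensional

theorem continuous_rtSum (g : SideFamily) (K : Finset Plane) : Continuous (rtSum g K) :=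
  continuous_finsetSum _ fun a _ =>
    (continuous_affine (g (K, a))).smul (continuous_id.sub continuous_const)

theorem continuous_divSum (g : SideFamily) (K : Finset Plane) : Continuous (divSum g K) :=
  continuous_finsetSum _ fun a _ =>
    ((continuous_affine (g (K, a))).const_mul 3).sub continuous_const

theorem continuous_rtField (A : Plane →ᵃ[ℝ] Plane) (c : Plane →ᵃ[ℝ] ℝ) :
    Continuous (rtField A c) :=
  (continuous_affine A).add ((continuous_affine c).smul continuous_id)

theorem hasFDerivAt_affine (g : Plane →ᵃ[ℝ] ℝ) (x : Plane) :
    HasFDerivAt g (LinearMap.toContinuousLinearMap g.linear) x := by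
  have e : (g : Plane → ℝ) = fun y => LinearMap.toContinuousLinearMap g.linear y + g 0 := by
    funext y
    have := g.map_vadd 0 y
    simpa using this
  conv => congr; rw [e]
  exact (ContinuousLinearMap.hasFDerivAt _).add_const _

theorem contDiff_affine (g : Plane →ᵃ[ℝ] ℝ) : ContDiff ℝ ∞ g := by
  have e : (g : Plane → ℝ) = fun y => LinearMap.toContinuousLinearMap g.linear y + g 0 := by
    funext y
    have := g.map_vadd 0 y
    simpa using this
  rw [e]
  exact (ContinuousLinearMap.contDiff _).add contDiff_const

theorem fderiv_affine_sub (g : Plane →ᵃ[ℝ] ℝ) (x a : Plane) :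
    fderiv ℝ g x (x - a) = g x - g a := by
  rw [(hasFDerivAt_affine g x).fderiv]
  exact (g.linearMap_vsub x a).trans rfl

/-- The divergence theorem on a triangle. -/
theorem integral_rtSum (h : IsTri K) (g : SideFamily) {φ : Plane → ℝ} (hφ : ContDiff ℝ ∞ φ) :
    ∫ x in convexHull ℝ (K : Set Plane),
        (inner ℝ (rtSum g K x) (gradient φ x) + divSum g K x * φ x) =
      ∑ a ∈ K, height (K, a) *
        ∫ x in side (K, a), g (K, a) x * φ x ∂(Measure.hausdorffMeasure 1 : Measure Plane) := by
  have e : ∀ x, inner ℝ (rtSum g K x) (gradient φ x) + divSum g K x * φ x =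
      ∑ a ∈ K, (2 * (g (K, a) x * φ x) + fderiv ℝ (fun y => g (K, a) y * φ y) x (x - a)) := by
    intro x
    rw [rtSum, divSum, sum_inner, Finset.sum_mul, ← Finset.sum_add_distrib]
    refine Finset.sum_congr rfl fun a _ => ?_
    have h1 : HasFDerivAt (fun y => g (K, a) y * φ y) _ x :=
      (contDiff_affine (g (K, a))).differentiable (by simp) x |>.hasFDerivAt.mul
        (hφ.differentiable (by simp) x).hasFDerivAt
    rw [h1.fderiv, inner_smul_left, real_inner_comm, inner_gradient]
    simp only [add_apply, smul_apply, smul_eq_mul,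
      fderiv_affine_sub]
    simp
    ring
  simp only [e]
  have hc : ∀ a ∈ K, ContDiff ℝ ∞ fun y => g (K, a) y * φ y :=
    fun a _ => (contDiff_affine (g (K, a))).mul hφ
  rw [integral_finsetSum]
  · exact Finset.sum_congr rfl fun a ha => integral_cone h ha ((hc a ha).of_le (by norm_cast))
  · intro a ha
    refine ContinuousOn.integrableOn_compact (IsTri.isCompact K) (Continuous.continuousOn ?_)
    exact ((hc a ha).continuous.const_mul 2).add
      (((hc a ha).continuous_fderiv (by simp)).clm_apply (continuous_id.sub continuous_const))

theorem sum_lam_linear (h : IsTri K) (v : Plane) : ∑ a ∈ K, (lam K a).linear v = 0 := by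
  have e : ∀ a, (lam K a).linear v = lam K a v - lam K a 0 := fun a => by
    have := (lam K a).linearMap_vsub v 0
    simpa using this
  simp only [e, Finset.sum_sub_distrib, h.sum_lam, sub_self]

theorem sum_lam_linear_smul (h : IsTri K) (v : Plane) :
    ∑ a ∈ K, (lam K a).linear v • a = v := by
  have e : ∀ a, (lam K a).linear v = lam K a v - lam K a 0 := fun a => by
    have := (lam K a).linearMap_vsub v 0
    simpa using this
  simp only [e, sub_smul, Finset.sum_sub_distrib, h.sum_lam_smul, sub_zero]

theorem exists_rtSum_eq (h : IsTri K) (A : Plane →ᵃ[ℝ] Plane) (c : Plane →ᵃ[ℝ] ℝ) :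
    ∃ γ : Plane → Plane →ᵃ[ℝ] ℝ, ∀ x, ∑ a ∈ K, γ a x • (x - a) = rtField A c x := by
  refine ⟨fun a => lam K a 0 • c - (lam K a).linear.toAffineMap.comp A, fun x => ?_⟩
  have e : ∀ a, ((lam K a 0 • c - (lam K a).linear.toAffineMap.comp A : Plane →ᵃ[ℝ] ℝ) x) • (x - a)
      = c x • lam K a 0 • x - c x • lam K a 0 • a - (lam K a).linear (A x) • x
        + (lam K a).linear (A x) • a := by
    intro a
    change (lam K a 0 * c x - (lam K a).linear (A x)) • (x - a) = _
    module
  simp only [e, Finset.sum_add_distrib, Finset.sum_sub_distrib, ← Finset.smul_sum,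
    ← Finset.sum_smul, h.sum_lam, h.sum_lam_smul, sum_lam_linear h, sum_lam_linear_smul h]
  rw [rtField]
  module

theorem affineMap_sum_apply {ι E : Type*} [AddCommGroup E] [Module ℝ E] (s : Finset ι)
    (f : ι → Plane →ᵃ[ℝ] E) (x : Plane) : (∑ i ∈ s, f i) x = ∑ i ∈ s, f i x := by
  classical
  induction s using Finset.induction_on with
  | empty => simp
  | insert b s hb ih => simp [Finset.sum_insert hb, ih]

theorem exists_rtField_eq (g : SideFamily) (K : Finset Plane) :
    ∃ (A : Plane →ᵃ[ℝ] Plane) (c : Plane →ᵃ[ℝ] ℝ), rtField A c = rtSum g K := by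
  refine ⟨-∑ a ∈ K, (LinearMap.toSpanSingleton ℝ Plane a).toAffineMap.comp (g (K, a)),
    ∑ a ∈ K, g (K, a), funext fun x => ?_⟩
  have h1 := affineMap_sum_apply K
    (fun a => (LinearMap.toSpanSingleton ℝ Plane a).toAffineMap.comp (g (K, a))) x
  rw [rtField, rtSum]
  change -((∑ a ∈ K, (LinearMap.toSpanSingleton ℝ Plane a).toAffineMap.comp (g (K, a)) :
      Plane →ᵃ[ℝ] Plane) x) + _ = _
  rw [h1, affineMap_sum_apply, Finset.sum_smul, ← Finset.sum_neg_distrib, ← Finset.sum_add_distrib]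
  refine Finset.sum_congr rfl fun a _ => ?_
  change -(g (K, a) x • a) + g (K, a) x • x = _
  module

/-- The normal component of the field on a side. -/
theorem inner_rtSum (h : IsTri K) (ha : a ∈ K) (g : SideFamily) {n : Plane}
    (hn : IsOutwardNormal K (K.erase a) n) {x : Plane} (hx : x ∈ side (K, a)) :
    inner ℝ (rtSum g K x) n = height (K, a) * g (K, a) x := by
  rw [rtSum, sum_inner, Finset.sum_eq_single a]
  · rw [inner_smul_left, inner_sub_eq_height h ha hn hx]
    simp [mul_comm]
  · intro b hb hba
    have hb' : b ∈ K.erase a := Finset.mem_erase.2 ⟨hba, hb⟩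
    have hlin : x ∈ {y : Plane | inner ℝ n (y - b) = (0 : ℝ)} := by
      have hc : Convex ℝ {y : Plane | inner ℝ n (y - b) = (0 : ℝ)} := by
        intro y hy z hz s t _ _ hst
        have : s • y + t • z - b = s • (y - b) + t • (z - b) := by
          rw [smul_sub, smul_sub, sub_add_sub_comm, ← add_smul, hst, one_smul]
        simp only [mem_ofPred_eq] at hy hz ⊢
        rw [this, inner_add_right, inner_smul_right, inner_smul_right, hy, hz]
        simp
      exact convexHull_min (fun y hy => hn.2.1 b hb' y hy) hc hx
    rw [inner_smul_left, real_inner_comm, hlin, mul_zero]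
  · exact fun hna => absurd ha hna

/-! ### Piecewise fields -/

/-- The pair `p` of a field and its divergence is given on every triangle by `g`. -/
def IsRep (T : Geometry.SimplicialComplex ℝ Plane) (p : L2Vec Ω × L2 Ω) (g : SideFamily) : Prop :=
  ∀ K ∈ triangles T,
    (p.1 : Plane → Plane) =ᵐ[volume.restrict (convexHull ℝ (K : Set Plane))] rtSum g K ∧
    (p.2 : Plane → ℝ) =ᵐ[volume.restrict (convexHull ℝ (K : Set Plane))] divSum g K

theorem IsTriangulation.ae_notMem (hK : K ∈ triangles T) {K' : Finset Plane}
    (hK' : K' ∈ triangles T) (hne : K ≠ K') :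
    ∀ᵐ x ∂(volume.restrict (convexHull ℝ (K : Set Plane))), x ∉ convexHull ℝ (K' : Set Plane) := by
  rw [ae_restrict_iff' (IsTri.isCompact K).isClosed.measurableSet]
  have h0 := volume_frontier_convexHull (K : Set Plane)
  filter_upwards [measure_eq_zero_iff_ae_notMem.1 h0] with x hx hxK hxK'
  refine disjoint_left.1 (disjoint_interior hK hK' hne) ?_ hxK'
  by_contra hi
  exact hx ⟨subset_closure hxK, hi⟩

/-- A function in `L²` with prescribed continuous restrictions to the triangles. -/
theorem IsTriangulation.exists_piecewise (hT : IsTriangulation Ω T) (hΩ : IsLipschitzDomain Ω)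
    {E : Type*} [NormedAddCommGroup E] [NormedSpace ℝ E]
    (F : Finset Plane → Plane → E) (hF : ∀ K, Continuous (F K)) :
    ∃ f : Lp E 2 (volume.restrict Ω), ∀ K ∈ triangles T,
      (f : Plane → E) =ᵐ[volume.restrict (convexHull ℝ (K : Set Plane))] F K := by
  have hm : MemLp (fun x => ∑ K ∈ hT.tris, (convexHull ℝ (K : Set Plane)).indicator (F K) x) 2
      (volume.restrict Ω) :=
    memLp_finsetSum _ fun K _ => (memLp_of_continuous hΩ.isBounded (hF K)).indicator
      (IsTri.isCompact K).isClosed.measurableSet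
  refine ⟨hm.toLp _, fun K hK => ?_⟩
  have h1 : ∀ᵐ x ∂(volume.restrict (convexHull ℝ (K : Set Plane))), ∀ K' ∈ hT.tris, K ≠ K' →
      x ∉ convexHull ℝ (K' : Set Plane) := by
    refine (ae_ball_iff hT.tris.countable_toSet).2 fun K' hK' => ?_
    by_cases hne : K = K'
    · exact Eventually.of_forall fun x h => absurd hne h
    · exact (ae_notMem hK (hT.mem_tris.1 hK') hne).mono fun x hx _ => hx
  filter_upwards [hT.ae_of_ae hΩ hK hm.coeFn_toLp, h1,
    ae_restrict_mem (IsTri.isCompact K).isClosed.measurableSet] with x e hx hxK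
  rw [e, Finset.sum_eq_single K]
  · exact indicator_of_mem hxK _
  · exact fun K' hK' hne => indicator_of_notMem (hx K' hK' hne.symm) _
  · exact fun h => absurd (hT.mem_tris.2 hK) h

theorem IsTriangulation.exists_isRep (hT : IsTriangulation Ω T) (hΩ : IsLipschitzDomain Ω)
    (g : SideFamily) : ∃ p : L2Vec Ω × L2 Ω, IsRep T p g := by
  obtain ⟨f, hf⟩ := hT.exists_piecewise hΩ (rtSum g) (continuous_rtSum g)
  obtain ⟨d, hd⟩ := hT.exists_piecewise hΩ (divSum g) (continuous_divSum g)
  exact ⟨(f, d), fun K hK => ⟨hf K hK, hd K hK⟩⟩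

theorem rtSum_add (g g' : SideFamily) (K : Finset Plane) (x : Plane) :
    rtSum (g + g') K x = rtSum g K x + rtSum g' K x := by
  simp only [rtSum, ← Finset.sum_add_distrib, ← add_smul]; rfl

theorem rtSum_smul (t : ℝ) (g : SideFamily) (K : Finset Plane) (x : Plane) :
    rtSum (t • g) K x = t • rtSum g K x := by
  simp only [rtSum, Finset.smul_sum, smul_smul]; rfl

theorem divSum_add (g g' : SideFamily) (K : Finset Plane) (x : Plane) :
    divSum (g + g') K x = divSum g K x + divSum g' K x := by
  simp only [divSum, ← Finset.sum_add_distrib]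
  refine Finset.sum_congr rfl fun a _ => ?_
  change 3 * (g (K, a) x + g' (K, a) x) - (g (K, a) a + g' (K, a) a) = _
  ring

theorem divSum_smul (t : ℝ) (g : SideFamily) (K : Finset Plane) (x : Plane) :
    divSum (t • g) K x = t * divSum g K x := by
  simp only [divSum, Finset.mul_sum]
  refine Finset.sum_congr rfl fun a _ => ?_
  change 3 * (t * g (K, a) x) - t * g (K, a) a = _
  ring

theorem IsRep.add (hT : IsTriangulation Ω T) (hΩ : IsLipschitzDomain Ω) {p p' : L2Vec Ω × L2 Ω}
    {g g' : SideFamily} (h : IsRep T p g) (h' : IsRep T p' g') : IsRep T (p + p') (g + g') := by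
  refine fun K hK => ⟨?_, ?_⟩
  · filter_upwards [(h K hK).1, (h' K hK).1, hT.ae_of_ae hΩ hK (Lp.coeFn_add p.1 p'.1)]
      with x h1 h2 h3
    rw [rtSum_add, ← h1, ← h2]; exact h3
  · filter_upwards [(h K hK).2, (h' K hK).2, hT.ae_of_ae hΩ hK (Lp.coeFn_add p.2 p'.2)]
      with x h1 h2 h3
    rw [divSum_add, ← h1, ← h2]; exact h3

theorem IsRep.smul (hT : IsTriangulation Ω T) (hΩ : IsLipschitzDomain Ω) (t : ℝ)
    {p : L2Vec Ω × L2 Ω} {g : SideFamily} (h : IsRep T p g) : IsRep T (t • p) (t • g) := by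
  refine fun K hK => ⟨?_, ?_⟩
  · filter_upwards [(h K hK).1, hT.ae_of_ae hΩ hK (Lp.coeFn_smul t p.1)] with x h1 h3
    rw [rtSum_smul, ← h1]; exact h3
  · filter_upwards [(h K hK).2, hT.ae_of_ae hΩ hK (Lp.coeFn_smul t p.2)] with x h1 h3
    rw [divSum_smul, ← h1]; exact h3

/-- Green's formula for piecewise fields. -/
theorem IsRep.integral_eq (hT : IsTriangulation Ω T) (hΩ : IsLipschitzDomain Ω)
    {p : L2Vec Ω × L2 Ω} {g : SideFamily} (h : IsRep T p g) {φ : Plane → ℝ}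
    (hφ : ContDiff ℝ ∞ φ) :
    ∫ x in Ω, (inner ℝ (p.1 x) (gradient φ x) + p.2 x * φ x) =
      ∑ s ∈ hT.sides, height s *
        ∫ x in side s, g s x * φ x ∂(Measure.hausdorffMeasure 1 : Measure Plane) := by
  have hb := hΩ.isBounded
  rw [hT.integral_eq_sum hΩ]
  · rw [hT.sum_sides fun K a => height (K, a) *
      ∫ x in side (K, a), g (K, a) x * φ x ∂(Measure.hausdorffMeasure 1 : Measure Plane)]
    refine Finset.sum_congr rfl fun K hK => ?_
    have hK' := hT.mem_tris.1 hK
    rw [← integral_rtSum (isTri_of_mem_triangles hK') g hφ]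
    refine integral_congr_ae ?_
    filter_upwards [(h K hK').1, (h K hK').2] with x h1 h2
    rw [h1, h2]
  · exact (integrable_inner_of_memLp (Lp.memLp _) (memLp_of_continuous hb
      (continuous_gradient hφ))).add (integrable_mul_of_memLp (Lp.memLp _)
        (memLp_of_continuous hb hφ.continuous))

/-! ### Characterization of the Raviart–Thomas space -/

/-- The normal components of the field given by `g` are continuous across the inner sides, and given
by `f` on the boundary. -/
def IsTriangulation.IsCompatible (hT : IsTriangulation Ω T) (g : SideFamily) (f : L2Bdry Ω) :
    Prop :=
  (∀ φ : Plane → ℝ, ContDiff ℝ ∞ φ → ∑ s ∈ hT.innerSides, height s *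
    ∫ x in side s, g s x * φ x ∂(Measure.hausdorffMeasure 1 : Measure Plane) = 0) ∧
  ∀ s ∈ hT.outerSides, (f : Plane → ℝ) =ᵐ[(Measure.hausdorffMeasure 1).restrict (side s)]
    fun x => height s * g s x

theorem integrableOn_side {s : Finset Plane × Plane} (h : IsTri s.1) (ha : s.2 ∈ s.1)
    {φ : Plane → ℝ} (hφ : Continuous φ) :
    IntegrableOn φ (side s) (Measure.hausdorffMeasure 1 : Measure Plane) := by
  obtain ⟨C, hC⟩ := (isCompact_side s).exists_bound_of_continuousOn hφ.continuousOn
  exact Measure.integrableOn_of_bounded (hausdorffMeasure_side_lt_top h ha).ne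
    hφ.aestronglyMeasurable
    ((ae_restrict_iff' (measurableSet_side s)).2 (Eventually.of_forall hC))

/-- Jumps that vanish when tested with compactly supported functions vanish. -/
theorem IsTriangulation.sum_innerSides_eq_zero (hT : IsTriangulation Ω T) (hΩ : IsLipschitzDomain Ω)
    {g : SideFamily}
    (h : ∀ φ ∈ testFunctions Ω, ∑ s ∈ hT.innerSides, height s *
      ∫ x in side s, g s x * φ x ∂(Measure.hausdorffMeasure 1 : Measure Plane) = 0)
    {φ : Plane → ℝ} (hφ : ContDiff ℝ ∞ φ) : ∑ s ∈ hT.innerSides, height s *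
      ∫ x in side s, g s x * φ x ∂(Measure.hausdorffMeasure 1 : Measure Plane) = 0 := by
  set U : Set Plane := ⋃ s ∈ hT.innerSides, side s with hU
  have hside : ∀ s ∈ hT.innerSides, side s ⊆ U := fun s hs => subset_biUnion_of_mem (u := side) hs
  set ν := (Measure.hausdorffMeasure 1 : Measure Plane).restrict U with hν
  set J : Plane → ℝ := fun x => ∑ s ∈ hT.innerSides,
    (side s).indicator (fun x => height s * g s x) x with hJ
  have hterm : ∀ s ∈ hT.innerSides, ∀ χ : Plane → ℝ, Continuous χ →
      Integrable (fun x => (side s).indicator (fun x => height s * g s x * χ x) x) ν ∧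
      ∫ x, (side s).indicator (fun x => height s * g s x * χ x) x ∂ν = height s *
        ∫ x in side s, g s x * χ x ∂(Measure.hausdorffMeasure 1 : Measure Plane) := by
    intro s hs χ hχ
    obtain ⟨h1, h2, -⟩ := hT.mem_innerSides.1 hs
    have hi : ν.restrict (side s) =
        (Measure.hausdorffMeasure 1 : Measure Plane).restrict (side s) := by
      rw [hν, Measure.restrict_restrict (measurableSet_side s), inter_eq_left.2 (hside s hs)]
    constructor
    · rw [integrable_indicator_iff (measurableSet_side s), IntegrableOn, hi]
      exact integrableOn_side (isTri_of_mem_triangles h1) h2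
        (((continuous_affine _).const_mul _).mul hχ)
    · rw [integral_indicator (measurableSet_side s), hi, ← integral_const_mul]
      simp only [mul_assoc]
  have hJχ : ∀ χ : Plane → ℝ, Continuous χ → ∫ x, χ x • J x ∂ν = ∑ s ∈ hT.innerSides, height s *
      ∫ x in side s, g s x * χ x ∂(Measure.hausdorffMeasure 1 : Measure Plane) := by
    intro χ hχ
    have e : ∀ x, χ x • J x = ∑ s ∈ hT.innerSides,
        (side s).indicator (fun x => height s * g s x * χ x) x := by
      intro x
      rw [hJ, smul_eq_mul, Finset.mul_sum]
      refine Finset.sum_congr rfl fun s _ => ?_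
      by_cases hx : x ∈ side s
      · simp [hx, mul_comm]
      · simp [hx]
    simp only [e]
    rw [integral_finsetSum _ fun s hs => (hterm s hs χ hχ).1]
    exact Finset.sum_congr rfl fun s hs => (hterm s hs χ hχ).2
  have hJi : Integrable J ν := by
    refine integrable_finsetSum _ fun s hs => ?_
    simpa using (hterm s hs (fun _ => 1) continuous_const).1
  have hmem : ∀ᵐ x ∂ν, x ∈ Ω := by
    rw [hν, ae_restrict_biUnion_finset_iff]
    rintro ⟨K, a⟩ hs
    obtain ⟨h1, h2, h3⟩ := hT.mem_innerSides.1 hs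
    simp only [IsOuter, not_forall] at h3
    obtain ⟨K', hK', hsub, hne⟩ := h3
    filter_upwards [ae_mem_openEdge (isTri_of_mem_triangles h1) h2] with x hx
    exact hT.openEdge_subset_of_shared hΩ h1 hK' (Ne.symm hne) h2 hsub hx
  have hae := hΩ.isOpen.ae_eq_zero_of_integral_contDiff_smul_eq_zero
    (hJi.integrableOn.locallyIntegrableOn) fun χ h1 h2 h3 => by
      rw [hJχ χ h1.continuous]; exact h χ ⟨h1, h2, h3⟩
  rw [← hJχ φ hφ.continuous]
  refine integral_eq_zero_of_ae ?_
  filter_upwards [hae, hmem] with x h1 h2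
  simp [h1 h2]

theorem IsTriangulation.sum_outerSides_eq_zero (hT : IsTriangulation Ω T)
    (hΩ : IsLipschitzDomain Ω) (g : SideFamily) {φ : Plane → ℝ} (hφ : φ ∈ testFunctions Ω) :
    ∑ s ∈ hT.outerSides, height s *
      ∫ x in side s, g s x * φ x ∂(Measure.hausdorffMeasure 1 : Measure Plane) = 0 := by
  refine Finset.sum_eq_zero fun s hs => ?_
  rw [setIntegral_eq_zero_of_forall_eq_zero, mul_zero]
  intro x hx
  have hx' := hT.side_subset_frontier hΩ hs hx
  have : x ∉ tsupport φ := fun h => (hΩ.isOpen.frontier_eq ▸ hx' : x ∈ closure Ω \ Ω).2 (hφ.2.2 h)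
  rw [image_eq_zero_of_notMem_tsupport this, mul_zero]

theorem mem_HDiv_iff (hb : Bornology.IsBounded Ω) {p : L2Vec Ω × L2 Ω} :
    p ∈ HDiv Ω ↔ ∀ φ ∈ testFunctions Ω,
      ∫ x in Ω, (inner ℝ (p.1 x) (gradient φ x) + p.2 x * φ x) = 0 := by
  refine forall₂_congr fun φ hφ => ?_
  rw [integral_add, eq_neg_iff_add_eq_zero]
  · exact integrable_inner_of_memLp (Lp.memLp _) (memLp_of_continuous hb (continuous_gradient hφ.1))
  · exact integrable_mul_of_memLp (Lp.memLp _) (memLp_of_continuous hb hφ.1.continuous)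

/-- Continuous functions that agree almost everywhere on a triangle agree on it. -/
theorem IsTri.eqOn_of_ae_eq (h : IsTri K) {E : Type*} [TopologicalSpace E] [T2Space E]
    {F G : Plane → E} (hF : Continuous F) (hG : Continuous G)
    (hae : F =ᵐ[volume.restrict (convexHull ℝ (K : Set Plane))] G) :
    EqOn F G (convexHull ℝ (K : Set Plane)) :=
  Measure.eqOn_of_ae_eq hae hF.continuousOn hG.continuousOn h.subset_closure_interior

theorem Wh.exists_isRep (hT : IsTriangulation Ω T) (hΩ : IsLipschitzDomain Ω)
    {p : L2Vec Ω × L2 Ω} (hp : p ∈ Wh Ω T) : ∃ g : SideFamily, IsRep T p g := by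
  have hb := hΩ.isBounded
  obtain ⟨hdiv, hW⟩ := hp
  have : ∀ K : Finset Plane, ∃ γ : Plane → Plane →ᵃ[ℝ] ℝ, K ∈ triangles T →
      (p.1 : Plane → Plane) =ᵐ[volume.restrict (convexHull ℝ (K : Set Plane))]
        fun x => ∑ a ∈ K, γ a x • (x - a) := by
    intro K
    by_cases hK : K ∈ triangles T
    · obtain ⟨A, c, hA⟩ := hW K hK
      obtain ⟨γ, hγ⟩ := exists_rtSum_eq (isTri_of_mem_triangles hK) A c
      exact ⟨γ, fun _ => hA.trans (Eventually.of_forall fun x => (hγ x).symm)⟩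
    · exact ⟨0, fun h => absurd h hK⟩
  choose γ hγ using this
  set g : SideFamily := fun s => γ s.1 s.2 with hg
  refine ⟨g, fun K hK => ⟨hγ K hK, ?_⟩⟩
  have tK := isTri_of_mem_triangles hK
  have h1 : (p.1 : Plane → Plane) =ᵐ[volume.restrict (convexHull ℝ (K : Set Plane))] rtSum g K :=
    hγ K hK
  have hmeas := (IsTri.isCompact K).isClosed.measurableSet
  have hle := hT.volume_restrict_le hΩ hK
  have hsub := hT.interior_subset hΩ hK
  have hint : ∀ᵐ x ∂(volume.restrict (convexHull ℝ (K : Set Plane))),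
      x ∈ interior (convexHull ℝ (K : Set Plane)) := by
    rw [ae_restrict_iff' hmeas]
    filter_upwards [measure_eq_zero_iff_ae_notMem.1 (volume_frontier_convexHull (K : Set Plane))]
      with x hx hxK
    by_contra hi
    exact hx ⟨subset_closure hxK, hi⟩
  have hloc : Integrable (fun x => p.2 x - divSum g K x)
      (volume.restrict (convexHull ℝ (K : Set Plane))) := by
    refine Integrable.sub ?_ ((continuous_divSum g K).continuousOn.integrableOn_compact
      (IsTri.isCompact K))
    have := integrable_mul_of_memLp (Lp.memLp p.2)
      (memLp_of_continuous hb (continuous_const (y := (1:ℝ))))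
    simp only [mul_one] at this
    exact this.mono_measure hle
  have key := isOpen_interior.ae_eq_zero_of_integral_contDiff_smul_eq_zero
    (U := interior (convexHull ℝ (K : Set Plane)))
    (μ := volume.restrict (convexHull ℝ (K : Set Plane)))
    (f := fun x => p.2 x - divSum g K x) hloc.integrableOn.locallyIntegrableOn
    fun φ c1 c2 c3 => by
      have ht : φ ∈ testFunctions Ω := ⟨c1, c2, c3.trans hsub⟩
      have e1 := (mem_HDiv_iff hb).1 hdiv φ ht
      have i1 : Integrable (fun x => inner ℝ (p.1 x) (gradient φ x) + p.2 x * φ x)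
          (volume.restrict Ω) :=
        (integrable_inner_of_memLp (Lp.memLp _) (memLp_of_continuous hb
          (continuous_gradient c1))).add (integrable_mul_of_memLp (Lp.memLp _)
          (memLp_of_continuous hb c1.continuous))
      have hz : ∀ x, x ∉ convexHull ℝ (K : Set Plane) → φ x = 0 ∧ gradient φ x = 0 := by
        intro x hx
        have hx' : x ∉ tsupport φ := fun h => hx (interior_subset (c3 h))
        refine ⟨image_eq_zero_of_notMem_tsupport hx', ?_⟩
        have h0 : fderiv ℝ φ x = 0 :=
          image_eq_zero_of_notMem_tsupport fun h => hx' (tsupport_fderiv_subset ℝ h)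
        rw [gradient, h0, map_zero]
      have e2 : ∫ x in convexHull ℝ (K : Set Plane),
          (inner ℝ (p.1 x) (gradient φ x) + p.2 x * φ x) = 0 := by
        rw [hT.integral_eq_sum hΩ i1, Finset.sum_eq_single K] at e1
        · exact e1
        · intro K' hK' hne
          refine integral_eq_zero_of_ae ?_
          filter_upwards [IsTriangulation.ae_notMem (hT.mem_tris.1 hK') hK hne] with x hx
          simp [hz x hx]
        · exact fun h => absurd (hT.mem_tris.2 hK) h
      have e3 := integral_rtSum tK g c1
      rw [Finset.sum_eq_zero] at e3
      · rw [← sub_eq_zero.2 (e2.trans e3.symm), ← integral_sub (i1.mono_measure hle)]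
        · refine integral_congr_ae ?_
          filter_upwards [h1] with x hx
          rw [hx, smul_eq_mul]
          ring
        · refine ContinuousOn.integrableOn_compact (IsTri.isCompact K) (Continuous.continuousOn ?_)
          exact ((continuous_rtSum g K).inner (continuous_gradient c1)).add
            ((continuous_divSum g K).mul c1.continuous)
      · intro a ha
        rw [setIntegral_eq_zero_of_forall_eq_zero, mul_zero]
        intro x hx
        have hx0 := ((tK.mem_convexHull_erase ha).1 hx).2
        have : x ∉ tsupport φ := fun h => ((tK.mem_interior.1 (c3 h)) a ha).ne' hx0
        rw [image_eq_zero_of_notMem_tsupport this, mul_zero]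
  filter_upwards [key, hint] with x k1 k2
  exact sub_eq_zero.1 (k1 k2)

theorem IsTriangulation.mem_WhF_iff (hT : IsTriangulation Ω T) (hΩ : IsLipschitzDomain Ω)
    {p : L2Vec Ω × L2 Ω} {f : L2Bdry Ω} :
    p ∈ WhF Ω T f ↔ ∃ g : SideFamily, IsRep T p g ∧ hT.IsCompatible g f := by
  have hb := hΩ.isBounded
  constructor
  · rintro ⟨hp, hf⟩
    obtain ⟨g, hg⟩ := Wh.exists_isRep hT hΩ hp
    refine ⟨g, hg, fun φ hφ => hT.sum_innerSides_eq_zero hΩ (fun χ hχ => ?_) hφ, ?_⟩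
    · have e1 := (mem_HDiv_iff hb).1 hp.1 χ hχ
      rw [hg.integral_eq hT hΩ hχ.1, ← hT.sum_outerSides_add_sum_innerSides,
        hT.sum_outerSides_eq_zero hΩ g hχ, zero_add] at e1
      exact e1
    · rintro ⟨K, a⟩ hs
      obtain ⟨hK, ha, ho⟩ := hT.mem_outerSides.1 hs
      have tK := isTri_of_mem_triangles hK
      obtain ⟨A, c, hA⟩ := exists_rtField_eq g K
      obtain ⟨n, hn⟩ := exists_isOutwardNormal tK ha
      have h1 := hf K hK (K.erase a) ((hT.mem_boundaryEdges_iff hΩ hK ha).2 ho)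
        (Finset.erase_subset _ _) A c (hA ▸ (hg K hK).1) n hn
      refine h1.trans ?_
      rw [hA]
      filter_upwards [ae_restrict_mem (measurableSet_side (K, a))] with x hx
      exact inner_rtSum tK ha g hn hx
  · rintro ⟨g, hg, hin, hout⟩
    refine ⟨⟨(mem_HDiv_iff hb).2 fun φ hφ => ?_, fun K hK => ?_⟩, ?_⟩
    · rw [hg.integral_eq hT hΩ hφ.1, ← hT.sum_outerSides_add_sum_innerSides,
        hT.sum_outerSides_eq_zero hΩ g hφ, zero_add]
      exact hin φ hφ.1
    · obtain ⟨A, c, hA⟩ := exists_rtField_eq g K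
      exact ⟨A, c, hA ▸ (hg K hK).1⟩
    · intro K hK e he heK A c hA n hn
      obtain ⟨a, ha, rfl⟩ : ∃ a ∈ K, K.erase a = e := by
        have hcard : (K \ e).card = 1 := by
          rw [Finset.card_sdiff_of_subset heK, hK.2, he.2.1]
        obtain ⟨a, ha⟩ := Finset.card_eq_one.1 hcard
        have haK : a ∈ K \ e := by simp [ha]
        refine ⟨a, (Finset.mem_sdiff.1 haK).1, ?_⟩
        rw [← Finset.sdiff_singleton_eq_erase, ← ha, Finset.sdiff_sdiff_eq_self heK]
      have tK := isTri_of_mem_triangles hK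
      have ho := (hT.mem_boundaryEdges_iff hΩ hK ha).1 he
      have heq := tK.eqOn_of_ae_eq (continuous_rtField A c) (continuous_rtSum g K)
        (hA.symm.trans (hg K hK).1)
      refine (hout (K, a) (hT.mem_outerSides.2 ⟨hK, ha, ho⟩)).trans ?_
      filter_upwards [ae_restrict_mem (measurableSet_side (K, a))] with x hx
      rw [heq ((tK.mem_convexHull_erase ha).1 hx).1, inner_rtSum tK ha g hn hx]

/-- Green's formula for Raviart–Thomas fields and smooth functions. -/
theorem IsTriangulation.integral_eq_of_mem_WhF (hT : IsTriangulation Ω T)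
    (hΩ : IsLipschitzDomain Ω) {p : L2Vec Ω × L2 Ω} {f : L2Bdry Ω} (hp : p ∈ WhF Ω T f)
    {φ : Plane → ℝ} (hφ : ContDiff ℝ ∞ φ) :
    ∫ x in Ω, (inner ℝ (p.1 x) (gradient φ x) + p.2 x * φ x) =
      ∫ x in frontier Ω, f x * φ x ∂(Measure.hausdorffMeasure 1 : Measure Plane) := by
  obtain ⟨g, hg, hin, hout⟩ := (hT.mem_WhF_iff hΩ).1 hp
  rw [hg.integral_eq hT hΩ hφ, ← hT.sum_outerSides_add_sum_innerSides, hin φ hφ, add_zero,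
    hT.integral_bdry_eq_sum hΩ]
  · refine Finset.sum_congr rfl fun s hs => ?_
    rw [← integral_const_mul]
    refine integral_congr_ae ?_
    filter_upwards [hout s hs] with x hx
    rw [hx, mul_assoc]
  · exact integrable_mul_of_memLp (Lp.memLp _) (hT.memLp_bdry hΩ hφ.continuous)

/-- Green's formula for Raviart–Thomas fields and functions in `H¹(Ω)`. -/
theorem IsTriangulation.bForm_eq_of_mem_WhF (hT : IsTriangulation Ω T) (hΩ : IsLipschitzDomain Ω)
    {p : L2Vec Ω × L2 Ω} {f : L2Bdry Ω} (hp : p ∈ WhF Ω T f) {v : L2 Ω × L2Vec Ω} (hv : v ∈ H1 Ω) :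
    bForm f v = inner ℝ p.1 v.2 + inner ℝ p.2 v.1 :=
  hT.bForm_eq hΩ (fun _ hφ => hT.integral_eq_of_mem_WhF hΩ hp hφ) hv

/-! ### Fields with prescribed normal component and divergence -/

theorem IsTriangulation.ae_side_of_ae (hT : IsTriangulation Ω T) (hΩ : IsLipschitzDomain Ω)
    {s : Finset Plane × Plane} (hs : s ∈ hT.outerSides) {P : Plane → Prop}
    (h : ∀ᵐ x ∂(Measure.hausdorffMeasure 1 : Measure Plane).restrict (frontier Ω), P x) :
    ∀ᵐ x ∂(Measure.hausdorffMeasure 1 : Measure Plane).restrict (side s), P x :=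
  ae_mono (Measure.restrict_mono (hT.side_subset_frontier hΩ hs) le_rfl) h

theorem IsTriangulation.IsCompatible.add {hT : IsTriangulation Ω T} (hΩ : IsLipschitzDomain Ω)
    {g g' : SideFamily} {f f' : L2Bdry Ω} (h : hT.IsCompatible g f) (h' : hT.IsCompatible g' f') :
    hT.IsCompatible (g + g') (f + f') := by
  refine ⟨fun φ hφ => ?_, fun s hs => ?_⟩
  · have h0 := congrArg₂ (· + ·) (h.1 φ hφ) (h'.1 φ hφ)
    simp only [add_zero, ← Finset.sum_add_distrib] at h0
    rw [← h0]
    refine Finset.sum_congr rfl fun s hs => ?_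
    obtain ⟨h1, h2, -⟩ := hT.mem_innerSides.1 hs
    have hi : ∀ k : Plane →ᵃ[ℝ] ℝ, Integrable (fun x => k x * φ x)
        ((Measure.hausdorffMeasure 1 : Measure Plane).restrict (side s)) := fun k =>
      integrableOn_side (isTri_of_mem_triangles h1) h2 ((continuous_affine k).mul hφ.continuous)
    rw [← mul_add, ← integral_add (hi _) (hi _)]
    congr 2
    funext x
    rw [← add_mul]; rfl
  · filter_upwards [h.2 s hs, h'.2 s hs, hT.ae_side_of_ae hΩ hs (Lp.coeFn_add f f')]
      with x h1 h2 h3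
    rw [h3, Pi.add_apply, h1, h2, ← mul_add]; rfl

theorem IsTriangulation.IsCompatible.smul {hT : IsTriangulation Ω T} (hΩ : IsLipschitzDomain Ω)
    (t : ℝ) {g : SideFamily} {f : L2Bdry Ω} (h : hT.IsCompatible g f) :
    hT.IsCompatible (t • g) (t • f) := by
  refine ⟨fun φ hφ => ?_, fun s hs => ?_⟩
  · rw [← mul_zero t, ← h.1 φ hφ, Finset.mul_sum]
    refine Finset.sum_congr rfl fun s hs => ?_
    rw [mul_left_comm, ← integral_const_mul t]
    congr 2
    funext x
    rw [← mul_assoc]; rfl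
  · filter_upwards [h.2 s hs, hT.ae_side_of_ae hΩ hs (Lp.coeFn_smul t f)] with x h1 h3
    rw [h3, Pi.smul_apply, h1, smul_eq_mul, mul_left_comm]; rfl

theorem IsTriangulation.add_mem_WhF (hT : IsTriangulation Ω T) (hΩ : IsLipschitzDomain Ω)
    {p p' : L2Vec Ω × L2 Ω} {f f' : L2Bdry Ω} (h : p ∈ WhF Ω T f) (h' : p' ∈ WhF Ω T f') :
    p + p' ∈ WhF Ω T (f + f') := by
  obtain ⟨g, h1, h2⟩ := (hT.mem_WhF_iff hΩ).1 h
  obtain ⟨g', h1', h2'⟩ := (hT.mem_WhF_iff hΩ).1 h'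
  exact (hT.mem_WhF_iff hΩ).2 ⟨g + g', h1.add hT hΩ h1', h2.add hΩ h2'⟩

theorem IsTriangulation.smul_mem_WhF (hT : IsTriangulation Ω T) (hΩ : IsLipschitzDomain Ω)
    (t : ℝ) {p : L2Vec Ω × L2 Ω} {f : L2Bdry Ω} (h : p ∈ WhF Ω T f) :
    t • p ∈ WhF Ω T (t • f) := by
  obtain ⟨g, h1, h2⟩ := (hT.mem_WhF_iff hΩ).1 h
  exact (hT.mem_WhF_iff hΩ).2 ⟨t • g, h1.smul hT hΩ t, h2.smul hΩ t⟩

theorem IsTriangulation.isCompatible_zero (hT : IsTriangulation Ω T) (hΩ : IsLipschitzDomain Ω)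
    {g : SideFamily} (hin : ∀ φ : Plane → ℝ, ContDiff ℝ ∞ φ → ∑ s ∈ hT.innerSides, height s *
      ∫ x in side s, g s x * φ x ∂(Measure.hausdorffMeasure 1 : Measure Plane) = 0)
    (hout : ∀ s ∈ hT.outerSides, ∀ x ∈ side s, g s x = 0) : hT.IsCompatible g 0 := by
  refine ⟨hin, fun s hs => ?_⟩
  filter_upwards [hT.ae_side_of_ae hΩ hs (Lp.coeFn_zero ℝ 2
      ((Measure.hausdorffMeasure 1 : Measure Plane).restrict (frontier Ω))),
    ae_restrict_mem (measurableSet_side s)] with x h1 h2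
  rw [h1, hout s hs x h2, mul_zero]; rfl

theorem IsTriangulation.zero_mem_WhF (hT : IsTriangulation Ω T) (hΩ : IsLipschitzDomain Ω) :
    (0 : L2Vec Ω × L2 Ω) ∈ WhF Ω T 0 := by
  refine (hT.mem_WhF_iff hΩ).2 ⟨0, fun K hK => ⟨?_, ?_⟩, hT.isCompatible_zero hΩ ?_ ?_⟩
  · filter_upwards [hT.ae_of_ae hΩ hK (Lp.coeFn_zero Plane 2 (volume.restrict Ω))] with x hx
    have : rtSum 0 K x = 0 := Finset.sum_eq_zero fun a _ => zero_smul ℝ (x - a)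
    rw [this]; exact hx
  · filter_upwards [hT.ae_of_ae hΩ hK (Lp.coeFn_zero ℝ 2 (volume.restrict Ω))] with x hx
    have : divSum 0 K x = 0 := Finset.sum_eq_zero fun a _ => by simp
    rw [this]; exact hx
  · intro φ _
    simp
  · intro s _ x _
    rfl

open Classical in
theorem IsTriangulation.exists_mem_WhF (hT : IsTriangulation Ω T) (hΩ : IsLipschitzDomain Ω)
    {f : L2Bdry Ω} (hf : f ∈ XGamma Ω T) : ∃ p, p ∈ WhF Ω T f := by
  have h : ∀ s : Finset Plane × Plane, ∃ A : Plane →ᵃ[ℝ] ℝ, s ∈ hT.outerSides →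
      (f : Plane → ℝ) =ᵐ[(Measure.hausdorffMeasure 1).restrict (side s)] A := by
    intro s
    by_cases hs : s ∈ hT.outerSides
    · obtain ⟨hK, ha, ho⟩ := hT.mem_outerSides.1 hs
      obtain ⟨A, hA⟩ := hf _ ((hT.mem_boundaryEdges_iff hΩ hK ha).2 ho)
      exact ⟨A, fun _ => hA⟩
    · exact ⟨0, fun h => absurd h hs⟩
  choose A hA using h
  set g : SideFamily := fun s => if s ∈ hT.outerSides then (height s)⁻¹ • A s else 0 with hg
  obtain ⟨p, hp⟩ := hT.exists_isRep hΩ g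
  refine ⟨p, (hT.mem_WhF_iff hΩ).2 ⟨g, hp, fun φ hφ => Finset.sum_eq_zero fun s hs => ?_,
    fun s hs => ?_⟩⟩
  · have hs' : s ∉ hT.outerSides := fun h =>
      (hT.mem_innerSides.1 hs).2.2 (hT.mem_outerSides.1 h).2.2
    simp [hg, hs']
  · refine (hA s hs).trans (Eventually.of_forall fun x => ?_)
    obtain ⟨hK, ha, -⟩ := hT.mem_outerSides.1 hs
    have := height_pos (isTri_of_mem_triangles hK) ha
    simp only [hg, hs, if_true]
    change A s x = height s * ((height s)⁻¹ * A s x)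
    rw [mul_inv_cancel_left₀ this.ne']

/-- Divergences with mean value zero on every triangle. -/
theorem IsTriangulation.exists_bubble (hT : IsTriangulation Ω T) (hΩ : IsLipschitzDomain Ω)
    (ℓ : Finset Plane → Plane →ᵃ[ℝ] ℝ) :
    ∃ q ∈ WhF Ω T 0, ∀ K ∈ triangles T,
      (q.2 : Plane → ℝ) =ᵐ[volume.restrict (convexHull ℝ (K : Set Plane))]
        fun x => ℓ K x - (∑ a ∈ K, ℓ K a) / 3 := by
  set g : SideFamily := fun s => (ℓ s.1 s.2 / 3) • lam s.1 s.2 with hg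
  have hz : ∀ s ∈ hT.sides, ∀ x ∈ side s, g s x = 0 := by
    rintro ⟨K, a⟩ hs x hx
    obtain ⟨hK, ha⟩ := hT.mem_sides.1 hs
    have := (((isTri_of_mem_triangles hK).mem_convexHull_erase ha).1 hx).2
    change ℓ K a / 3 * lam K a x = 0
    rw [this, mul_zero]
  obtain ⟨q, hq⟩ := hT.exists_isRep hΩ g
  refine ⟨q, (hT.mem_WhF_iff hΩ).2 ⟨g, hq, hT.isCompatible_zero hΩ ?_ ?_⟩, fun K hK => ?_⟩
  · intro φ _
    refine Finset.sum_eq_zero fun s hs => ?_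
    obtain ⟨h1, h2, -⟩ := hT.mem_innerSides.1 hs
    rw [setIntegral_eq_zero_of_forall_eq_zero, mul_zero]
    intro x hx
    rw [hz s (hT.mem_sides.2 ⟨h1, h2⟩) x hx, zero_mul]
  · intro s hs
    obtain ⟨h1, h2, -⟩ := hT.mem_outerSides.1 hs
    exact hz s (hT.mem_sides.2 ⟨h1, h2⟩)
  · refine (hq K hK).2.trans (Eventually.of_forall fun x => ?_)
    have tK := isTri_of_mem_triangles hK
    change divSum g K x = ℓ K x - (∑ a ∈ K, ℓ K a) / 3
    rw [divSum, tK.affineMap_eq (ℓ K) x, Finset.sum_div, ← Finset.sum_sub_distrib]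
    refine Finset.sum_congr rfl fun a ha => ?_
    change 3 * (ℓ K a / 3 * lam K a x) - ℓ K a / 3 * lam K a a = lam K a x * ℓ K a - ℓ K a / 3
    rw [tK.lam_self ha]
    ring

/-- The area of a triangle. -/
noncomputable def area (K : Finset Plane) : ℝ := volume.real (convexHull ℝ (K : Set Plane))

theorem two_mul_area (h : IsTri K) (ha : a ∈ K) :
    2 * area K = height (K, a) *
      (Measure.hausdorffMeasure 1 : Measure Plane).real (side (K, a)) := by
  have := integral_cone h ha (Φ := fun _ => 1) contDiff_const
  simpa [area, mul_comm] using this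

theorem area_pos (h : IsTri K) : 0 < area K := by
  refine ENNReal.toReal_pos ?_ (IsTri.isCompact K).measure_lt_top.ne
  exact ((isOpen_interior.measure_pos _ h.interior_nonempty).trans_le
    (measure_mono interior_subset)).ne'

open Classical in
/-- A flux through the common side of two triangles. -/
theorem IsTriangulation.exists_flux (hT : IsTriangulation Ω T) (hΩ : IsLipschitzDomain Ω)
    {K' : Finset Plane} (hK : K ∈ triangles T) (hK' : K' ∈ triangles T) (ha : a ∈ K) (hne : K ≠ K')
    (hsub : K.erase a ⊆ K') :
    ∃ q ∈ WhF Ω T 0, ∀ L ∈ triangles T,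
      (q.2 : Plane → ℝ) =ᵐ[volume.restrict (convexHull ℝ (L : Set Plane))] fun _ =>
        (if L = K' then (area K')⁻¹ else 0) - (if L = K then (area K)⁻¹ else 0) := by
  obtain ⟨a', ha', ha'K, haK', e'⟩ := exists_opposite hK hK' hne ha hsub
  have tK := isTri_of_mem_triangles hK
  have tK' := isTri_of_mem_triangles hK'
  have hside : side (K', a') = side (K, a) := by simp only [side, e']
  set m := (Measure.hausdorffMeasure 1 : Measure Plane).real (side (K, a)) with hm
  have m_pos : 0 < m := ENNReal.toReal_pos (hausdorffMeasure_side_pos (s := (K, a)) tK ha).ne'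
    (hausdorffMeasure_side_lt_top (s := (K, a)) tK ha).ne
  have hh := height_pos tK ha
  have hh' := height_pos tK' ha'
  have ar := two_mul_area tK ha
  have ar' := two_mul_area tK' ha'
  rw [hside] at ar'
  rw [← hm] at ar ar'
  have hpair : (K, a) ≠ (K', a') := fun h => hne (congrArg Prod.fst h)
  have hin1 : (K, a) ∈ hT.innerSides :=
    hT.mem_innerSides.2 ⟨hK, ha, fun ho => hne (ho K' hK' hsub).symm⟩
  have hin2 : (K', a') ∈ hT.innerSides :=
    hT.mem_innerSides.2 ⟨hK', ha', fun ho => hne (ho K hK (e' ▸ Finset.erase_subset _ _))⟩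
  set k : Finset Plane × Plane → ℝ := fun s =>
    (if s = (K', a') then (height (K', a') * m)⁻¹ else 0) -
      (if s = (K, a) then (height (K, a) * m)⁻¹ else 0) with hk
  set g : SideFamily := fun s => AffineMap.const ℝ Plane (k s) with hg
  obtain ⟨q, hq⟩ := hT.exists_isRep hΩ g
  refine ⟨q, (hT.mem_WhF_iff hΩ).2 ⟨g, hq, hT.isCompatible_zero hΩ ?_ ?_⟩, fun L hL => ?_⟩
  · intro φ _
    rw [← Finset.sum_subset (s₁ := {(K, a), (K', a')})]
    · rw [Finset.sum_pair hpair, hside]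
      simp only [hg, AffineMap.const_apply, integral_const_mul, hk, hpair, hpair.symm, if_true,
        if_false]
      field_simp
      ring
    · intro s hs
      rcases Finset.mem_insert.1 hs with rfl | hs
      · exact hin1
      · rw [Finset.mem_singleton.1 hs]; exact hin2
    · intro s _ hs
      have h1 : s ≠ (K, a) := fun h => hs (by simp [h])
      have h2 : s ≠ (K', a') := fun h => hs (by simp [h])
      simp [hg, hk, h1, h2]
  · intro s hs x _
    have ho := (hT.mem_outerSides.1 hs).2.2
    have h1 : s ≠ (K, a) := fun h => (hT.mem_innerSides.1 hin1).2.2 (h ▸ ho)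
    have h2 : s ≠ (K', a') := fun h => (hT.mem_innerSides.1 hin2).2.2 (h ▸ ho)
    simp [hg, hk, h1, h2]
  · refine (hq L hL).2.trans (Eventually.of_forall fun x => ?_)
    have key : ∀ M : Finset Plane, ∀ b ∈ M, ∀ t : ℝ, ∑ c ∈ L, (if (L, c) = (M, b) then t else 0) =
        if L = M then t else 0 := by
      intro M b hb t
      by_cases h : L = M
      · subst h
        simp [hb]
      · simp [h]
    have hd : divSum g L x = 2 * ∑ c ∈ L, k (L, c) := by
      rw [divSum, Finset.mul_sum]
      refine Finset.sum_congr rfl fun c _ => ?_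
      simp only [hg, AffineMap.const_apply]
      ring
    rw [hd, Finset.sum_sub_distrib, key K' a' ha', key K a ha, mul_sub]
    have e1 : (area K)⁻¹ = 2 * (height (K, a) * m)⁻¹ := by
      rw [← ar]
      have := (area_pos tK).ne'
      field_simp
    have e2 : (area K')⁻¹ = 2 * (height (K', a') * m)⁻¹ := by
      rw [← ar']
      have := (area_pos tK').ne'
      field_simp
    rw [e1, e2]
    split_ifs <;> simp

theorem IsTriangulation.exists_common_divergence_add (hT : IsTriangulation Ω T)
    (hΩ : IsLipschitzDomain Ω) {c c' : Finset Plane → ℝ} (t : ℝ)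
    (h : ∃ q ∈ WhF Ω T 0, ∀ L ∈ triangles T,
      (q.2 : Plane → ℝ) =ᵐ[volume.restrict (convexHull ℝ (L : Set Plane))] fun _ => c L)
    (h' : ∃ q ∈ WhF Ω T 0, ∀ L ∈ triangles T,
      (q.2 : Plane → ℝ) =ᵐ[volume.restrict (convexHull ℝ (L : Set Plane))] fun _ => c' L) :
    ∃ q ∈ WhF Ω T 0, ∀ L ∈ triangles T,
      (q.2 : Plane → ℝ) =ᵐ[volume.restrict (convexHull ℝ (L : Set Plane))]
        fun _ => c L + t * c' L := by
  obtain ⟨q, hq, e⟩ := h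
  obtain ⟨q', hq', e'⟩ := h'
  refine ⟨q + t • q', ?_, fun L hL => ?_⟩
  · have := hT.add_mem_WhF hΩ hq (hT.smul_mem_WhF hΩ t hq')
    rwa [smul_zero, add_zero] at this
  · filter_upwards [e L hL, e' L hL, hT.ae_of_ae hΩ hL (Lp.coeFn_add q.2 (t • q'.2)),
      hT.ae_of_ae hΩ hL (Lp.coeFn_smul t q'.2)] with x h1 h2 h3 h4
    change (q.2 + t • q'.2 : L2 Ω) x = _
    rw [h3, Pi.add_apply, h4, Pi.smul_apply, h1, h2, smul_eq_mul]

open Classical in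
/-- Piecewise constant divergences with mean value zero. -/
theorem IsTriangulation.exists_piecewise_const (hT : IsTriangulation Ω T)
    (hΩ : IsLipschitzDomain Ω) (c : Finset Plane → ℝ) (hc : ∑ K ∈ hT.tris, c K * area K = 0) :
    ∃ q ∈ WhF Ω T 0, ∀ L ∈ triangles T,
      (q.2 : Plane → ℝ) =ᵐ[volume.restrict (convexHull ℝ (L : Set Plane))] fun _ => c L := by
  obtain ⟨s₀, hs₀⟩ := hT.outer_nonempty hΩ
  set K₀ := s₀.1
  have hK₀ : K₀ ∈ triangles T := (hT.mem_outerSides.1 hs₀).1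
  have hzero : ∃ q ∈ WhF Ω T 0, ∀ L ∈ triangles T,
      (q.2 : Plane → ℝ) =ᵐ[volume.restrict (convexHull ℝ (L : Set Plane))] fun _ => (0 : ℝ) :=
    ⟨0, hT.zero_mem_WhF hΩ, fun L hL =>
      hT.ae_of_ae hΩ hL (Lp.coeFn_zero ℝ 2 (volume.restrict Ω))⟩
  have hdiff := hT.triangle_induction hΩ (P := fun K => ∃ q ∈ WhF Ω T 0, ∀ L ∈ triangles T,
      (q.2 : Plane → ℝ) =ᵐ[volume.restrict (convexHull ℝ (L : Set Plane))] fun _ =>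
        (if L = K then (area K)⁻¹ else 0) - (if L = K₀ then (area K₀)⁻¹ else 0)) hK₀
    (by simpa only [sub_self] using hzero) fun K hK K' hK' a ha hne hsub hP => by
      have := hT.exists_common_divergence_add hΩ 1 (hT.exists_flux hΩ hK hK' ha hne hsub) hP
      simpa only [one_mul, sub_add_sub_cancel] using this
  have hsum : ∀ S : Finset (Finset Plane), S ⊆ hT.tris → ∃ q ∈ WhF Ω T 0, ∀ L ∈ triangles T,
      (q.2 : Plane → ℝ) =ᵐ[volume.restrict (convexHull ℝ (L : Set Plane))] fun _ =>
        ∑ K ∈ S, c K * area K *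
          ((if L = K then (area K)⁻¹ else 0) - (if L = K₀ then (area K₀)⁻¹ else 0)) := by
    intro S
    induction S using Finset.induction_on with
    | empty => intro _; simpa using hzero
    | insert K S hKS ih =>
      intro hS
      have := hT.exists_common_divergence_add hΩ (c K * area K)
        (ih ((Finset.subset_insert _ _).trans hS))
        (hdiff K (hT.mem_tris.1 (hS (Finset.mem_insert_self _ _))))
      simpa only [Finset.sum_insert hKS, add_comm] using this
  obtain ⟨q, hq, e⟩ := hsum _ subset_rfl
  refine ⟨q, hq, fun L hL => (e L hL).trans (Eventually.of_forall fun x => ?_)⟩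
  have h0 : ∑ K ∈ hT.tris, c K * area K * (if L = K₀ then (area K₀)⁻¹ else 0) = 0 := by
    rw [← Finset.sum_mul, hc, zero_mul]
  simp only [mul_sub, Finset.sum_sub_distrib, h0, sub_zero]
  rw [Finset.sum_eq_single L]
  · rw [if_pos rfl, mul_inv_cancel_right₀ (area_pos (isTri_of_mem_triangles hL)).ne']
  · exact fun K _ hKL => by rw [if_neg hKL.symm, mul_zero]
  · exact fun h => absurd (hT.mem_tris.2 hL) h

theorem integrable_L2 (hb : Bornology.IsBounded Ω) (d : L2 Ω) :
    Integrable d (volume.restrict Ω) := by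
  simpa using integrable_mul_of_memLp (Lp.memLp d)
    (memLp_of_continuous hb (continuous_const (y := (1 : ℝ))))

theorem IsTriangulation.integral_divergence (hT : IsTriangulation Ω T) (hΩ : IsLipschitzDomain Ω)
    {q : L2Vec Ω × L2 Ω} (hq : q ∈ WhF Ω T 0) : ∫ x in Ω, q.2 x = 0 := by
  have h := hT.integral_eq_of_mem_WhF hΩ hq (φ := fun _ => 1) contDiff_const
  have hg : ∀ x : Plane, gradient (fun _ => (1 : ℝ)) x = (0 : Plane) := fun x => by simp [gradient]
  simp only [hg, inner_zero_right, zero_add, mul_one] at h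
  rw [h]
  refine integral_eq_zero_of_ae (Lp.coeFn_zero _ _ _)

theorem IsTriangulation.exists_divergence_eq (hT : IsTriangulation Ω T) (hΩ : IsLipschitzDomain Ω)
    {d : L2 Ω} {ℓ : Finset Plane → Plane →ᵃ[ℝ] ℝ} (hd : ∀ K ∈ triangles T,
      (d : Plane → ℝ) =ᵐ[volume.restrict (convexHull ℝ (K : Set Plane))] ℓ K)
    (h0 : ∫ x in Ω, d x = 0) : ∃ q ∈ WhF Ω T 0, q.2 = d := by
  have hb := hΩ.isBounded
  obtain ⟨q₁, hq₁, e₁⟩ := hT.exists_bubble hΩ ℓ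
  set c : Finset Plane → ℝ := fun K => (∑ a ∈ K, ℓ K a) / 3 with hc
  have hsub : ∀ K ∈ triangles T,
      (fun x => d x - q₁.2 x) =ᵐ[volume.restrict (convexHull ℝ (K : Set Plane))] fun _ => c K := by
    intro K hK
    filter_upwards [hd K hK, e₁ K hK] with x h1 h2
    rw [h1, h2, sub_sub_cancel]
  obtain ⟨q₂, hq₂, e₂⟩ := hT.exists_piecewise_const hΩ c (by
    have h1 : ∫ x in Ω, (d x - q₁.2 x) = 0 := by
      rw [integral_sub (integrable_L2 hb _) (integrable_L2 hb _), h0,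
        hT.integral_divergence hΩ hq₁, sub_zero]
    rw [hT.integral_eq_sum hΩ (F := fun x => d x - q₁.2 x)
      ((integrable_L2 hb _).sub (integrable_L2 hb _))] at h1
    rw [← h1]
    refine Finset.sum_congr rfl fun K hK => ?_
    rw [integral_congr_ae (hsub K (hT.mem_tris.1 hK))]
    simp [area, mul_comm])
  refine ⟨q₁ + q₂, ?_, ?_⟩
  · simpa using hT.add_mem_WhF hΩ hq₁ hq₂
  · refine Lp.ext ((hT.ae_iff hΩ).2 fun K hK => ?_)
    filter_upwards [hsub K hK, e₂ K hK, hT.ae_of_ae hΩ hK (Lp.coeFn_add q₁.2 q₂.2)]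
      with x h1 h2 h3
    change (q₁.2 + q₂.2 : L2 Ω) x = _
    rw [h3, Pi.add_apply, h2, ← h1]
    ring

/-- Admissible fields exist. -/
theorem IsTriangulation.exists_admissible (hT : IsTriangulation Ω T) (hΩ : IsLipschitzDomain Ω)
    {f : L2Bdry Ω} (hf : f ∈ XGamma Ω T) {u : L2 Ω × L2Vec Ω} (hu : IsFEMSolution T f u) :
    ∃ p ∈ WhF Ω T f, p.2 = u.1 := by
  have hb := hΩ.isBounded
  obtain ⟨p₀, hp₀⟩ := hT.exists_mem_WhF hΩ hf
  obtain ⟨g, hg, -⟩ := (hT.mem_WhF_iff hΩ).1 hp₀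
  have hA : ∀ K, ∃ A : Plane →ᵃ[ℝ] ℝ, K ∈ triangles T →
      (u.1 : Plane → ℝ) =ᵐ[volume.restrict (convexHull ℝ (K : Set Plane))] A := by
    intro K
    by_cases hK : K ∈ triangles T
    · obtain ⟨A, hA⟩ := hu.1.2 K hK
      exact ⟨A, fun _ => hA⟩
    · exact ⟨0, fun h => absurd h hK⟩
  choose A hA using hA
  set one := smoothPair hb (contDiff_const (c := (1 : ℝ))) with hone
  have hone_mem : one ∈ Vh Ω T := by
    refine ⟨smoothPair_mem hb _, fun K hK => ⟨AffineMap.const ℝ Plane 1, ?_⟩⟩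
    exact hT.ae_of_ae hΩ hK (memLp_of_continuous hb continuous_const).coeFn_toLp
  have hone2 : one.2 = 0 := by
    refine Lp.ext ?_
    refine (memLp_of_continuous hb (continuous_gradient contDiff_const)).coeFn_toLp.trans ?_
    filter_upwards [Lp.coeFn_zero Plane 2 (volume.restrict Ω)] with x hx
    rw [hx]
    simp [gradient]
  have hd : ∫ x in Ω, (u.1 - p₀.2 : L2 Ω) x = 0 := by
    have h1 := hu.2 one hone_mem
    rw [hT.bForm_eq_of_mem_WhF hΩ hp₀ hone_mem.1, aForm, hone2, inner_zero_right, inner_zero_right,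
      zero_add, zero_add] at h1
    have h2 : inner ℝ one.1 (u.1 - p₀.2) = (0 : ℝ) := by
      rw [real_inner_comm, inner_sub_left, h1, sub_self]
    have h3 := L2.inner_toLp (memLp_of_continuous hb (continuous_const (y := (1 : ℝ))))
      (u.1 - p₀.2)
    rw [show one.1 = (memLp_of_continuous hb (continuous_const (y := (1 : ℝ)))).toLp _ from rfl,
      h3] at h2
    simpa using h2
  obtain ⟨q, hq, hqd⟩ := hT.exists_divergence_eq hΩ (d := u.1 - p₀.2)
    (ℓ := fun K => A K - ∑ a ∈ K, ((3 : ℝ) • g (K, a) - AffineMap.const ℝ Plane (g (K, a) a)))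
    (fun K hK => by
      filter_upwards [hA K hK, (hg K hK).2, hT.ae_of_ae hΩ hK (Lp.coeFn_sub u.1 p₀.2)]
        with x h1 h2 h3
      rw [h3, Pi.sub_apply, h1, h2]
      change _ = A K x - (∑ a ∈ K, ((3 : ℝ) • g (K, a) - AffineMap.const ℝ Plane (g (K, a) a)) :
        Plane →ᵃ[ℝ] ℝ) x
      rw [affineMap_sum_apply]
      rfl) hd
  refine ⟨p₀ + q, ?_, ?_⟩
  · simpa using hT.add_mem_WhF hΩ hp₀ hq
  · rw [Prod.snd_add, hqd, add_sub_cancel]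

/-! ### Finite-dimensional spaces of piecewise functions -/

section Piecewise

variable {α E V ι : Type*} [MeasurableSpace α] [NormedAddCommGroup E] [NormedSpace ℝ E]
  [AddCommGroup V] [Module ℝ V]

/-- The functions in `L²(μ)` that agree almost everywhere for `ν i` with a function parametrized
by `V`. -/
def piecewiseSpace (μ : Measure α) (ν : ι → Measure α) (hν : ∀ i, ν i ≤ μ)
    (ev : V →ₗ[ℝ] α → E) : Submodule ℝ (Lp E 2 μ) where
  carrier := {f | ∀ i, ∃ A, (f : α → E) =ᵐ[ν i] ev A}
  zero_mem' := fun i => ⟨0, by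
    rw [map_zero]; exact ae_mono (hν i) (Lp.coeFn_zero E 2 μ)⟩
  add_mem' := fun {f f'} hf hf' i => by
    obtain ⟨A, hA⟩ := hf i
    obtain ⟨A', hA'⟩ := hf' i
    refine ⟨A + A', ?_⟩
    filter_upwards [hA, hA', ae_mono (hν i) (Lp.coeFn_add f f')] with x h1 h2 h3
    rw [h3, map_add, Pi.add_apply, Pi.add_apply, h1, h2]
  smul_mem' := fun t f hf i => by
    obtain ⟨A, hA⟩ := hf i
    refine ⟨t • A, ?_⟩
    filter_upwards [hA, ae_mono (hν i) (Lp.coeFn_smul t f)] with x h1 h3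
    rw [h3, map_smul, Pi.smul_apply, Pi.smul_apply, h1]

theorem finiteDimensional_piecewiseSpace [Finite ι] [FiniteDimensional ℝ V] (μ : Measure α)
    (ν : ι → Measure α) (hν : ∀ i, ν i ≤ μ) (ev : V →ₗ[ℝ] α → E)
    (h : ∀ P : α → Prop, (∀ i, ∀ᵐ x ∂ν i, P x) → ∀ᵐ x ∂μ, P x) :
    FiniteDimensional ℝ (piecewiseSpace μ ν hν ev) := by
  let G : Submodule ℝ ((ι → V) × Lp E 2 μ) :=
    { carrier := {z | ∀ i, (z.2 : α → E) =ᵐ[ν i] ev (z.1 i)}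
      zero_mem' := fun i => by
        change _ =ᵐ[ν i] ev 0
        rw [map_zero]; exact ae_mono (hν i) (Lp.coeFn_zero E 2 μ)
      add_mem' := fun {z z'} hz hz' i => by
        filter_upwards [hz i, hz' i, ae_mono (hν i) (Lp.coeFn_add z.2 z'.2)] with x h1 h2 h3
        change (z.2 + z'.2 : Lp E 2 μ) x = ev (z.1 i + z'.1 i) x
        rw [h3, map_add, Pi.add_apply, Pi.add_apply, h1, h2]
      smul_mem' := fun t z hz i => by
        filter_upwards [hz i, ae_mono (hν i) (Lp.coeFn_smul t z.2)] with x h1 h3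
        change (t • z.2 : Lp E 2 μ) x = ev (t • z.1 i) x
        rw [h3, map_smul, Pi.smul_apply, Pi.smul_apply, h1] }
  have hinj : Function.Injective ((LinearMap.fst ℝ (ι → V) (Lp E 2 μ)).comp G.subtype) := by
    rintro ⟨⟨A, f⟩, h1⟩ ⟨⟨A', f'⟩, h2⟩ e
    have e' : A = A' := e
    subst e'
    have : f = f' := Lp.ext (h _ fun i => (h1 i).trans (h2 i).symm)
    subst this
    rfl
  have : FiniteDimensional ℝ G := FiniteDimensional.of_injective _ hinj
  refine Submodule.finiteDimensional_of_le (S₂ := G.map (LinearMap.snd ℝ _ _)) fun f hf => ?_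
  choose A hA using hf
  exact ⟨(A, f), hA, rfl⟩

end Piecewise

/-- The function given by an affine map. -/
noncomputable def affineEval : (Plane →ᵃ[ℝ] ℝ) →ₗ[ℝ] Plane → ℝ where
  toFun A := A
  map_add' _ _ := rfl
  map_smul' _ _ := rfl

/-- `rtField` as a linear map. -/
noncomputable def rtEval : ((Plane →ᵃ[ℝ] Plane) × (Plane →ᵃ[ℝ] ℝ)) →ₗ[ℝ] Plane → Plane where
  toFun z := rtField z.1 z.2
  map_add' z w := by
    funext x
    change (z.1 x + w.1 x) + (z.2 x + w.2 x) • x = (z.1 x + z.2 x • x) + (w.1 x + w.2 x • x)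
    module
  map_smul' t z := by
    funext x
    change t • z.1 x + (t * z.2 x) • x = t • (z.1 x + z.2 x • x)
    module

instance finiteDimensional_affineMap {E : Type*} [AddCommGroup E] [Module ℝ E]
    [FiniteDimensional ℝ E] : FiniteDimensional ℝ (Plane →ᵃ[ℝ] E) :=
  (AffineMap.toConstProdLinearMap (R := ℝ) (V1 := Plane) (V2 := E)).symm.finiteDimensional

theorem IsTriangulation.xGamma_eq (hT : IsTriangulation Ω T) (hΩ : IsLipschitzDomain Ω) :
    ∃ X : Submodule ℝ (L2Bdry Ω), FiniteDimensional ℝ X ∧ (X : Set (L2Bdry Ω)) = XGamma Ω T := by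
  have hν : ∀ e : boundaryEdges Ω T,
      ((Measure.hausdorffMeasure 1 : Measure Plane).restrict (convexHull ℝ (e.1 : Set Plane))) ≤
        (Measure.hausdorffMeasure 1).restrict (frontier Ω) :=
    fun e => Measure.restrict_mono e.2.2.2 le_rfl
  have : Finite (boundaryEdges Ω T) :=
    (hT.finite_faces.subset fun e (he : e ∈ boundaryEdges Ω T) => he.1).to_subtype
  refine ⟨piecewiseSpace _ _ hν affineEval, finiteDimensional_piecewiseSpace _ _ _ _ fun P hP => ?_,
    ?_⟩
  · rw [hT.hausdorffMeasure_restrict_eq_sum hΩ, MeasureTheory.ae_finsetSum_measure_iff]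
    intro s hs
    obtain ⟨h1, h2, h3⟩ := hT.mem_outerSides.1 hs
    exact hP ⟨_, (hT.mem_boundaryEdges_iff hΩ h1 h2).2 h3⟩
  · ext f
    exact ⟨fun h e he => h ⟨e, he⟩, fun h e => h e.1 e.2⟩

theorem eq_zero_of_weak_gradient (hΩ : IsLipschitzDomain Ω) {w : L2Vec Ω}
    (h : ((0 : L2 Ω), w) ∈ H1 Ω) : w = 0 := by
  have hb := hΩ.isBounded
  have hi : Integrable (w : Plane → Plane) (volume.restrict Ω) := by
    simpa using integrable_smul_of_memLp
      (memLp_of_continuous hb (continuous_const (y := (1 : ℝ)))) (Lp.memLp w)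
  have hae := hΩ.isOpen.ae_eq_zero_of_integral_contDiff_smul_eq_zero
    (hi.integrableOn.locallyIntegrableOn) fun φ h1 h2 h3 => by
      have e := h φ ⟨h1, h2, h3⟩
      have e0 : ∫ x in Ω, (0 : L2 Ω) x • gradient φ x = 0 := by
        refine integral_eq_zero_of_ae ?_
        filter_upwards [Lp.coeFn_zero ℝ 2 (volume.restrict Ω)] with x hx
        rw [hx]; simp
      rw [e0] at e
      exact neg_eq_zero.1 e.symm
  refine Lp.ext ?_
  filter_upwards [hae, ae_restrict_mem hΩ.isOpen.measurableSet,
    Lp.coeFn_zero Plane 2 (volume.restrict Ω)] with x h1 h2 h3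
  rw [h1 h2, h3]; rfl

theorem IsTriangulation.vh_eq (hT : IsTriangulation Ω T) (hΩ : IsLipschitzDomain Ω) :
    ∃ X : Submodule ℝ (L2 Ω × L2Vec Ω), FiniteDimensional ℝ X ∧
      (X : Set (L2 Ω × L2Vec Ω)) = Vh Ω T := by
  have hν : ∀ K : triangles T, (volume.restrict (convexHull ℝ (K.1 : Set Plane)) : Measure Plane) ≤
      volume.restrict Ω := fun K => hT.volume_restrict_le hΩ K.2
  have : Finite (triangles T) := hT.finite_triangles.to_subtype
  let P := piecewiseSpace (volume.restrict Ω) _ hν affineEval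
  have hP : FiniteDimensional ℝ P := finiteDimensional_piecewiseSpace _ _ _ _ fun Q hQ =>
    (hT.ae_iff hΩ).2 fun K hK => hQ ⟨K, hK⟩
  let X := h1Submodule hΩ.isBounded ⊓ P.comap (LinearMap.fst ℝ (L2 Ω) (L2Vec Ω))
  have hinj : Function.Injective (((LinearMap.fst ℝ (L2 Ω) (L2Vec Ω)).comp X.subtype).codRestrict P
      fun v => v.2.2) := by
    rw [injective_iff_map_eq_zero]
    rintro ⟨⟨u, w⟩, h1, h2⟩ e
    have e' : u = 0 := congrArg Subtype.val e
    subst e'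
    have : w = 0 := eq_zero_of_weak_gradient hΩ h1
    subst this
    rfl
  refine ⟨X, FiniteDimensional.of_injective _ hinj, ?_⟩
  ext v
  exact ⟨fun h => ⟨h.1, fun K hK => h.2 ⟨K, hK⟩⟩, fun h => ⟨h.1, fun K => h.2 K.1 K.2⟩⟩

theorem IsTriangulation.exists_rtSpace (hT : IsTriangulation Ω T) (hΩ : IsLipschitzDomain Ω) :
    ∃ X : Submodule ℝ (L2Vec Ω), FiniteDimensional ℝ X ∧ ∀ p ∈ Wh Ω T, p.1 ∈ X := by
  have hν : ∀ K : triangles T, (volume.restrict (convexHull ℝ (K.1 : Set Plane)) : Measure Plane) ≤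
      volume.restrict Ω := fun K => hT.volume_restrict_le hΩ K.2
  have : Finite (triangles T) := hT.finite_triangles.to_subtype
  refine ⟨piecewiseSpace (volume.restrict Ω) _ hν rtEval,
    finiteDimensional_piecewiseSpace _ _ _ _ fun Q hQ =>
      (hT.ae_iff hΩ).2 fun K hK => hQ ⟨K, hK⟩, fun p hp K => ?_⟩
  obtain ⟨A, c, h⟩ := hp.2 K.1 K.2
  exact ⟨(A, c), h⟩

/-! ### The finite element solution -/

/-- `a` as a bilinear form. -/
noncomputable def aBilin (Ω : Set Plane) : (L2 Ω × L2Vec Ω) →ₗ[ℝ] (L2 Ω × L2Vec Ω) →ₗ[ℝ] ℝ :=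
  LinearMap.mk₂ ℝ aForm
    (fun u v w => by simp only [aForm, Prod.fst_add, Prod.snd_add, inner_add_left]; ring)
    (fun t u v => by
      simp only [aForm, Prod.smul_fst, Prod.smul_snd, real_inner_smul_left, smul_eq_mul]; ring)
    (fun u v w => by simp only [aForm, Prod.fst_add, Prod.snd_add, inner_add_right]; ring)
    (fun t u v => by
      simp only [aForm, Prod.smul_fst, Prod.smul_snd, real_inner_smul_right, smul_eq_mul]; ring)

theorem aForm_sub_left (u v w : L2 Ω × L2Vec Ω) : aForm (u - v) w = aForm u w - aForm v w :=
  LinearMap.map_sub₂ (aBilin Ω) u v w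

theorem eq_zero_of_aForm_self {w : L2 Ω × L2Vec Ω} (h : aForm w w = 0) : w = 0 := by
  rw [aForm, real_inner_self_eq_norm_sq, real_inner_self_eq_norm_sq] at h
  have h1 : ‖w.1‖ = 0 := by nlinarith [sq_nonneg ‖w.1‖, sq_nonneg ‖w.2‖]
  have h2 : ‖w.2‖ = 0 := by nlinarith [sq_nonneg ‖w.1‖, sq_nonneg ‖w.2‖]
  exact Prod.ext (norm_eq_zero.1 h1) (norm_eq_zero.1 h2)

theorem IsTriangulation.isFEMSolution_unique (hT : IsTriangulation Ω T)
    (hΩ : IsLipschitzDomain Ω) {f : L2Bdry Ω} {u u' : L2 Ω × L2Vec Ω} (h : IsFEMSolution T f u)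
    (h' : IsFEMSolution T f u') : u = u' := by
  obtain ⟨X, -, hX⟩ := hT.vh_eq hΩ
  have hX' : ∀ {v}, v ∈ Vh Ω T ↔ v ∈ X := fun {v} => by rw [← hX]; rfl
  have hmem : u - u' ∈ Vh Ω T := hX'.2 (X.sub_mem (hX'.1 h.1) (hX'.1 h'.1))
  refine sub_eq_zero.1 (eq_zero_of_aForm_self ?_)
  rw [aForm_sub_left, h.2 _ hmem, h'.2 _ hmem, sub_self]

theorem IsTriangulation.exists_isFEMSolution (hT : IsTriangulation Ω T)
    (hΩ : IsLipschitzDomain Ω) {f : L2Bdry Ω} (hf : f ∈ XGamma Ω T) :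
    ∃ u, IsFEMSolution T f u := by
  obtain ⟨X, hfin, hX⟩ := hT.vh_eq hΩ
  obtain ⟨p, hp⟩ := hT.exists_mem_WhF hΩ hf
  let B : X →ₗ[ℝ] Module.Dual ℝ X := (aBilin Ω).compl₁₂ X.subtype X.subtype
  have hinj : Function.Injective B := by
    rw [injective_iff_map_eq_zero]
    intro w hw
    exact Subtype.ext (eq_zero_of_aForm_self (LinearMap.congr_fun hw w))
  have hsurj : Function.Surjective B :=
    (LinearMap.injective_iff_surjective_of_finrank_eq_finrank
      (Subspace.dual_finrank_eq (K := ℝ) (V := X)).symm).1 hinj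
  let l : Module.Dual ℝ X :=
    (((innerₛₗ ℝ p.1).comp (LinearMap.snd ℝ _ _)) +
      ((innerₛₗ ℝ p.2).comp (LinearMap.fst ℝ _ _))).comp
      X.subtype
  obtain ⟨u, hu⟩ := hsurj l
  refine ⟨u, hX ▸ u.2, fun v hv => ?_⟩
  have hvX : v ∈ X := by rw [← hX] at hv; exact hv
  rw [hT.bForm_eq_of_mem_WhF hΩ hp hv.1]
  exact LinearMap.congr_fun hu ⟨v, hvX⟩

/-! ### Minimal elements of fibres -/

/-- In a finite-dimensional linear relation, an element of minimal norm of the fibre can be chosen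
linearly. -/
theorem exists_linear_minimizer {F E : Type*} [AddCommGroup F] [Module ℝ F]
    [NormedAddCommGroup E] [InnerProductSpace ℝ E] (S : Submodule ℝ (F × E))
    [FiniteDimensional ℝ S] :
    ∃ L : S.map (LinearMap.fst ℝ F E) →ₗ[ℝ] E, ∀ f : S.map (LinearMap.fst ℝ F E),
      ((f : F), L f) ∈ S ∧ ∀ e, ((f : F), e) ∈ S → ‖L f‖ ≤ ‖e‖ := by
  let π : S →ₗ[ℝ] S.map (LinearMap.fst ℝ F E) :=
    ((LinearMap.fst ℝ F E).comp S.subtype).codRestrict _ fun z => ⟨z, z.2, rfl⟩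
  have hπ : Function.Surjective π := by
    rintro ⟨_, z, hz, rfl⟩
    exact ⟨⟨z, hz⟩, rfl⟩
  obtain ⟨s, hs⟩ := π.exists_rightInverse_of_surjective (LinearMap.range_eq_top.2 hπ)
  let N : Submodule ℝ E := S.comap (LinearMap.inr ℝ F E)
  have hN : FiniteDimensional ℝ N := by
    refine FiniteDimensional.of_injective
      (((LinearMap.inr ℝ F E).comp N.subtype).codRestrict S fun n => n.2) ?_
    intro n n' e
    exact Subtype.ext (congrArg (fun z : S => z.1.2) e)
  have hs1 : ∀ f, ((s f).1).1 = (f : F) := fun f => congrArg Subtype.val (LinearMap.congr_fun hs f)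
  let D : S.map (LinearMap.fst ℝ F E) →ₗ[ℝ] E := ((LinearMap.snd ℝ F E).comp S.subtype).comp s
  have hD : ∀ f : S.map (LinearMap.fst ℝ F E), ((f : F), D f) ∈ S := fun f => by
    have := (s f).2
    rwa [show (s f).1 = ((f : F), D f) from Prod.ext (hs1 f) rfl] at this
  refine ⟨D - N.starProjection.toLinearMap.comp D, fun f => ⟨?_, fun e he => ?_⟩⟩
  · have h1 : N.starProjection (D f) ∈ N := N.starProjection_apply_mem _
    have h2 := S.sub_mem (hD f) (show ((0 : F), N.starProjection (D f)) ∈ S from h1)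
    simpa using h2
  · have h1 : e - D f ∈ N := by
      have := S.sub_mem he (hD f)
      simpa [N] using this
    have h2 : (D - N.starProjection.toLinearMap.comp D) f = e - N.starProjection e := by
      have h3 := N.starProjection_eq_self_iff.2 h1
      rw [map_sub] at h3
      change D f - N.starProjection (D f) = _
      refine sub_eq_zero.1 (Eq.trans ?_ (sub_eq_zero.2 h3))
      abel
    rw [h2, ← Submodule.starProjection_orthogonal_val]
    exact Submodule.norm_starProjection_apply_le _ e

theorem exists_max_ratio {F E : Type*} [NormedAddCommGroup F] [NormedSpace ℝ F]
    [FiniteDimensional ℝ F] [Nontrivial F] [NormedAddCommGroup E] [NormedSpace ℝ E]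
    (L : F →ₗ[ℝ] E) : ∃ f₀ : F, f₀ ≠ 0 ∧ ∀ f : F, ‖L f‖ / ‖f‖ ≤ ‖L f₀‖ / ‖f₀‖ := by
  have hc : Continuous fun f => ‖L f‖ := (L.continuous_of_finiteDimensional).norm
  have : ProperSpace F := FiniteDimensional.proper_real F
  obtain ⟨f₀, hf₀, hmax⟩ := (isCompact_sphere (0 : F) 1).exists_isMaxOn
    (NormedSpace.sphere_nonempty.2 zero_le_one) hc.continuousOn
  have hn : ‖f₀‖ = 1 := by simpa using hf₀
  refine ⟨f₀, fun h => by simp [h] at hn, fun f => ?_⟩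
  rw [hn, div_one]
  by_cases hf : f = 0
  · simp [hf]
  · have hf' : ‖f‖ ≠ 0 := norm_ne_zero_iff.2 hf
    have h1 : ‖f‖⁻¹ • f ∈ Metric.sphere (0 : F) 1 := by
      simp [norm_smul, hf']
    have h2 := hmax h1
    simp only [mem_ofPred_eq, map_smul, norm_smul, norm_inv, norm_norm] at h2
    rwa [inv_mul_eq_div] at h2

/-! ### The hypercircle identity and the error estimate -/

theorem h1Norm_sq (u : L2 Ω × L2Vec Ω) : h1Norm u ^ 2 = ‖u.1‖ ^ 2 + ‖u.2‖ ^ 2 :=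
  Real.sq_sqrt (by positivity)

theorem IsTriangulation.hypercircle (hT : IsTriangulation Ω T) (hΩ : IsLipschitzDomain Ω)
    {f : L2Bdry Ω} {u uh : L2 Ω × L2Vec Ω} (hu : IsWeakSolution f u) (huh : IsFEMSolution T f uh)
    {p : L2Vec Ω × L2 Ω} (hp : p ∈ WhF Ω T f) (hpu : p.2 = uh.1) :
    ‖uh.2 - p.1‖ ^ 2 = h1Norm (u - uh) ^ 2 + ‖u.2 - p.1‖ ^ 2 + ‖u.1 - uh.1‖ ^ 2 := by
  have hv : u - uh ∈ H1 Ω := (h1Submodule hΩ.isBounded).sub_mem hu.1 huh.1.1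
  have h1 := hu.2 _ hv
  rw [hT.bForm_eq_of_mem_WhF hΩ hp hv, aForm, hpu] at h1
  simp only [Prod.fst_sub, Prod.snd_sub] at h1
  have h2 : inner ℝ (u.2 - p.1) (u.2 - uh.2) = -‖u.1 - uh.1‖ ^ 2 := by
    have h3 : inner ℝ (u.1 - uh.1) (u.1 - uh.1) = ‖u.1 - uh.1‖ ^ 2 := real_inner_self_eq_norm_sq _
    rw [inner_sub_left] at h3 ⊢
    linarith
  have h4 : uh.2 - p.1 = (u.2 - p.1) - (u.2 - uh.2) := by abel
  rw [h4, norm_sub_sq_real, h2, h1Norm_sq, Prod.fst_sub, Prod.snd_sub]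
  ring

/-- The pairs of a datum `f` and a difference `∇u_h - p_h` for an admissible field `p_h`. -/
theorem IsTriangulation.exists_residualSpace (hT : IsTriangulation Ω T)
    (hΩ : IsLipschitzDomain Ω) :
    ∃ S : Submodule ℝ (L2Bdry Ω × L2Vec Ω), FiniteDimensional ℝ S ∧
      (∀ f e, (f, e) ∈ S ↔ f ∈ XGamma Ω T ∧ ∃ u p, IsFEMSolution T f u ∧ p ∈ WhF Ω T f ∧
        p.2 = u.1 ∧ e = u.2 - p.1) := by
  obtain ⟨X, hXfin, hX⟩ := hT.xGamma_eq hΩ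
  obtain ⟨V, hVfin, hV⟩ := hT.vh_eq hΩ
  obtain ⟨R, hRfin, hR⟩ := hT.exists_rtSpace hΩ
  have hX' : ∀ {f}, f ∈ XGamma Ω T ↔ f ∈ X := fun {f} => by rw [← hX]; rfl
  have hV' : ∀ {v}, v ∈ Vh Ω T ↔ v ∈ V := fun {v} => by rw [← hV]; rfl
  let S : Submodule ℝ (L2Bdry Ω × L2Vec Ω) :=
    { carrier := {z | z.1 ∈ XGamma Ω T ∧ ∃ u p, IsFEMSolution T z.1 u ∧ p ∈ WhF Ω T z.1 ∧
        p.2 = u.1 ∧ z.2 = u.2 - p.1}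
      zero_mem' := ⟨hX'.2 X.zero_mem, 0, 0, ⟨hV'.2 V.zero_mem, fun v _ => by
        simp [aForm, bForm]⟩, hT.zero_mem_WhF hΩ, rfl, by simp⟩
      add_mem' := by
        rintro ⟨f, e⟩ ⟨f', e'⟩ ⟨hf, u, p, hu, hp, h1, h2⟩ ⟨hf', u', p', hu', hp', h1', h2'⟩
        refine ⟨hX'.2 (X.add_mem (hX'.1 hf) (hX'.1 hf')), u + u', p + p',
          ⟨hV'.2 (V.add_mem (hV'.1 hu.1) (hV'.1 hu'.1)), fun v hv => ?_⟩,
          hT.add_mem_WhF hΩ hp hp', ?_, ?_⟩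
        · have e1 := hu.2 v hv
          have e2 := hu'.2 v hv
          simp only [aForm, bForm, Prod.fst_add, Prod.snd_add, inner_add_left] at e1 e2 ⊢
          linarith
        · rw [Prod.snd_add, h1, h1', Prod.fst_add]
        · change e + e' = u.2 + u'.2 - (p.1 + p'.1)
          rw [show e = u.2 - p.1 from h2, show e' = u'.2 - p'.1 from h2']
          abel
      smul_mem' := by
        rintro t ⟨f, e⟩ ⟨hf, u, p, hu, hp, h1, h2⟩
        refine ⟨hX'.2 (X.smul_mem t (hX'.1 hf)), t • u, t • p,
          ⟨hV'.2 (V.smul_mem t (hV'.1 hu.1)), fun v hv => ?_⟩, hT.smul_mem_WhF hΩ t hp, ?_, ?_⟩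
        · have e1 := hu.2 v hv
          simp only [aForm, bForm, Prod.smul_fst, Prod.smul_snd, real_inner_smul_left] at e1 ⊢
          rw [← e1]
          ring
        · rw [Prod.smul_snd, h1, Prod.smul_fst]
        · change t • e = t • u.2 - t • p.1
          rw [show e = u.2 - p.1 from h2, smul_sub] }
  refine ⟨S, ?_, fun f e => Iff.rfl⟩
  have hle : S ≤ X.prod (V.map (LinearMap.snd ℝ _ _) ⊔ R) := by
    rintro ⟨f, e⟩ ⟨hf, u, p, hu, hp, h1, h2⟩
    refine ⟨hX'.1 hf, ?_⟩
    rw [show e = u.2 - p.1 from h2]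
    exact Submodule.sub_mem _ (Submodule.mem_sup_left ⟨u, hV'.1 hu.1, rfl⟩)
      (Submodule.mem_sup_right (hR p hp.1))
  have : FiniteDimensional ℝ (X.prod (V.map (LinearMap.snd ℝ _ _) ⊔ R)) := by
    rw [FiniteDimensional, Module.Finite.iff_fg]
    exact (Module.Finite.iff_fg.1 hXfin).prod (Module.Finite.iff_fg.1 inferInstance)
  exact Submodule.finiteDimensional_of_le hle

theorem IsTriangulation.exists_ne_zero_mem_xGamma (hT : IsTriangulation Ω T)
    (hΩ : IsLipschitzDomain Ω) : ∃ f ∈ XGamma Ω T, f ≠ 0 := by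
  have hm := hT.memLp_bdry hΩ (continuous_const (y := (1 : ℝ)))
  refine ⟨hm.toLp _, fun e he => ⟨AffineMap.const ℝ Plane 1, ?_⟩, fun h => ?_⟩
  · exact ae_mono (Measure.restrict_mono he.2.2 le_rfl) hm.coeFn_toLp
  · have h1 := hm.coeFn_toLp
    rw [h] at h1
    have h2 : ∀ᵐ x ∂(Measure.hausdorffMeasure 1 : Measure Plane).restrict (frontier Ω), False := by
      filter_upwards [h1, Lp.coeFn_zero ℝ 2
        ((Measure.hausdorffMeasure 1 : Measure Plane).restrict (frontier Ω))] with x h3 h4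
      rw [h4] at h3
      exact zero_ne_one h3
    have h3 := MeasureTheory.ae_iff.1 h2
    simp only [not_false_eq_true, ofPred_true, Measure.restrict_apply_univ] at h3
    exact (hT.hausdorffMeasure_frontier_pos hΩ).ne' h3

end Hypercircle

/-- Besides the hypercircle identity and the error estimate, the statement records that the minima
and the maximum in the definition of `κ_h` exist. -/
theorem mainTheorem4 (Ω : Set Plane) (hΩ : IsLipschitzDomain Ω)
    (T : Geometry.SimplicialComplex ℝ Plane) (hT : IsTriangulation Ω T) :
    (∀ f ∈ XGamma Ω T, ∀ u uh : L2 Ω × L2Vec Ω, IsWeakSolution f u → IsFEMSolution T f uh →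
      (∀ p ∈ WhF Ω T f, p.2 = uh.1 →
        ‖uh.2 - p.1‖ ^ 2 = h1Norm (u - uh) ^ 2 + ‖u.2 - p.1‖ ^ 2 + ‖u.1 - uh.1‖ ^ 2) ∧
      h1Norm (u - uh) ≤ kappa Ω T * ‖f‖) ∧
    (∀ f ∈ XGamma Ω T, f ≠ 0 → ∃ m, IsLeast (ratios T f) m) ∧
    IsGreatest {m | ∃ f ∈ XGamma Ω T, f ≠ 0 ∧ IsLeast (ratios T f) m} (kappa Ω T) := by
  obtain ⟨S, hSfin, hS⟩ := hT.exists_residualSpace hΩ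
  obtain ⟨L, hL⟩ := exists_linear_minimizer S
  have hmem : ∀ f ∈ XGamma Ω T, f ∈ S.map (LinearMap.fst ℝ (L2Bdry Ω) (L2Vec Ω)) := by
    intro f hf
    obtain ⟨u, hu⟩ := hT.exists_isFEMSolution hΩ hf
    obtain ⟨p, hp, hpu⟩ := hT.exists_admissible hΩ hf hu
    exact ⟨(f, u.2 - p.1), (hS _ _).2 ⟨hf, u, p, hu, hp, hpu, rfl⟩, rfl⟩
  have hleast : ∀ f : S.map (LinearMap.fst ℝ (L2Bdry Ω) (L2Vec Ω)),
      IsLeast (ratios T (f : L2Bdry Ω)) (‖L f‖ / ‖f‖) := by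
    intro f
    constructor
    · obtain ⟨-, u, p, hu, hp, hpu, he⟩ := (hS _ _).1 (hL f).1
      exact ⟨u, p, hu, hp, hpu, by rw [he]; rfl⟩
    · rintro _ ⟨u, p, hu, hp, hpu, rfl⟩
      have hf := ((hS _ _).1 (hL f).1).1
      exact div_le_div_of_nonneg_right
        ((hL f).2 _ ((hS _ _).2 ⟨hf, u, p, hu, hp, hpu, rfl⟩)) (norm_nonneg _)
  obtain ⟨f₁, hf₁, hf₁0⟩ := hT.exists_ne_zero_mem_xGamma hΩ
  have : Nontrivial (S.map (LinearMap.fst ℝ (L2Bdry Ω) (L2Vec Ω))) :=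
    ⟨⟨⟨f₁, hmem f₁ hf₁⟩, 0, fun h => hf₁0 (congrArg Subtype.val h)⟩⟩
  obtain ⟨f₀, hf₀, hmax⟩ := exists_max_ratio L
  have hgreat : ∀ M : Set ℝ, M = {m | ∃ f ∈ XGamma Ω T, f ≠ 0 ∧ IsLeast (ratios T f) m} →
      IsGreatest M (‖L f₀‖ / ‖f₀‖) := by
    rintro M rfl
    refine ⟨⟨f₀, ((hS _ _).1 (hL f₀).1).1, fun h => hf₀ (Subtype.ext h), hleast f₀⟩, ?_⟩
    rintro m ⟨f, hf, -, hm⟩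
    rw [hm.unique (hleast ⟨f, hmem f hf⟩)]
    exact hmax _
  have hkappa : kappa Ω T = ‖L f₀‖ / ‖f₀‖ := by
    refine (hgreat _ ?_).csSup_eq
    ext m
    refine exists_congr fun f => and_congr_right fun hf => and_congr_right fun _ => ?_
    have hl := hleast ⟨f, hmem f hf⟩
    exact ⟨fun h => by rw [h, hl.csInf_eq]; exact hl, fun h => h.csInf_eq.symm⟩
  refine ⟨fun f hf u uh hu huh => ⟨fun p hp hpu => hT.hypercircle hΩ hu huh hp hpu, ?_⟩,
    fun f hf _ => ⟨_, hleast ⟨f, hmem f hf⟩⟩, hkappa ▸ hgreat _ rfl⟩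
  by_cases hf0 : f = 0
  · subst hf0
    have hb0 : ∀ v : L2 Ω × L2Vec Ω, bForm (0 : L2Bdry Ω) v = 0 := fun v => inner_zero_left _
    rw [eq_zero_of_aForm_self ((hu.2 u hu.1).trans (hb0 u)),
      eq_zero_of_aForm_self ((huh.2 uh huh.1).trans (hb0 uh))]
    simp [h1Norm]
  · obtain ⟨-, u', p, hu', hp, hpu, he⟩ := (hS _ _).1 (hL ⟨f, hmem f hf⟩).1
    obtain rfl := hT.isFEMSolution_unique hΩ huh hu'
    have hid := hT.hypercircle hΩ hu huh hp hpu
    have h1 : h1Norm (u - uh) ≤ ‖L ⟨f, hmem f hf⟩‖ := by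
      rw [he]
      refine abs_le_of_sq_le_sq' ?_ (norm_nonneg _) |>.2
      rw [hid]
      nlinarith [sq_nonneg ‖u.2 - p.1‖, sq_nonneg ‖u.1 - uh.1‖]
    have h2 := hmax ⟨f, hmem f hf⟩
    rw [← hkappa, div_le_iff₀ (norm_pos_iff.2 fun h => hf0 (congrArg Subtype.val h))] at h2
    exact h1.trans h2
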